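/- Let $K$ be an algebraic number field with ring of integers $\mathfrak o$, class number $h_K=1$ and at most one real place. Let $\mathbb A_f$ be the ring of finite adeles, $\mathbb A=K_\infty\times\mathbb A_f$ the ring of adeles, $\hat{\mathfrak o}=\prod_\nu\mathfrak o_\nu\subset\mathbb A_f$ (product over the finite places), and let $U=\overline{K^\times K_{\infty,+}^\times}\subset\mathbb A^*$, where $K_{\infty,+}^\times$ is the connected component of $1$ in $K_\infty^\times$; $\mathbb A_f^*$ is embedded in $\mathbb A^*$ with $1$ at the infinite places. Let $X=\mathbb A^*/U\times_{\hat{\mathfrak o}^*}\mathbb A_f$ be the quotient of $\mathbb A^*/U\times\mathbb A_f$ by $(x,y)\sim(rx,r^{-1}y)$ for $r\in\hat{\mathfrak o}^*$, let $Y\subset X$ be the image of $\mathbb A^*/U\times\hat{\mathfrak o}$, and let $\mathbb A_f^*/\hat{\mathfrak o}^*$ act on $X$ by $z\cdot[(x,y)]=[(z^{-1}x,zy)]$. Let $y\sim y'$ in $\mathbb A_f$ if and only if $y\in(\hat{\mathfrak o}^*\cap U)\,y'$, and let $\varphi^*:\mathbb A_f/\!\sim\;\to X$, $[y]\mapsto[(1,y)]$.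 All crossed products are full crossed products by discrete groups, and $f\delta_g$ denotes their standard elements. Then $Y\subset X$ and $\hat{\mathfrak o}/\!\sim\;\subset\mathbb A_f/\!\sim$ are compact and open and closed; put $\mathcal A=1_Y\big(C_0(X)\rtimes\mathbb A_f^*/\hat{\mathfrak o}^*\big)1_Y$. Put $G=K^\times$ if $K$ has no real place, and $G=K^\times_{>0}=\{\lambda\in K^\times:\sigma(\lambda)>0\}$ if $K$ has a real place, with real embedding $\sigma$; let $G/(G\cap\mathfrak o^*)$ act on $\mathbb A_f/\!\sim$ by multiplication. Then: (1) $\varphi^*$ is a homeomorphism and induces a *-isomorphism $$C_0(X)\rtimes\mathbb A_f^*/\hat{\mathfrak o}^*\;\cong\;C_0(\mathbb A_f/\!\sim)\rtimes G/(G\cap\mathfrak o^*),\qquad f\,\delta_{[\lambda]}\mapsto(f\circ\varphi^*)\,\delta_{[\lambda]}\quad(f\in C_0(X),\ \lambda\in G),$$ which restricts to a *-isomorphism $$\mathcal A\;\cong\;1_{\hat{\mathfrak o}/\sim}\big(C_0(\mathbb A_f/\!\sim)\rtimes G/(G\cap\mathfrak o^*)\big)1_{\hat{\mathfrak o}/\sim}.$$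 (2) $\mathcal A$ embeds into $\mathfrak A[\mathfrak o]$, the universal C*-algebra generated by isometries $s_m$ ($0\ne m\in\mathfrak o$) and unitaries $u^n$ ($n\in\mathfrak o$) with the relations $s_ks_m=s_{km}$, $u^lu^n=u^{l+n}$, $s_mu^n=u^{mn}s_m$ and $\sum_{n+(m)\in\mathfrak o/(m)}u^ns_ms_m^*u^{-n}=1$. More precisely, there are a group homomorphism $\tau:\mathbb A_f^*/\hat{\mathfrak o}^*\to K^\times$ with values in $G$ and $[\tau(z)]=z$ for all $z$, a unital *-homomorphism $\alpha:C(\hat{\mathfrak o})\to\mathfrak A[\mathfrak o]$ with $\alpha(1_{n+m\hat{\mathfrak o}})=u^ns_ms_m^*u^{-n}$ for all $m\ne0$ and $n$ in $\mathfrak o$, and an injective *-homomorphism $\Phi:\mathcal A\to\mathfrak A[\mathfrak o]$ such that $$\Phi\big(1_Y(f\delta_z)1_Y\big)=\alpha\big(y\mapsto f([(1,y)])\big)\,s_b^*s_a$$ for all $f\in C_0(X)$, all $z\in\mathbb A_f^*/\hat{\mathfrak o}^*$ and all nonzero $a,b\in\mathfrak o$ with $\tau(z)=a/b$. -/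

import Mathlib

open scoped ENNReal NumberField ZeroAtInfty nonZeroDivisors
open NumberField IsDedekindDomain

noncomputable section

universe u

namespace BostConnes

/-! ### Full crossed products by discrete groups -/

/-- A covariant representation of a C*-dynamical system `(A, G, α)` with `G` discrete, on a complex
Hilbert space `H`. -/
structure CovariantRep {A G : Type u} [NonUnitalCStarAlgebra A] [Group G]
    (α : G →* (A →⋆ₙₐ[ℂ] A)) : Type (u + 1) where
  H : Type u
  [normed : NormedAddCommGroup H]
  [inner : InnerProductSpace ℂ H]
  [complete : CompleteSpace H]
  π : A →⋆ₙₐ[ℂ] (H →L[ℂ] H)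
  V : G →* unitary (H →L[ℂ] H)
  covariant : ∀ (g : G) (a : A),
    (V g : H →L[ℂ] H) * π a * star (V g : H →L[ℂ] H) = π (α g a)

attribute [instance] CovariantRep.normed CovariantRep.inner CovariantRep.complete

section CrossedProduct

variable {A G : Type u} [NonUnitalCStarAlgebra A] [Group G] (α : G →* (A →⋆ₙₐ[ℂ] A))

/-- The `ℓ^∞`-direct sum of the algebras of bounded operators, over all covariant
representations. -/
abbrev CovariantRep.Ambient : Type (u + 1) :=
  lp (fun ρ : CovariantRep α => ρ.H →L[ℂ] ρ.H) ∞

/-- The element `a δ_g` in the direct sum of all covariant representations. -/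
def CovariantRep.elt (a : A) (g : G) : CovariantRep.Ambient α :=
  ⟨fun ρ => ρ.π a * (ρ.V g : ρ.H →L[ℂ] ρ.H), by
    refine memℓp_infty ⟨‖a‖, ?_⟩
    rintro _ ⟨ρ, rfl⟩
    show ‖ρ.π a * (ρ.V g : ρ.H →L[ℂ] ρ.H)‖ ≤ ‖a‖
    rw [CStarRing.norm_mul_coe_unitary]
    exact NonUnitalStarAlgHom.norm_apply_le ρ.π a⟩

/-- The C*-subalgebra generated by the elements `a δ_g` in the direct sum of all covariant
representations. -/
def crossedProductSubalgebra : NonUnitalStarSubalgebra ℂ (CovariantRep.Ambient α) :=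
  (NonUnitalStarAlgebra.adjoin ℂ
    {x | ∃ (a : A) (g : G), x = CovariantRep.elt α a g}).topologicalClosure

/-- The full crossed product `A ⋊ G`: the C*-algebra generated by the elements `a δ_g` in the
direct sum of all covariant representations. -/
def CrossedProduct : Type (u + 1) := crossedProductSubalgebra α

instance : NonUnitalCStarAlgebra (CrossedProduct α) :=
  NonUnitalStarSubalgebra.nonUnitalCStarAlgebra (crossedProductSubalgebra α)
    (h_closed := isClosed_closure)

/-- The element `a δ_g` of the full crossed product. -/
def CrossedProduct.mk (a : A) (g : G) : CrossedProduct α :=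
  ⟨CovariantRep.elt α a g, NonUnitalStarSubalgebra.le_topologicalClosure _
    (NonUnitalStarAlgebra.subset_adjoin ℂ _ ⟨a, g, rfl⟩)⟩

end CrossedProduct

/-- The corner `e B e` of a C*-algebra `B` at a projection `e`. -/
def corner {B : Type*} [NonUnitalCStarAlgebra B] (e : B) (he : IsStarProjection e) :
    NonUnitalStarSubalgebra ℂ B where
  carrier := {x | ∃ b : B, x = e * b * e}
  add_mem' := by
    rintro _ _ ⟨b, rfl⟩ ⟨c, rfl⟩
    exact ⟨b + c, by simp [mul_add, add_mul]⟩
  zero_mem' := ⟨0, by simp⟩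
  mul_mem' := by
    rintro _ _ ⟨b, rfl⟩ ⟨c, rfl⟩
    exact ⟨b * e * e * c, by simp only [mul_assoc]⟩
  smul_mem' := by
    rintro t _ ⟨b, rfl⟩
    exact ⟨t • b, by rw [mul_smul_comm, smul_mul_assoc]⟩
  star_mem' := by
    rintro _ ⟨b, rfl⟩
    exact ⟨star b, by simp [star_mul, he.isSelfAdjoint.star_eq, mul_assoc]⟩

/-! ### Crossed products of `C₀(X)` -/

section Functions

variable {X G : Type u} [TopologicalSpace X] [Group G]

/-- The action `(g f)(x) = f (g⁻¹ x)` on `C₀(X)` induced by an action of `G` on `X` by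
homeomorphisms. -/
def translation (ρ : G →* (X ≃ₜ X)) : G →* (C₀(X, ℂ) →⋆ₙₐ[ℂ] C₀(X, ℂ)) where
  toFun g :=
    { toFun := fun f => f.comp (Homeomorph.toCocompactMap (ρ g⁻¹))
      map_smul' := fun _ _ => rfl
      map_zero' := rfl
      map_add' := fun _ _ => rfl
      map_mul' := fun _ _ => rfl
      map_star' := fun _ => rfl }
  map_one' := by
    ext f x
    show f (ρ 1⁻¹ x) = f x
    simp
  map_mul' g h := by
    ext f x
    show f (ρ (g * h)⁻¹ x) = f (ρ h⁻¹ (ρ g⁻¹ x))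
    simp [mul_inv_rev]

/-- The indicator function of a compact open and closed set `S` as an element of `C₀(X)`
(for other sets the value is `0`). -/
def indicatorC₀ (S : Set X) : C₀(X, ℂ) := by
  classical
  exact
  if h : IsClopen S ∧ IsCompact S then
    { toFun := S.indicator 1
      continuous_toFun := (continuous_const (y := (1 : ℂ))).indicator (by simp [h.1.frontier_eq])
      zero_at_infty' := by
        refine tendsto_const_nhds.congr' ?_
        filter_upwards [h.2.compl_mem_cocompact] with x hx
        exact (Set.indicator_of_notMem hx _).symm }
  else 0

theorem indicatorC₀_mul_self (S : Set X) : indicatorC₀ S * indicatorC₀ S = indicatorC₀ S := by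
  classical
  unfold indicatorC₀
  split_ifs with h
  · ext x
    by_cases hx : x ∈ S <;> simp [hx]
  · simp

theorem star_indicatorC₀ (S : Set X) : star (indicatorC₀ S) = indicatorC₀ S := by
  classical
  unfold indicatorC₀
  split_ifs with h
  · ext x
    by_cases hx : x ∈ S <;> simp [hx]
  · simp

/-- The image `1_S δ_1` of the indicator function of `S` in `C₀(X) ⋊ G`. -/
def indicatorElt (ρ : G →* (X ≃ₜ X)) (S : Set X) : CrossedProduct (translation ρ) :=
  CrossedProduct.mk (translation ρ) (indicatorC₀ S) 1

theorem isStarProjection_indicatorElt (ρ : G →* (X ≃ₜ X)) (S : Set X) :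
    IsStarProjection (indicatorElt ρ S) := by
  constructor
  · apply Subtype.ext
    apply lp.ext
    funext τ
    show (τ.π (indicatorC₀ S) * (τ.V 1 : τ.H →L[ℂ] τ.H)) *
      (τ.π (indicatorC₀ S) * (τ.V 1 : τ.H →L[ℂ] τ.H)) =
      τ.π (indicatorC₀ S) * (τ.V 1 : τ.H →L[ℂ] τ.H)
    simp only [map_one, OneMemClass.coe_one, mul_one]
    rw [← map_mul, indicatorC₀_mul_self]
  · apply Subtype.ext
    apply lp.ext
    funext τ
    show star (τ.π (indicatorC₀ S) * (τ.V 1 : τ.H →L[ℂ] τ.H)) =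
      τ.π (indicatorC₀ S) * (τ.V 1 : τ.H →L[ℂ] τ.H)
    simp only [map_one, OneMemClass.coe_one, mul_one]
    rw [← map_star, star_indicatorC₀]

/-- The corner `1_S (C₀(X) ⋊ G) 1_S`. -/
def indicatorCorner (ρ : G →* (X ≃ₜ X)) (S : Set X) :
    NonUnitalStarSubalgebra ℂ (CrossedProduct (translation ρ)) :=
  corner (indicatorElt ρ S) (isStarProjection_indicatorElt ρ S)

end Functions

/-! ### The ring C*-algebra -/

/-- A representation, on a nonzero Hilbert space, of the generators and relations of the ring
C*-algebra of an integral domain `R` in which every nonzero principal ideal has finite index: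
isometries `s m` for nonzero `m`, unitaries `u n`, with
`s k * s m = s (k * m)`, `u l * u n = u (l + n)`, `s m * u n = u (m * n) * s m` and
`∑ u n * s m * (s m)* * u (-n) = 1`, the sum being over the cosets `n + (m)`. By the other
relations its terms do not depend on the representatives, here chosen by `Quotient.out`. -/
structure RingRep (R : Type u) [CommRing R] : Type (u + 1) where
  H : Type u
  [normed : NormedAddCommGroup H]
  [inner : InnerProductSpace ℂ H]
  [complete : CompleteSpace H]
  [nontrivial : Nontrivial H]
  s : R⁰ → (H →L[ℂ] H)
  u : R → (H →L[ℂ] H)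
  isometry_s : ∀ m, star (s m) * s m = 1
  unitary_u : ∀ n, u n ∈ unitary (H →L[ℂ] H)
  s_mul : ∀ k m, s k * s m = s (k * m)
  u_mul : ∀ l n, u l * u n = u (l + n)
  s_mul_u : ∀ (m : R⁰) (n : R), s m * u n = u (m * n) * s m
  sum_eq_one : ∀ m : R⁰,
    ∑ᶠ c : R ⧸ Ideal.span {(m : R)},
      u (Quotient.out c) * (s m * star (s m)) * u (-Quotient.out c) = 1

attribute [instance] RingRep.normed RingRep.inner RingRep.complete RingRep.nontrivial

section RingAlgebra

variable (R : Type u) [CommRing R]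

/-- The `ℓ^∞`-direct sum of the algebras of bounded operators, over all representations of the
generators and relations. -/
abbrev RingRep.Ambient : Type (u + 1) := lp (fun ρ : RingRep R => ρ.H →L[ℂ] ρ.H) ∞

instance : CStarAlgebra (RingRep.Ambient R) where

variable {R}

theorem RingRep.norm_s_le (ρ : RingRep R) (m : R⁰) : ‖ρ.s m‖ ≤ 1 := by
  have h := CStarRing.norm_star_mul_self (x := ρ.s m)
  rw [ρ.isometry_s m, norm_one] at h
  nlinarith [norm_nonneg (ρ.s m)]

/-- The isometry `s_m` in the direct sum of all representations. -/
def RingRep.sElt (m : R⁰) : RingRep.Ambient R :=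
  ⟨fun ρ => ρ.s m, memℓp_infty ⟨1, by rintro _ ⟨ρ, rfl⟩; exact ρ.norm_s_le m⟩⟩

/-- The unitary `u^n` in the direct sum of all representations. -/
def RingRep.uElt (n : R) : RingRep.Ambient R :=
  ⟨fun ρ => ρ.u n, memℓp_infty ⟨1, by
    rintro _ ⟨ρ, rfl⟩; exact (CStarRing.norm_of_mem_unitary (ρ.unitary_u n)).le⟩⟩

variable (R)

/-- The C*-subalgebra generated by the `s_m` and `u^n` in the direct sum of all
representations. -/
def ringSubalgebra : StarSubalgebra ℂ (RingRep.Ambient R) :=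
  (StarAlgebra.adjoin ℂ (Set.range RingRep.sElt ∪ Set.range RingRep.uElt)).topologicalClosure

/-- The universal C*-algebra `𝔄[R]` generated by isometries `s_m` and unitaries `u^n` with the
relations of `RingRep`. -/
def RingCStarAlgebra : Type (u + 1) := ringSubalgebra R

instance : CStarAlgebra (RingCStarAlgebra R) :=
  StarSubalgebra.cstarAlgebra (ringSubalgebra R) (h_closed := isClosed_closure)

variable {R}

/-- The isometry `s_m` of `𝔄[R]`. -/
def RingCStarAlgebra.s (m : R⁰) : RingCStarAlgebra R :=
  ⟨RingRep.sElt m, StarSubalgebra.le_topologicalClosure _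
    (StarAlgebra.subset_adjoin ℂ _ (Or.inl ⟨m, rfl⟩))⟩

/-- The unitary `u^n` of `𝔄[R]`. -/
def RingCStarAlgebra.u (n : R) : RingCStarAlgebra R :=
  ⟨RingRep.uElt n, StarSubalgebra.le_topologicalClosure _
    (StarAlgebra.subset_adjoin ℂ _ (Or.inr ⟨n, rfl⟩))⟩

end RingAlgebra

/-! ### Adeles and ideles -/

section Adeles

variable (K : Type u) [Field K] [NumberField K]

/-- The finite adeles `𝔸_f`. -/
abbrev FinAdele : Type u := FiniteAdeleRing (𝓞 K) K

/-- The adeles `𝔸 = K_∞ × 𝔸_f`. -/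
abbrev Adele : Type u := AdeleRing (𝓞 K) K

/-- The subring `ô = ∏ o_ν` of the finite adeles. -/
def integralAdeles : Subring (FinAdele K) where
  carrier := {y | ∀ v, y v ∈ v.adicCompletionIntegers K}
  zero_mem' := fun v => zero_mem (v.adicCompletionIntegers K)
  one_mem' := fun v => one_mem (v.adicCompletionIntegers K)
  add_mem' := fun ha hb v => add_mem (ha v) (hb v)
  mul_mem' := fun ha hb v => mul_mem (ha v) (hb v)
  neg_mem' := fun ha v => neg_mem (ha v)

/-- The unit group `ô^* = ∏ o_ν^*` of `ô`, as a subgroup of the finite ideles. -/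
def integralIdeles : Subgroup (FinAdele K)ˣ := (integralAdeles K).toSubmonoid.units

/-- The embedding `K_∞^× → 𝔸^*`, with `1` at the finite places. -/
def infIdele : (InfiniteAdeleRing K)ˣ →* (Adele K)ˣ :=
  Units.map
    { toFun := fun x => ((x, 1) : InfiniteAdeleRing K × FinAdele K)
      map_one' := rfl
      map_mul' := fun _ _ => Prod.ext rfl (mul_one _).symm }

/-- The embedding `𝔸_f^* → 𝔸^*`, with `1` at the infinite places. -/
def finIdele : (FinAdele K)ˣ →* (Adele K)ˣ :=
  Units.map
    { toFun := fun z => ((1, z) : InfiniteAdeleRing K × FinAdele K)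
      map_one' := rfl
      map_mul' := fun _ _ => Prod.ext (mul_one _).symm rfl }

/-- The diagonal embedding `K^× → 𝔸^*`. -/
def diagIdele : Kˣ →* (Adele K)ˣ := Units.map (algebraMap K (Adele K) : K →* Adele K)

/-- The diagonal embedding `K^× → 𝔸_f^*`. -/
def diagFin : Kˣ →* (FinAdele K)ˣ := FiniteAdeleRing.unitEmbedding (𝓞 K) K

/-- The diagonal embedding `K^× → K_∞^×`. -/
def diagInf : Kˣ →* (InfiniteAdeleRing K)ˣ :=
  Units.map (algebraMap K (InfiniteAdeleRing K) : K →* InfiniteAdeleRing K)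

/-- `U`, the closure of `K^× K_{∞,+}^×` in the ideles, where `K_{∞,+}^×` is the connected
component of the identity in `K_∞^×`. -/
def ideleU : Subgroup (Adele K)ˣ :=
  ((diagIdele K).range ⊔
    (Subgroup.connectedComponentOfOne (InfiniteAdeleRing K)ˣ).map (infIdele K)).topologicalClosure

/-- The topological group `𝔸^*/U`. -/
def IdeleClassQuot : Type u := (Adele K)ˣ ⧸ ideleU K

instance : CommGroup (IdeleClassQuot K) := inferInstanceAs (CommGroup ((Adele K)ˣ ⧸ ideleU K))

instance : TopologicalSpace (IdeleClassQuot K) :=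
  inferInstanceAs (TopologicalSpace ((Adele K)ˣ ⧸ ideleU K))

instance : IsTopologicalGroup (IdeleClassQuot K) :=
  inferInstanceAs (IsTopologicalGroup ((Adele K)ˣ ⧸ ideleU K))

/-- The quotient map `𝔸^* → 𝔸^*/U`. -/
def ideleClass : (Adele K)ˣ →* IdeleClassQuot K := QuotientGroup.mk' (ideleU K)

/-- The unit group `o^*` of the ring of integers, as a subgroup of `K^×`. -/
def intUnits : Subgroup Kˣ := (Units.map (algebraMap (𝓞 K) K : 𝓞 K →* K)).range

/-! ### The spaces -/

/-- The equivalence relation on `𝔸^*/U × 𝔸_f` given by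
`(x, y) ∼ (r x, r⁻¹ y)` for `r ∈ ô^*`. -/
def spaceXSetoid : Setoid (IdeleClassQuot K × FinAdele K) where
  r p q := ∃ r ∈ integralIdeles K,
    (ideleClass K (finIdele K r) * p.1, ((r⁻¹ : (FinAdele K)ˣ) : FinAdele K) * p.2) = q
  iseqv :=
    { refl := fun p => ⟨1, one_mem _, by simp⟩
      symm := by
        rintro p _ ⟨r, hr, rfl⟩
        exact ⟨r⁻¹, inv_mem hr, by ext1 <;> simp⟩
      trans := by
        rintro p _ _ ⟨r, hr, rfl⟩ ⟨t, ht, rfl⟩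
        exact ⟨t * r, mul_mem ht hr, by ext1 <;> simp [mul_assoc, mul_comm, mul_left_comm]⟩ }

/-- The space `X = 𝔸^*/U ×_{ô^*} 𝔸_f`, with the quotient topology. -/
abbrev SpaceX : Type u := Quotient (spaceXSetoid K)

/-- The image `Y` of `𝔸^*/U × ô` in `X`. -/
def subsetY : Set (SpaceX K) := {p | ∃ x, ∃ y ∈ integralAdeles K, p = Quotient.mk _ (x, y)}

/-- The equivalence relation on `𝔸_f` given by multiplication with elements of `ô^* ∩ U`. -/
def adeleSetoid : Setoid (FinAdele K) where
  r y y' := ∃ z ∈ integralIdeles K, finIdele K z ∈ ideleU K ∧ y = z * y'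
  iseqv :=
    { refl := fun y => ⟨1, one_mem _, by simp [one_mem], by simp⟩
      symm := by
        rintro _ y ⟨z, hz, hU, rfl⟩
        exact ⟨z⁻¹, inv_mem hz, by rw [map_inv]; exact inv_mem hU, by simp⟩
      trans := by
        rintro _ _ y ⟨z, hz, hU, rfl⟩ ⟨w, hw, hwU, rfl⟩
        exact ⟨z * w, mul_mem hz hw, by rw [map_mul]; exact mul_mem hU hwU, by simp [mul_assoc]⟩ }

/-- The quotient space `𝔸_f / ∼_{ô^* ∩ U}`. -/
abbrev AdeleQuot : Type u := Quotient (adeleSetoid K)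

/-- The image of `ô` in `𝔸_f / ∼_{ô^* ∩ U}`. -/
def integralQuot : Set (AdeleQuot K) := {p | ∃ y ∈ integralAdeles K, p = Quotient.mk _ y}

/-- The map `φ^* : 𝔸_f / ∼_{ô^* ∩ U} → X`, `[y] ↦ [(1, y)]`. -/
def phiStar : AdeleQuot K → SpaceX K :=
  Quotient.lift (fun y => Quotient.mk (spaceXSetoid K) (1, y)) (by
    rintro _ y ⟨z, hz, hU, rfl⟩
    refine Quotient.sound ⟨z, hz, ?_⟩
    ext1
    · exact (mul_one _).trans ((QuotientGroup.eq_one_iff (finIdele K z)).2 hU)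
    · simp)

/-! ### The actions -/

/-- Multiplication by the finite idele `z` on `X`: `(x, y) ↦ (z⁻¹ x, z y)`. -/
def actX (z : (FinAdele K)ˣ) : SpaceX K → SpaceX K :=
  Quotient.map
    (fun p => ((ideleClass K (finIdele K z))⁻¹ * p.1, (z : FinAdele K) * p.2)) (by
      rintro p _ ⟨r, hr, rfl⟩
      exact ⟨r, hr, by ext1 <;> simp [mul_left_comm]⟩)

theorem continuous_actX (z : (FinAdele K)ˣ) : Continuous (actX K z) := by
  have h : Continuous fun p : IdeleClassQuot K × FinAdele K =>
      ((ideleClass K (finIdele K z))⁻¹ * p.1, (z : FinAdele K) * p.2) := by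
    fun_prop
  exact h.quotient_map' _

theorem actX_one : actX K 1 = id := by
  funext p
  induction p using Quotient.inductionOn with
  | h p => exact congrArg (Quotient.mk _) (by ext1 <;> simp)

theorem actX_mul (z w : (FinAdele K)ˣ) (p : SpaceX K) :
    actX K (z * w) p = actX K z (actX K w p) := by
  induction p using Quotient.inductionOn with
  | h p => exact congrArg (Quotient.mk _) (by ext1 <;> simp [mul_comm, mul_left_comm])

/-- The action of the finite ideles on `X` by homeomorphisms. -/
def finIdeleActX : (FinAdele K)ˣ →* (SpaceX K ≃ₜ SpaceX K) where
  toFun z :=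
    { toFun := actX K z
      invFun := actX K z⁻¹
      left_inv := fun p => by rw [← actX_mul, inv_mul_cancel, actX_one]; rfl
      right_inv := fun p => by rw [← actX_mul, mul_inv_cancel, actX_one]; rfl
      continuous_toFun := continuous_actX K z
      continuous_invFun := continuous_actX K z⁻¹ }
  map_one' := by ext p; exact congrFun (actX_one K) p
  map_mul' z w := by ext p; exact actX_mul K z w p

/-- The group `𝔸_f^*/ô^*`. -/
abbrev IdealGroup : Type u := (FinAdele K)ˣ ⧸ integralIdeles K

/-- The action of `𝔸_f^*/ô^*` on `X`. -/
def idealActX : IdealGroup K →* (SpaceX K ≃ₜ SpaceX K) :=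
  QuotientGroup.lift (integralIdeles K) (finIdeleActX K) (by
    intro z hz
    ext p
    induction p using Quotient.inductionOn with
    | h p => exact Quotient.sound ⟨z, hz, by ext1 <;> simp⟩)

/-- Multiplication by the finite idele `z` on `𝔸_f / ∼_{ô^* ∩ U}`. -/
def actQuot (z : (FinAdele K)ˣ) : AdeleQuot K → AdeleQuot K :=
  Quotient.map (fun y => (z : FinAdele K) * y) (by
    rintro _ y ⟨w, hw, hU, rfl⟩
    exact ⟨w, hw, hU, by simp [mul_left_comm]⟩)

theorem continuous_actQuot (z : (FinAdele K)ˣ) : Continuous (actQuot K z) :=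
  Continuous.quotient_map' (continuous_const.mul continuous_id) _

theorem actQuot_one : actQuot K 1 = id := by
  funext p
  induction p using Quotient.inductionOn with
  | h y => exact congrArg (Quotient.mk _) (by simp)

theorem actQuot_mul (z w : (FinAdele K)ˣ) (p : AdeleQuot K) :
    actQuot K (z * w) p = actQuot K z (actQuot K w p) := by
  induction p using Quotient.inductionOn with
  | h y => exact congrArg (Quotient.mk _) (by simp [mul_assoc])

/-- The action of the finite ideles on `𝔸_f / ∼_{ô^* ∩ U}` by homeomorphisms. -/
def finIdeleActQuot : (FinAdele K)ˣ →* (AdeleQuot K ≃ₜ AdeleQuot K) where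
  toFun z :=
    { toFun := actQuot K z
      invFun := actQuot K z⁻¹
      left_inv := fun p => by rw [← actQuot_mul, inv_mul_cancel, actQuot_one]; rfl
      right_inv := fun p => by rw [← actQuot_mul, mul_inv_cancel, actQuot_one]; rfl
      continuous_toFun := continuous_actQuot K z
      continuous_invFun := continuous_actQuot K z⁻¹ }
  map_one' := by ext p; exact congrFun (actQuot_one K) p
  map_mul' z w := by ext p; exact actQuot_mul K z w p

variable {K}

/-- All elements of the subgroup `G` of `K^×` are positive under every real embedding of `K`. -/
def IsTotallyPositive (G : Subgroup Kˣ) : Prop :=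
  ∀ x ∈ G, ∀ σ : K →+* ℝ, 0 < σ x

/-- The part of the completion at `v` that consists of the positive elements if `v` is real, and of
the nonzero elements if `v` is complex. -/
def positivePart (v : InfinitePlace K) : Set v.Completion :=
  {t | t ≠ 0 ∧ ∀ hv : v.IsReal, 0 < InfinitePlace.Completion.extensionEmbeddingOfIsReal hv t}

set_option linter.unusedSectionVars false in
theorem isPreconnected_positivePart (v : InfinitePlace K) : IsPreconnected (positivePart v) := by
  by_cases hv : v.IsReal
  · let e := InfinitePlace.Completion.isometryEquivRealOfIsReal hv
    have he : ∀ t, e t = InfinitePlace.Completion.extensionEmbeddingOfIsReal hv t := fun _ => rfl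
    have h : positivePart v = e.symm '' Set.Ioi 0 := by
      ext t
      constructor
      · rintro ⟨-, h⟩
        exact ⟨e t, h hv, e.symm_apply_apply t⟩
      · rintro ⟨r, hr, rfl⟩
        have h1 : 0 < InfinitePlace.Completion.extensionEmbeddingOfIsReal hv (e.symm r) := by
          rw [← he, e.apply_symm_apply]
          exact hr
        refine ⟨?_, fun _ => h1⟩
        intro h0
        rw [h0, map_zero] at h1
        exact lt_irrefl _ h1
    rw [h]
    exact isPreconnected_Ioi.image _ e.symm.continuous.continuousOn
  · have hc : v.IsComplex := InfinitePlace.not_isReal_iff_isComplex.1 hv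
    let e := InfinitePlace.Completion.isometryEquivComplexOfIsComplex hc
    have he : ∀ t, e t = InfinitePlace.Completion.extensionEmbedding v t := fun _ => rfl
    have h : positivePart v = e.symm '' {0}ᶜ := by
      ext t
      constructor
      · rintro ⟨h, -⟩
        refine ⟨e t, ?_, e.symm_apply_apply t⟩
        simpa [he] using h
      · rintro ⟨r, hr, rfl⟩
        refine ⟨?_, fun h => absurd h hv⟩
        intro h0
        apply hr
        have := congrArg e h0
        rwa [e.apply_symm_apply, he, map_zero] at this
    rw [h]
    refine IsPreconnected.image ?_ _ e.symm.continuous.continuousOn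
    exact (isConnected_compl_singleton_of_one_lt_rank (by simp) 0).isPreconnected

theorem diagInf_mem_connectedComponent (x : Kˣ) (hx : ∀ σ : K →+* ℝ, 0 < σ x) :
    diagInf K x ∈ Subgroup.connectedComponentOfOne (InfiniteAdeleRing K)ˣ := by
  have hpre : ∀ v : InfinitePlace K, PreconnectedSpace (positivePart v) := fun v =>
    isPreconnected_iff_preconnectedSpace.1 (isPreconnected_positivePart v)
  let f : (∀ v : InfinitePlace K, positivePart v) → (InfiniteAdeleRing K)ˣ := fun s =>
    { val := fun v => (s v : v.Completion)
      inv := fun v => (s v : v.Completion)⁻¹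
      val_inv := funext fun v => mul_inv_cancel₀ (s v).2.1
      inv_val := funext fun v => inv_mul_cancel₀ (s v).2.1 }
  have hf : Continuous f := by
    refine Units.continuous_iff.2 ⟨?_, ?_⟩
    · exact continuous_pi fun v => continuous_subtype_val.comp (continuous_apply v)
    · exact continuous_pi fun v =>
        (continuous_subtype_val.comp (continuous_apply v)).inv₀ fun s => (s v).2.1
  refine (isPreconnected_range hf).subset_connectedComponent ?_ ?_
  · refine ⟨fun v => ⟨1, one_ne_zero, fun hv => by simp⟩, ?_⟩
    exact Units.ext rfl
  · refine ⟨fun v => ⟨((x : K) : v.Completion), ?_, fun hv => ?_⟩, ?_⟩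
    · exact (map_ne_zero (algebraMap K v.Completion)).2 x.ne_zero
    · have h := InfinitePlace.Completion.extensionEmbeddingOfIsReal_coe hv
        ((WithAbs.equiv v.1).symm (x : K))
      exact (hx (InfinitePlace.embedding_of_isReal hv)).trans_eq h.symm
    · exact Units.ext rfl

theorem finIdele_diagFin_mem (x : Kˣ) (hx : ∀ σ : K →+* ℝ, 0 < σ x) :
    finIdele K (diagFin K x) ∈ ideleU K := by
  refine Subgroup.le_topologicalClosure _ ?_
  have h : finIdele K (diagFin K x) = diagIdele K x * infIdele K (diagInf K x)⁻¹ := by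
    apply Units.ext
    refine Prod.ext ?_ ?_
    · exact ((diagInf K x).mul_inv).symm
    · exact (mul_one (diagFin K x : FinAdele K)).symm
  rw [h]
  exact mul_mem (Subgroup.mem_sup_left ⟨x, rfl⟩) (Subgroup.mem_sup_right
    ⟨_, inv_mem (diagInf_mem_connectedComponent x hx), rfl⟩)

theorem diagFin_mem_integralIdeles (x : Kˣ) (hx : x ∈ intUnits K) :
    diagFin K x ∈ integralIdeles K := by
  obtain ⟨t, rfl⟩ := hx
  refine ⟨fun v => ?_, fun v => ?_⟩
  · exact v.coe_mem_adicCompletionIntegers (K := K) (t : 𝓞 K)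
  · exact v.coe_mem_adicCompletionIntegers (K := K) ((t⁻¹ : (𝓞 K)ˣ) : 𝓞 K)

variable (G : Subgroup Kˣ)

/-- The group `G / (G ∩ o^*)` for a subgroup `G` of `K^×`. -/
abbrev ScalarGroup : Type u := G ⧸ (intUnits K).subgroupOf G

/-- The action of `G / (G ∩ o^*)` on `𝔸_f / ∼_{ô^* ∩ U}` by multiplication. -/
def scalarAct (hG : IsTotallyPositive G) : ScalarGroup G →* (AdeleQuot K ≃ₜ AdeleQuot K) :=
  QuotientGroup.lift ((intUnits K).subgroupOf G)
    ((finIdeleActQuot K).comp ((diagFin K).comp G.subtype)) (by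
      intro x hx
      ext p
      induction p using Quotient.inductionOn with
      | h y =>
        exact Quotient.sound ⟨diagFin K x, diagFin_mem_integralIdeles _ hx,
          finIdele_diagFin_mem _ (hG x x.2), rfl⟩)

end Adeles

section Comparison

variable (K : Type u) [Field K] [NumberField K]

/-- The generalized Bost-Connes algebra `𝒜 = 1_Y (C₀(X) ⋊ 𝔸_f^*/ô^*) 1_Y`. -/
abbrev bostConnesAlgebra :
    NonUnitalStarSubalgebra ℂ (CrossedProduct (translation (idealActX K))) :=
  indicatorCorner (idealActX K) (subsetY K)

variable {K}

/-- The element `1_Y (f δ_z) 1_Y` of the generalized Bost-Connes algebra. -/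
def bostConnesElt (f : C₀(SpaceX K, ℂ)) (z : IdealGroup K) : bostConnesAlgebra K :=
  ⟨indicatorElt (idealActX K) (subsetY K) * CrossedProduct.mk _ f z *
    indicatorElt (idealActX K) (subsetY K), _, rfl⟩

/-- The subgroup `K^×_{>0}` of elements that are positive under a real embedding `σ`. -/
def positiveScalars (σ : K →+* ℝ) : Subgroup Kˣ where
  carrier := {x | 0 < σ x}
  one_mem' := by simp
  mul_mem' {x y} hx hy := by
    show 0 < σ ((x * y : Kˣ) : K)
    rw [Units.val_mul, map_mul]
    exact mul_pos hx hy
  inv_mem' {x} hx := by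
    show 0 < σ ((x⁻¹ : Kˣ) : K)
    rw [Units.val_inv_eq_inv_val, map_inv₀]
    exact inv_pos.2 hx

/-- The real place defined by a real embedding. -/
def realPlace (σ : K →+* ℝ) : {w : InfinitePlace K // w.IsReal} :=
  ⟨InfinitePlace.mk (Complex.ofRealHom.comp σ), _, by
    refine ComplexEmbedding.isReal_iff.2 ?_
    ext x
    simp [ComplexEmbedding.conjugate], rfl⟩

set_option linter.unusedSectionVars false in
theorem realPlace_injective : Function.Injective (realPlace (K := K)) := by
  intro σ τ h
  have h' : (Complex.ofRealHom.comp σ : K →+* ℂ) = Complex.ofRealHom.comp τ := by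
    rcases InfinitePlace.mk_eq_iff.1 (congrArg Subtype.val h) with h | h
    · exact h
    · rw [← h]
      ext x
      simp [ComplexEmbedding.conjugate]
  ext x
  exact Complex.ofReal_injective (DFunLike.congr_fun h' x)

theorem isTotallyPositive_top (h : InfinitePlace.nrRealPlaces K = 0) :
    IsTotallyPositive (⊤ : Subgroup Kˣ) := by
  classical
  intro _ _ σ
  exact ((Fintype.card_eq_zero_iff.1 h).false (realPlace σ)).elim

theorem isTotallyPositive_positiveScalars (h : InfinitePlace.nrRealPlaces K ≤ 1) (σ : K →+* ℝ) :
    IsTotallyPositive (positiveScalars σ) := by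
  classical
  intro x hx τ
  rw [realPlace_injective (Fintype.card_le_one_iff.1 h (realPlace τ) (realPlace σ))]
  exact hx

/-- `φ^*` is a homeomorphism and induces *-isomorphisms
`C₀(X) ⋊ 𝔸_f^*/ô^* ≅ C₀(𝔸_f/∼) ⋊ G/(G ∩ o^*)`, with `f δ_[λ] ↦ (f ∘ φ^*) δ_[λ]`, and, by
restriction, `𝒜 ≅ 1_{ô/∼} (C₀(𝔸_f/∼) ⋊ G/(G ∩ o^*)) 1_{ô/∼}`. -/
def PhiStarInducesIsos (G : Subgroup Kˣ) (hG : IsTotallyPositive G) : Prop :=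
  ∃ φ : AdeleQuot K ≃ₜ SpaceX K, (∀ p, φ p = phiStar K p) ∧
  ∃ Ψ : CrossedProduct (translation (idealActX K)) ≃⋆ₐ[ℂ]
      CrossedProduct (translation (scalarAct G hG)),
    (∀ (f : C₀(SpaceX K, ℂ)) (l : G),
      Ψ (CrossedProduct.mk _ f (diagFin K l : IdealGroup K)) =
        CrossedProduct.mk _ (f.comp φ.toCocompactMap) (l : ScalarGroup G)) ∧
    ∃ Ψ' : bostConnesAlgebra K ≃⋆ₐ[ℂ] indicatorCorner (scalarAct G hG) (integralQuot K),
      ∀ a : bostConnesAlgebra K,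
        (Ψ' a : CrossedProduct (translation (scalarAct G hG))) = Ψ a

/-- The restriction to `ô` of the function `y ↦ f [(1, y)]` on `𝔸_f`. -/
def restrictToIntegral (f : C₀(SpaceX K, ℂ)) : C(integralAdeles K, ℂ) where
  toFun y := f (Quotient.mk (spaceXSetoid K) (1, y))
  continuous_toFun :=
    f.continuous.comp (continuous_quotient_mk'.comp (by fun_prop))

/-- The coset `n + m ô` in `ô`. -/
def integralCoset (m : (𝓞 K)⁰) (n : 𝓞 K) : Set (integralAdeles K) :=
  {y | ∃ w ∈ integralAdeles K,
    (y : FinAdele K) = algebraMap (𝓞 K) (FinAdele K) n + algebraMap (𝓞 K) (FinAdele K) m * w}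

/-- `𝒜` embeds into `𝔄[o]`. The embedding `Φ` is the one which on functions is given by
`C(ô) → 𝔄[o]`, `1_{n + m ô} ↦ u^n s_m s_m^* u^{-n}`, and on group elements by a
multiplicative choice `σ z = a / b` in `G` (with `a, b ∈ o`) of representatives of the classes
`z ∈ 𝔸_f^*/ô^*`, with `z` corresponding to `s_b^* s_a`. -/
def EmbedsInRingCStarAlgebra (G : Subgroup Kˣ) : Prop :=
  ∃ σ : IdealGroup K →* Kˣ, (∀ z, σ z ∈ G ∧ (diagFin K (σ z) : IdealGroup K) = z) ∧
  ∃ α : C(integralAdeles K, ℂ) →⋆ₐ[ℂ] RingCStarAlgebra (𝓞 K),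
    (∀ (m : (𝓞 K)⁰) (n : 𝓞 K) (g : C(integralAdeles K, ℂ)),
      (∀ y, g y = (integralCoset m n).indicator 1 y) →
        α g = RingCStarAlgebra.u n * (RingCStarAlgebra.s m * star (RingCStarAlgebra.s m)) *
          RingCStarAlgebra.u (-n)) ∧
  ∃ Φ : bostConnesAlgebra K →⋆ₙₐ[ℂ] RingCStarAlgebra (𝓞 K), Function.Injective Φ ∧
    ∀ (f : C₀(SpaceX K, ℂ)) (z : IdealGroup K) (a b : (𝓞 K)⁰),
      (σ z : K) = ((a : 𝓞 K) : K) / ((b : 𝓞 K) : K) →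
        Φ (bostConnesElt f z) = α (restrictToIntegral f) *
          (star (RingCStarAlgebra.s b) * RingCStarAlgebra.s a)

end Comparison

end BostConnes

end

/-! Part (1) rests on one arithmetic fact: the map from the units of `ô` to `𝔸^*/U` is surjective
and open. Class number one makes the finite part of an idele principal up to a unit idele. The sign
at the only possible real place is corrected by `-1`, itself a unit. Infinite ideles that are
positive at the real places lie in `U`. Hence every point of `X` has the form `[(1, y)]`, with `y`
unique up to `ô^* ∩ U`, and `φ^*` is a homeomorphism (`exists_homeomorph`). The same arithmetic
identifies `G/(G ∩ o^*)` with the ideal group (`exists_scalarGroup_equiv`). A totally positive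
scalar, viewed as a finite idele, lies in `U`, so it acts on `[(1, y)]` by multiplying `y`. Thus
`φ^*` is equivariant, and functoriality of full crossed products gives the isomorphism and its
restriction to the corners.

For part (2), the ideal group is free on the primes, so choosing generators of the primes in `G`
gives the section `τ` (`exists_section`). The projections `u^n s_m s_m^* u^{-n}` commute, and a
character of the algebra they generate picks one residue class modulo each `m`, compatibly, that is,
a point of `ô`. Gelfand duality then gives `α` (`exists_functionRep`). Restriction to `ô` followed
by `α`, together with the isometries `s_{τ(z)}` for integral `τ(z)`, forms a covariant pair
(`isCovariantPair_functionRep`). The assignment `f δ_g ↦ β(f) W_g`, with `W_g = s_b^* s_a` for `τ(g)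
= a/b`, is multiplicative and *-preserving once compressed to the corner
(`IsCovariantPair.exists_cornerHom`).

Two analytic points remain, and both use that the group is commutative. Boundedness
(`IsCovariantPair.norm_sum_le`): the vectors `Σ_{k ∈ T} S_{k⁻¹} ξ ⊗ δ_k`, for Følner sets `T` inside
`P⁻¹`, turn matrix coefficients of the pair into approximate matrix coefficients of a regular
covariant representation, so the full crossed product norm dominates and no unitary dilation is
needed. Injectivity: on `ℓ²(ô)` the diagonal coefficient at a nonzero `y` reads off the coefficient
at the identity of the group (`diagCoeff_pair`), because distinct integers move `y` to distinct
points. If the homomorphism kills `x`, then `x* x` is a limit of finite sums whose coefficients at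
the identity tend to zero, and averaging over the compact dual group forces `x = 0`
(`CrossedProduct.eq_zero_of_coeff_one_small`). -/

noncomputable section

universe u

namespace BostConnes

/-! ### Generalities on full crossed products -/

namespace CrossedProduct

variable {A G : Type u} [NonUnitalCStarAlgebra A] [Group G] {α : G →* (A →⋆ₙₐ[ℂ] A)}

/-- Evaluation of the full crossed product in a covariant representation. -/
def ev (ρ : CovariantRep α) : CrossedProduct α →⋆ₙₐ[ℂ] (ρ.H →L[ℂ] ρ.H) where
  toFun x := x.1.1 ρ
  map_smul' _ _ := rfl
  map_zero' := rfl
  map_add' _ _ := rfl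
  map_mul' _ _ := rfl
  map_star' _ := rfl

theorem ev_mk (ρ : CovariantRep α) (a : A) (g : G) :
    ev ρ (mk α a g) = ρ.π a * (ρ.V g : ρ.H →L[ℂ] ρ.H) := rfl

theorem norm_ev_le (ρ : CovariantRep α) (x : CrossedProduct α) : ‖ev ρ x‖ ≤ ‖x‖ :=
  NonUnitalStarAlgHom.norm_apply_le (ev ρ) x

theorem ext_ev {x y : CrossedProduct α} (h : ∀ ρ, ev ρ x = ev ρ y) : x = y :=
  Subtype.ext (lp.ext (funext h))

theorem ev_smul_V (ρ : CovariantRep α) (g : G) (a : A) :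
    (ρ.V g : ρ.H →L[ℂ] ρ.H) * ρ.π a = ρ.π (α g a) * (ρ.V g : ρ.H →L[ℂ] ρ.H) := by
  rw [← ρ.covariant g a, mul_assoc, Unitary.coe_star_mul_self, mul_one]

theorem mk_mul (a b : A) (g h : G) : mk α a g * mk α b h = mk α (a * α g b) (g * h) := by
  refine ext_ev fun ρ => ?_
  rw [map_mul, ev_mk, ev_mk, ev_mk, map_mul, map_mul, Submonoid.coe_mul, mul_assoc,
    ← mul_assoc (ρ.V g : ρ.H →L[ℂ] ρ.H), ev_smul_V]
  simp only [mul_assoc]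

theorem star_mk (a : A) (g : G) : star (mk α a g) = mk α (α g⁻¹ (star a)) g⁻¹ := by
  refine ext_ev fun ρ => ?_
  rw [map_star, ev_mk, ev_mk, star_mul, ← map_star, ← ev_smul_V, map_inv,
    ← Unitary.star_eq_inv, Unitary.coe_star]

/-- Finite sums of the elements `a δ_g`. -/
def ofFinsupp (α : G →* (A →⋆ₙₐ[ℂ] A)) : (G →₀ A) →ₗ[ℂ] CrossedProduct α :=
  Finsupp.lsum ℂ fun g =>
    { toFun := fun a => mk α a g
      map_add' := fun a b => ext_ev fun ρ => by
        rw [map_add, ev_mk, ev_mk, ev_mk, map_add, add_mul]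
      map_smul' := fun t a => ext_ev fun ρ => by
        rw [RingHom.id_apply, map_smul, ev_mk, ev_mk, map_smul, smul_mul_assoc] }

@[simp]
theorem ofFinsupp_single (g : G) (a : A) : ofFinsupp α (Finsupp.single g a) = mk α a g := by
  rw [ofFinsupp, Finsupp.lsum_single]
  rfl

theorem ofFinsupp_eq_sum (c : G →₀ A) : ofFinsupp α c = ∑ g ∈ c.support, mk α (c g) g := by
  simp [ofFinsupp, Finsupp.sum]

/-- By the product and adjoint formulas for `a δ_g`, the finite sums already form a *-subalgebra. It
contains the generators, so the crossed product is its closure. -/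
theorem denseRange_ofFinsupp : DenseRange (ofFinsupp α) := by
  let S : NonUnitalStarSubalgebra ℂ (CrossedProduct α) :=
    { carrier := Set.range (ofFinsupp α)
      add_mem' := by
        rintro _ _ ⟨c, rfl⟩ ⟨d, rfl⟩
        exact ⟨c + d, map_add _ _ _⟩
      zero_mem' := ⟨0, map_zero _⟩
      smul_mem' := by
        rintro t _ ⟨c, rfl⟩
        exact ⟨t • c, map_smul _ _ _⟩
      mul_mem' := by
        rintro _ _ ⟨c, rfl⟩ ⟨d, rfl⟩
        refine ⟨∑ g ∈ c.support, ∑ h ∈ d.support,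
          Finsupp.single (g * h) (c g * α g (d h)), ?_⟩
        rw [ofFinsupp_eq_sum c, ofFinsupp_eq_sum d]
        simp only [map_sum, ofFinsupp_single, Finset.sum_mul_sum, mk_mul]
      star_mem' := by
        rintro _ ⟨c, rfl⟩
        refine ⟨∑ g ∈ c.support, Finsupp.single g⁻¹ (α g⁻¹ (star (c g))), ?_⟩
        rw [ofFinsupp_eq_sum c]
        simp only [map_sum, ofFinsupp_single, star_sum, star_mk] }
  intro x
  -- The closure defining the crossed product is taken in the ambient direct sum, so the subalgebra
  -- is moved there and the conclusion pulled back to the subtype.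
  let T : NonUnitalStarSubalgebra ℂ (CovariantRep.Ambient α) :=
    S.map (NonUnitalStarSubalgebraClass.subtype (crossedProductSubalgebra α))
  have hT : NonUnitalStarAlgebra.adjoin ℂ {x | ∃ (a : A) (g : G), x = CovariantRep.elt α a g}
      ≤ T := by
    refine NonUnitalStarAlgebra.adjoin_le ?_
    rintro _ ⟨a, g, rfl⟩
    exact ⟨mk α a g, ⟨Finsupp.single g a, ofFinsupp_single g a⟩, rfl⟩
  have hx : x.1 ∈ closure (T : Set (CovariantRep.Ambient α)) := closure_mono hT x.2
  refine closure_subtype.2 (closure_mono ?_ hx)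
  rintro _ ⟨y, hy, rfl⟩
  exact ⟨y, hy, rfl⟩

/-- Two continuous additive maps on the crossed product that agree on the elements `a δ_g` are
equal. -/
theorem eq_of_forall_mk {E F F' : Type*} [AddCommMonoid E] [TopologicalSpace E] [T2Space E]
    [FunLike F (CrossedProduct α) E] [AddMonoidHomClass F (CrossedProduct α) E]
    [FunLike F' (CrossedProduct α) E] [AddMonoidHomClass F' (CrossedProduct α) E]
    {f : F} {g : F'} (hf : Continuous f) (hg : Continuous g)
    (h : ∀ a k, f (mk α a k) = g (mk α a k)) (x : CrossedProduct α) : f x = g x := by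
  refine congrFun (denseRange_ofFinsupp.equalizer hf hg (funext fun c => ?_)) x
  simp only [Function.comp_apply, ofFinsupp_eq_sum, map_sum, h]

/-! ### Functoriality of full crossed products -/

section Functoriality

variable {A' G' : Type u} [NonUnitalCStarAlgebra A'] [Group G'] {α' : G' →* (A' →⋆ₙₐ[ℂ] A')}

/-- The pullback of a covariant representation along a morphism of dynamical systems. -/
def pullback (φ : A →⋆ₙₐ[ℂ] A') (γ : G →* G') (h : ∀ g a, φ (α g a) = α' (γ g) (φ a))
    (ρ : CovariantRep α') : CovariantRep α where
  H := ρ.H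
  π := ρ.π.comp φ
  V := ρ.V.comp γ
  covariant g a := by
    simp only [MonoidHom.comp_apply, NonUnitalStarAlgHom.comp_apply, h, ρ.covariant]

/-- The *-homomorphism of crossed products induced by a morphism of dynamical systems. -/
theorem exists_map (φ : A →⋆ₙₐ[ℂ] A') (γ : G →* G') (h : ∀ g a, φ (α g a) = α' (γ g) (φ a)) :
    ∃ Ψ : CrossedProduct α →⋆ₙₐ[ℂ] CrossedProduct α',
      ∀ a g, Ψ (mk α a g) = mk α' (φ a) (γ g) := by
  let P := pullback φ γ h
  -- The coordinate of the image at `ρ` is the value of `x` in the pullback of `ρ`. This lands a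
  -- priori only in the full direct sum; membership in the crossed product is checked on finite sums
  -- and passes to limits.
  let Ψ₀ : CrossedProduct α →⋆ₙₐ[ℂ] CovariantRep.Ambient α' :=
    { toFun := fun x => ⟨fun ρ => ev (P ρ) x, memℓp_infty ⟨‖x‖, by
        rintro _ ⟨ρ, rfl⟩
        exact norm_ev_le (P ρ) x⟩⟩
      map_smul' := fun _ _ => rfl
      map_zero' := rfl
      map_add' := fun _ _ => rfl
      map_mul' := fun _ _ => rfl
      map_star' := fun _ => rfl }
  have hmk : ∀ a g, Ψ₀ (mk α a g) = (mk α' (φ a) (γ g)).1 := fun a g => rfl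
  have hmem : ∀ x, Ψ₀ x ∈ crossedProductSubalgebra α' := by
    intro x
    have hc : IsClosed {x | Ψ₀ x ∈ crossedProductSubalgebra α'} :=
      isClosed_closure.preimage 
        (AddMonoidHomClass.continuous_of_bound Ψ₀ 1 fun x => by
          simpa using NonUnitalStarAlgHom.norm_apply_le Ψ₀ x)
    refine denseRange_ofFinsupp.induction_on x hc fun c => ?_
    simp only [ofFinsupp_eq_sum, map_sum]
    exact sum_mem fun g _ => (mk α' (φ (c g)) (γ g)).2
  exact ⟨NonUnitalStarAlgHom.codRestrict Ψ₀ (crossedProductSubalgebra α') hmem,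
    fun a g => Subtype.ext (hmk a g)⟩

/-- An isomorphism of dynamical systems induces an isomorphism of the crossed products. -/
theorem exists_equiv (φ : A ≃⋆ₐ[ℂ] A') (γ : G ≃* G') (h : ∀ g a, φ (α g a) = α' (γ g) (φ a)) :
    ∃ Ψ : CrossedProduct α ≃⋆ₐ[ℂ] CrossedProduct α',
      ∀ a g, Ψ (mk α a g) = mk α' (φ a) (γ g) := by
  obtain ⟨f, hf⟩ := exists_map (α := α) (α' := α') (φ : A →⋆ₙₐ[ℂ] A') γ.toMonoidHom h
  obtain ⟨f', hf'⟩ := exists_map (α := α') (α' := α) (φ.symm : A' →⋆ₙₐ[ℂ] A) γ.symm.toMonoidHom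
    (fun g a => by
      apply φ.injective
      have := h (γ.symm g) (φ.symm a)
      simp only [MulEquiv.apply_symm_apply,
        StarAlgEquiv.apply_symm_apply] at this
      exact (φ.apply_symm_apply _).trans this.symm)
  have hf2 : ∀ a g, f (mk α a g) = mk α' (φ a) (γ g) := hf
  have hf2' : ∀ a g, f' (mk α' a g) = mk α (φ.symm a) (γ.symm g) := hf'
  have hcont : Continuous f := AddMonoidHomClass.continuous_of_bound f 1 fun x => by
    simpa using NonUnitalStarAlgHom.norm_apply_le f x
  have hcont' : Continuous f' := AddMonoidHomClass.continuous_of_bound f' 1 fun x => by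
    simpa using NonUnitalStarAlgHom.norm_apply_le f' x
  have hl : Function.LeftInverse f' f := by
    refine eq_of_forall_mk (f := f'.comp f) (g := NonUnitalStarAlgHom.id ℂ _)
      (hcont'.comp hcont) continuous_id fun a k => ?_
    change f' (f (mk α a k)) = mk α a k
    rw [hf2, hf2', φ.symm_apply_apply, γ.symm_apply_apply]
  have hr : Function.RightInverse f' f := by
    refine eq_of_forall_mk (f := f.comp f') (g := NonUnitalStarAlgHom.id ℂ _)
      (hcont.comp hcont') continuous_id fun a k => ?_
    change f (f' (mk α' a k)) = mk α' a k
    rw [hf2', hf2, φ.apply_symm_apply, γ.apply_symm_apply]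
  exact ⟨StarAlgEquiv.ofBijective f ⟨hl.injective, hr.surjective⟩, hf2⟩

end Functoriality

end CrossedProduct

/-! ### Faithfulness of the canonical expectation for commutative groups -/

section Characters

variable {G : Type u} [CommGroup G]

/-- Characters with values in `ℚ/ℤ` separate the points of an abelian group, and `ℚ/ℤ` embeds into
`ℝ/ℤ`, which is the circle. -/
theorem exists_circle_character_ne_one {g : G} (hg : g ≠ 1) : ∃ χ : G →* Circle, χ g ≠ 1 := by
  have hg' : Additive.ofMul g ≠ 0 := by simpa using hg
  obtain ⟨c, hc⟩ := CharacterModule.exists_character_apply_ne_zero_of_ne_zero hg'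
  have hinj : Function.Injective (AddCircle.toCircle (T := 1)) :=
    AddCircle.injective_toCircle one_ne_zero
  let j : AddCircle (1 : ℚ) →+ AddCircle (1 : ℝ) :=
    QuotientAddGroup.map _ _ (Rat.castHom ℝ).toAddMonoidHom (by
      rw [AddSubgroup.zmultiples_le]
      exact AddSubgroup.mem_zmultiples_iff.2 ⟨1, by simp⟩)
  have hj : ∀ t, j t = 0 → t = 0 := by
    intro t ht
    induction t using QuotientAddGroup.induction_on with
    | H q =>
      have h1 : (((q : ℚ) : ℝ) : AddCircle (1 : ℝ)) = 0 := ht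
      rw [AddCircle.coe_eq_zero_iff] at h1
      obtain ⟨n, hn⟩ := h1
      refine (AddCircle.coe_eq_zero_iff (1 : ℚ)).2 ⟨n, ?_⟩
      have : ((n : ℚ) : ℝ) = (q : ℝ) := by simpa using hn
      simpa using (Rat.cast_injective this)
  refine ⟨MonoidHom.mk' (fun x => AddCircle.toCircle (j (c (Additive.ofMul x)))) ?_, ?_⟩
  · intro x y
    rw [ofMul_mul, map_add, map_add, AddCircle.toCircle_add]
  · intro h
    apply hc
    apply hj
    apply hinj
    rw [AddCircle.toCircle_zero]
    exact h

end Characters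

/-! ### Averaging over the dual group -/

namespace CrossedProduct

variable {A G : Type u} [NonUnitalCStarAlgebra A] [CommGroup G] {α : G →* (A →⋆ₙₐ[ℂ] A)}

/-- The twist of a covariant representation by a character of the group. -/
def twist (ρ : CovariantRep α) (χ : G →* Circle) : CovariantRep α where
  H := ρ.H
  π := ρ.π
  V :=
    { toFun := fun g => ⟨(χ g : ℂ) • (ρ.V g : ρ.H →L[ℂ] ρ.H), by
        have h1 : star (χ g : ℂ) * (χ g : ℂ) = 1 := by
          simp [← Complex.normSq_eq_conj_mul_self]
        have h2 : (χ g : ℂ) * star (χ g : ℂ) = 1 := by rw [mul_comm, h1]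
        rw [Unitary.mem_iff]
        constructor
        · rw [star_smul, smul_mul_smul_comm, h1, Unitary.coe_star_mul_self, one_smul]
        · rw [star_smul, smul_mul_smul_comm, h2, Unitary.mul_star_self_of_mem (ρ.V g).2, one_smul]⟩
      map_one' := Subtype.ext (by simp)
      map_mul' := fun g h => Subtype.ext (by simp [smul_smul, mul_comm]) }
  covariant g a := by
    have h2 : (χ g : ℂ) * star (χ g : ℂ) = 1 := by
      simp [Complex.mul_conj]
    change ((χ g : ℂ) • (ρ.V g : ρ.H →L[ℂ] ρ.H)) * ρ.π a *
      star ((χ g : ℂ) • (ρ.V g : ρ.H →L[ℂ] ρ.H)) = ρ.π (α g a)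
    rw [star_smul, smul_mul_assoc, smul_mul_smul_comm, h2, one_smul, ρ.covariant]

/-- The operator of `x` in the twist of `ρ` by a character. -/
def evTwist (ρ : CovariantRep α) (χ : G →* Circle) :
    CrossedProduct α →⋆ₙₐ[ℂ] (ρ.H →L[ℂ] ρ.H) := ev (twist ρ χ)

theorem evTwist_mk (ρ : CovariantRep α) (χ : G →* Circle) (a : A) (g : G) :
    evTwist ρ χ (mk α a g) = (χ g : ℂ) • (ρ.π a * (ρ.V g : ρ.H →L[ℂ] ρ.H)) :=
  mul_smul_comm (χ g : ℂ) (ρ.π a) (ρ.V g : ρ.H →L[ℂ] ρ.H)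

theorem evTwist_one (ρ : CovariantRep α) (x : CrossedProduct α) : evTwist ρ 1 x = ev ρ x := by
  refine eq_of_forall_mk (f := evTwist ρ 1) (g := ev ρ) ?_ ?_ (fun a g => ?_) x
  · exact AddMonoidHomClass.continuous_of_bound (evTwist ρ 1) 1 fun x => by
      rw [one_mul]
      exact norm_ev_le (twist ρ 1) x
  · exact AddMonoidHomClass.continuous_of_bound (ev ρ) 1 fun x => by
      simpa using norm_ev_le ρ x
  · rw [evTwist_mk, ev_mk]
    simp

/-- If `x* x` is approximated by finite sums whose coefficient at the identity is small, then
`x = 0`. -/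
theorem eq_zero_of_coeff_one_small (x : CrossedProduct α)
    (h : ∀ ε > 0, ∃ c : G →₀ A, ‖star x * x - ofFinsupp α c‖ ≤ ε ∧ ‖c 1‖ ≤ ε) : x = 0 := by
  classical
  refine ext_ev fun ρ => ?_
  rw [map_zero]
  ext ξ
  -- With the discrete topology on `G`, its Pontryagin dual consists of all characters and is
  -- compact, so continuous functions on it are integrable for Haar measure.
  let _ : TopologicalSpace G := ⊥
  have : DiscreteTopology G := ⟨rfl⟩
  let T := PontryaginDual G
  let _ : MeasurableSpace T := borel T
  have : BorelSpace T := ⟨rfl⟩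
  let μ : MeasureTheory.Measure T := MeasureTheory.Measure.haar
  let χ' : T → (G →* Circle) := fun t => (t : G →* Circle)
  have hχ : ∀ t g, χ' t g = t g := fun _ _ => rfl
  have hev : ∀ g : G, Continuous fun t : T => ((χ' t g : Circle) : ℂ) := fun g =>
    continuous_induced_dom.comp (continuous_eval_const (F := G →ₜ* Circle) g)
  -- The diagonal matrix coefficient at `ξ`, as the representation is twisted by a varying
  -- character; its integral will see only the coefficient at the identity.
  let F : CrossedProduct α → T → ℂ := fun b t => inner ℂ ξ (evTwist ρ (χ' t) b ξ)
  have hFsub : ∀ b b' t, ‖F b t - F b' t‖ ≤ ‖b - b'‖ * ‖ξ‖ ^ 2 := by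
    intro b b' t
    have h1 : F b t - F b' t = inner ℂ ξ (evTwist ρ (χ' t) (b - b') ξ) := by
      simp only [F, map_sub, sub_apply, inner_sub_right]
    rw [h1]
    calc _ ≤ ‖ξ‖ * ‖evTwist ρ (χ' t) (b - b') ξ‖ := norm_inner_le_norm _ _
      _ ≤ ‖ξ‖ * (‖b - b'‖ * ‖ξ‖) := by
        gcongr
        exact ContinuousLinearMap.le_of_opNorm_le _ (norm_ev_le (twist ρ (χ' t)) _) _
      _ = _ := by ring
  have hFsum : ∀ (c : G →₀ A) t, F (ofFinsupp α c) t =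
      ∑ g ∈ c.support, (χ' t g : ℂ) * inner ℂ ξ (ρ.π (c g) ((ρ.V g : ρ.H →L[ℂ] ρ.H) ξ)) := by
    intro c t
    simp only [F, ofFinsupp_eq_sum, map_sum, evTwist_mk, sum_apply,
      inner_sum, smul_apply, inner_smul_right]
    rfl
  have hFcont₀ : ∀ c, Continuous (F (ofFinsupp α c)) := by
    intro c
    rw [funext (hFsum c)]
    exact continuous_finsetSum _ fun g _ => (hev g).mul continuous_const
  -- Each `F b` is a limit of trigonometric polynomials, uniformly in the character, because twisted
  -- representations are contractive.
  have hFcont : ∀ b, Continuous (F b) := by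
    intro b
    refine continuous_of_uniform_approx_of_continuous fun U hU => ?_
    obtain ⟨ε, hε, hεU⟩ := Metric.mem_uniformity_dist.1 hU
    have hpos : 0 < ε / (‖ξ‖ ^ 2 + 1) := by positivity
    obtain ⟨c, hc⟩ := denseRange_ofFinsupp.exists_dist_lt b hpos
    refine ⟨F (ofFinsupp α c), hFcont₀ c, fun t => hεU ?_⟩
    rw [dist_eq_norm] at hc ⊢
    refine (hFsub _ _ _).trans_lt ?_
    rw [lt_div_iff₀ (by positivity)] at hc
    nlinarith [norm_nonneg (b - ofFinsupp α c)]
  have hint : ∀ b, MeasureTheory.Integrable (F b) μ := fun b =>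
    (hFcont b).integrable_of_hasCompactSupport (HasCompactSupport.of_compactSpace _)
  -- Translating by a character `ψ` with `ψ g ≠ 1` multiplies the integral by `ψ g`, while
  -- invariance of Haar measure leaves it unchanged.
  have horth : ∀ g : G, g ≠ 1 → ∫ t, (χ' t g : ℂ) ∂μ = 0 := by
    intro g hg
    obtain ⟨ψ, hψ⟩ := exists_circle_character_ne_one hg
    let ψ' : T := (⟨ψ, continuous_of_discreteTopology⟩ : G →ₜ* Circle)
    have h1 : ∫ t, (χ' (ψ' * t) g : ℂ) ∂μ = ∫ t, (χ' t g : ℂ) ∂μ :=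
      MeasureTheory.integral_mul_left_eq_self (fun t => (χ' t g : ℂ)) ψ'
    have h2 : ∀ t, (χ' (ψ' * t) g : ℂ) = (ψ g : ℂ) * (χ' t g : ℂ) := fun t => rfl
    simp only [h2, MeasureTheory.integral_const_mul] at h1
    have h3 : ((ψ g : ℂ) - 1) * ∫ t, (χ' t g : ℂ) ∂μ = 0 := by
      rw [sub_mul, h1, one_mul, sub_self]
    refine (mul_eq_zero.1 h3).resolve_left fun h4 => hψ ?_
    exact Circle.ext (by simpa using sub_eq_zero.1 h4)
  have hintc : ∀ c : G →₀ A, ∫ t, F (ofFinsupp α c) t ∂μ =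
      μ.real Set.univ * inner ℂ ξ (ρ.π (c 1) ξ) := by
    intro c
    simp only [hFsum]
    rw [MeasureTheory.integral_finsetSum _ fun g _ =>
      (((hev g).integrable_of_hasCompactSupport
        (HasCompactSupport.of_compactSpace _)).mul_const _)]
    simp only [MeasureTheory.integral_mul_const]
    rw [Finset.sum_eq_single 1]
    · simp
    · intro g _ hg
      rw [horth g hg, zero_mul]
    · intro h1
      simp [Finsupp.notMem_support_iff.1 h1]
  let b := star x * x
  have hzero : ∫ t, F b t ∂μ = 0 := by
    rw [← norm_le_zero_iff]
    refine le_of_forall_pos_le_add fun δ hδ => ?_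
    let M := μ.real Set.univ * ‖ξ‖ ^ 2
    have hM : 0 ≤ M := by positivity
    -- Two errors of size at most `ε M` arise, from the approximation and from the coefficient at
    -- the identity; this `ε` makes their sum at most `δ`.
    obtain ⟨c, hc, hc1⟩ := h (δ / (2 * M + 1)) (by positivity)
    have h1 : ‖∫ t, F b t ∂μ - ∫ t, F (ofFinsupp α c) t ∂μ‖ ≤
        ‖b - ofFinsupp α c‖ * M := by
      rw [← MeasureTheory.integral_sub (hint _) (hint _)]
      refine (MeasureTheory.norm_integral_le_of_norm_le_const
        (Filter.Eventually.of_forall fun t => hFsub b _ t)).trans_eq ?_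
      simp only [M]
      ring
    have h2 : ‖∫ t, F (ofFinsupp α c) t ∂μ‖ ≤ ‖c 1‖ * M := by
      rw [hintc, norm_mul]
      have h3 : ‖inner ℂ ξ (ρ.π (c 1) ξ)‖ ≤ ‖ξ‖ * (‖c 1‖ * ‖ξ‖) :=
        (norm_inner_le_norm _ _).trans (by
          gcongr
          exact ContinuousLinearMap.le_of_opNorm_le _
            (NonUnitalStarAlgHom.norm_apply_le ρ.π (c 1)) _)
      have h4 : ‖((μ.real Set.univ : ℝ) : ℂ)‖ = μ.real Set.univ := by
        simp
      rw [h4]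
      calc _ ≤ μ.real Set.univ * (‖ξ‖ * (‖c 1‖ * ‖ξ‖)) := by gcongr
        _ = _ := by simp only [M]; ring
    have h3 : ‖∫ t, F b t ∂μ‖ ≤ ‖b - ofFinsupp α c‖ * M + ‖c 1‖ * M := by
      calc _ = ‖(∫ t, F b t ∂μ - ∫ t, F (ofFinsupp α c) t ∂μ) +
            ∫ t, F (ofFinsupp α c) t ∂μ‖ := by rw [sub_add_cancel]
        _ ≤ _ := (norm_add_le _ _).trans (add_le_add h1 h2)
    have h4 : δ / (2 * M + 1) * (2 * M + 1) = δ := by field_simp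
    have h5 : 0 < δ / (2 * M + 1) := by positivity
    calc _ ≤ ‖b - ofFinsupp α c‖ * M + ‖c 1‖ * M := h3
      _ ≤ δ / (2 * M + 1) * M + δ / (2 * M + 1) * M := by gcongr
      _ ≤ 0 + δ := by nlinarith
  -- For `b = x* x` the integrand is a squared norm. Being continuous and nonnegative with integral
  -- zero, it vanishes everywhere, in particular at the trivial character.
  have hFb : ∀ t, F b t = ((‖evTwist ρ (χ' t) x ξ‖ ^ 2 : ℝ) : ℂ) := by
    intro t
    simp only [F, b, map_mul, map_star, ContinuousLinearMap.star_eq_adjoint,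
      mul_apply_eq_comp, ContinuousLinearMap.adjoint_inner_right,
      inner_self_eq_norm_sq_to_K]
    norm_cast
  let f : T → ℝ := fun t => ‖evTwist ρ (χ' t) x ξ‖ ^ 2
  have hf : f = fun t => (F b t).re := by
    funext t
    rw [hFb, Complex.ofReal_re]
  have hfc : Continuous f := by
    rw [hf]
    exact Complex.continuous_re.comp (hFcont b)
  have hf0 : ∫ t, f t ∂μ = 0 := by
    have : ((∫ t, f t ∂μ : ℝ) : ℂ) = 0 := by
      rw [← integral_complex_ofReal, ← hzero]
      exact MeasureTheory.integral_congr_ae (Filter.Eventually.of_forall fun t => (hFb t).symm)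
    exact_mod_cast this
  have hfz : f = 0 := by
    rw [MeasureTheory.integral_eq_zero_iff_of_nonneg (fun t => by positivity)
      (hfc.integrable_of_hasCompactSupport (HasCompactSupport.of_compactSpace _))] at hf0
    exact (hfc.ae_eq_iff_eq μ continuous_const).1 hf0
  have h1 := congrFun hfz 1
  have h2 : evTwist ρ 1 x ξ = 0 := by
    have h3 : ‖evTwist ρ (χ' 1) x ξ‖ ^ 2 = 0 := h1
    exact norm_eq_zero.1 (pow_eq_zero_iff two_ne_zero |>.1 h3)
  rw [evTwist_one] at h2
  exact h2

end CrossedProduct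

/-! ### Operators on spaces of square summable functions -/

section SquareSummable

variable {A : Type*} [NonUnitalCStarAlgebra A]
variable {Ω Ω' Ω'' : Type*} {H : Type*} [NormedAddCommGroup H] [InnerProductSpace ℂ H]

/-- The operator on square summable functions given by composition with an injective map. -/
def pullOp (H : Type*) [NormedAddCommGroup H] [InnerProductSpace ℂ H] (j : Ω → Ω')
    (hj : Function.Injective j) :
    lp (fun _ : Ω' => H) 2 →L[ℂ] lp (fun _ : Ω => H) 2 :=
  LinearMap.mkContinuous
    { toFun := fun ζ => ⟨fun ω => ζ (j ω), memℓp_gen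
        (((lp.memℓp ζ).summable (by norm_num)).comp_injective hj)⟩
      map_add' := fun _ _ => rfl
      map_smul' := fun _ _ => rfl } 1 (fun ζ => by
    rw [one_mul]
    refine lp.norm_le_of_tsum_le (by norm_num) (norm_nonneg _) ?_
    rw [lp.norm_rpow_eq_tsum (by norm_num)]
    have hs := (lp.memℓp ζ).summable (p := 2) (by norm_num)
    exact (hs.comp_injective hj).tsum_le_tsum_of_inj j hj (fun _ _ => by positivity)
      (fun _ => le_rfl) hs)

@[simp]
theorem pullOp_apply (j : Ω → Ω') (hj : Function.Injective j) (ζ : lp (fun _ : Ω' => H) 2)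
    (ω : Ω) : pullOp H j hj ζ ω = ζ (j ω) := rfl

/-- The unitary operator on square summable functions given by a permutation. -/
def permIsometry (H : Type*) [NormedAddCommGroup H] [InnerProductSpace ℂ H] (e : Ω ≃ Ω) :
    lp (fun _ : Ω => H) 2 ≃ₗᵢ[ℂ] lp (fun _ : Ω => H) 2 where
  toFun := pullOp H e.symm e.symm.injective
  invFun := pullOp H e e.injective
  map_add' := map_add _
  map_smul' := map_smul _
  left_inv ζ := lp.ext (funext fun ω => by simp)
  right_inv ζ := lp.ext (funext fun ω => by simp)
  norm_map' ζ := by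
    have h2 : (0 : ℝ) < (2 : ℝ≥0∞).toReal := by norm_num
    refine (Real.rpow_left_inj (norm_nonneg _) (norm_nonneg _) h2.ne').1 ?_
    rw [lp.norm_rpow_eq_tsum h2, lp.norm_rpow_eq_tsum h2]
    exact e.symm.tsum_eq fun ω => ‖ζ ω‖ ^ (2 : ℝ≥0∞).toReal

variable [CompleteSpace H]

/-- The direct sum of a family of representations on the same Hilbert space. -/
def diagRep (β : Ω → A →⋆ₙₐ[ℂ] (H →L[ℂ] H)) :
    A →⋆ₙₐ[ℂ] (lp (fun _ : Ω => H) 2 →L[ℂ] lp (fun _ : Ω => H) 2) :=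
  -- The bound is stated against the vector `‖a‖ • v`, so that square summability and the norm
  -- estimate both follow by comparison with `‖a‖ • ζ`.
  have hle : ∀ a ω (v : H), ‖β ω a v‖ ≤ ‖‖a‖ • v‖ := fun a ω v => by
    rw [norm_smul, norm_norm]
    exact ContinuousLinearMap.le_of_opNorm_le _ (NonUnitalStarAlgHom.norm_apply_le (β ω) a) v
  let D : A → (lp (fun _ : Ω => H) 2 →L[ℂ] lp (fun _ : Ω => H) 2) := fun a =>
    LinearMap.mkContinuous
      { toFun := fun ζ => ⟨fun ω => β ω a (ζ ω),
          (lp.memℓp (‖a‖ • ζ)).mono' fun ω => hle a ω (ζ ω)⟩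
        map_add' := fun ζ ζ' => lp.ext (funext fun ω => map_add (β ω a) (ζ ω) (ζ' ω))
        map_smul' := fun t ζ => lp.ext (funext fun ω => map_smul (β ω a) t (ζ ω)) } ‖a‖
      (fun ζ => by
        refine (lp.norm_mono two_ne_zero (y := ‖a‖ • ζ) fun ω => hle a ω (ζ ω)).trans_eq ?_
        rw [norm_smul, norm_norm])
  have hD : ∀ a ζ ω, D a ζ ω = β ω a (ζ ω) := fun _ _ _ => rfl
  { toFun := D
    map_smul' := fun t a => by
      ext ζ ω
      simp only [hD, map_smul]
      rfl
    map_zero' := by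
      ext ζ ω
      simp only [hD, map_zero]
      rfl
    map_add' := fun a b => by
      ext ζ ω
      simp only [hD, map_add]
      rfl
    map_mul' := fun a b => by
      ext ζ ω
      simp only [hD, map_mul]
      rfl
    map_star' := fun a => by
      rw [ContinuousLinearMap.star_eq_adjoint]
      refine (ContinuousLinearMap.eq_adjoint_iff _ _).2 fun ζ ζ' => ?_
      rw [lp.inner_eq_tsum, lp.inner_eq_tsum]
      refine tsum_congr fun ω => ?_
      rw [hD, hD, map_star, ContinuousLinearMap.star_eq_adjoint,
        ContinuousLinearMap.adjoint_inner_left] }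

@[simp]
theorem diagRep_apply (β : Ω → A →⋆ₙₐ[ℂ] (H →L[ℂ] H)) (a : A) (ζ : lp (fun _ : Ω => H) 2)
    (ω : Ω) : diagRep β a ζ ω = β ω a (ζ ω) := rfl

end SquareSummable

/-! ### Følner sets in commutative groups -/

section Foelner

open scoped Pointwise

variable {G : Type*} [CommGroup G] [DecidableEq G]

/-- By commutativity a product of `n` factors from `E` depends only on how often each factor occurs.
-/
theorem exists_exponents_of_mem_pow (E : Finset G) (n : ℕ) :
    ∀ x ∈ E ^ n, ∃ e : G → ℕ, (∀ z, e z ≤ n) ∧ x = ∏ z ∈ E, z ^ e z := by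
  induction n with
  | zero =>
    intro x hx
    rw [pow_zero, Finset.mem_one] at hx
    exact ⟨0, fun _ => le_rfl, by simp [hx]⟩
  | succ n ih =>
    intro x hx
    rw [pow_succ, Finset.mem_mul] at hx
    obtain ⟨y, hy, w, hw, rfl⟩ := hx
    obtain ⟨e, he, rfl⟩ := ih y hy
    refine ⟨e + Pi.single w 1, fun z => ?_, ?_⟩
    · have h1 : (Pi.single w 1 : G → ℕ) z ≤ 1 := by
        by_cases h : z = w
        · subst h
          simp
        · simp [h]
      exact add_le_add (he z) h1
    · simp only [Pi.add_apply, pow_add, Finset.prod_mul_distrib]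
      congr 1
      rw [Finset.prod_eq_single w]
      · simp
      · intro z _ hz
        simp [hz]
      · exact fun h => absurd hw h

/-- Counting exponent vectors shows that a finite set in a commutative group grows polynomially. -/
theorem card_pow_le_succ_pow (E : Finset G) (n : ℕ) : (E ^ n).card ≤ (n + 1) ^ E.card := by
  choose! e he hx using exists_exponents_of_mem_pow E n
  calc (E ^ n).card ≤ (Fintype.piFinset fun _ : E => Finset.range (n + 1)).card := by
        refine Finset.card_le_card_of_injOn (fun x z => e x z) (fun x hx => ?_) ?_
        · simp only [Finset.mem_coe] at hx
          rw [Finset.mem_coe, Fintype.mem_piFinset]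
          exact fun z => Finset.mem_range.2 (Nat.lt_succ_of_le (he x hx z))
        · intro x hx' y hy' hxy
          rw [hx x hx', hx y hy']
          refine Finset.prod_congr rfl fun z hz => ?_
          rw [show e x z = e y z from congrFun hxy ⟨z, hz⟩]
    _ = (n + 1) ^ E.card := by simp

/-- If every step multiplied the size by more than `1 + ε`, growth would be exponential,
contradicting the polynomial bound. -/
theorem exists_card_pow_succ_le (E : Finset G) {ε : ℝ} (hε : 0 < ε) :
    ∃ n, ((E ^ (n + 1)).card : ℝ) ≤ (1 + ε) * (E ^ n).card := by
  by_contra! h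
  have hlow : ∀ n, (1 + ε) ^ n ≤ ((E ^ n).card : ℝ) := by
    intro n
    induction n with
    | zero => simp
    | succ n ih =>
      rw [pow_succ, mul_comm]
      exact (mul_le_mul_of_nonneg_left ih (by positivity)).trans (h n).le
  have ht := tendsto_pow_const_div_const_pow_of_one_lt E.card (r := 1 + ε) (by linarith)
  -- The shift matches the base `n + 1` of the polynomial bound; the factor `1 + ε` then restores
  -- the exponent `n` in the denominator.
  have ht' := (ht.comp (Filter.tendsto_add_atTop_nat 1)).const_mul (1 + ε)
  rw [mul_zero] at ht'
  obtain ⟨n, hn⟩ := (ht'.eventually (gt_mem_nhds one_pos)).exists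
  have h1 : ((E ^ n).card : ℝ) ≤ ((n + 1 : ℕ) : ℝ) ^ E.card := by
    exact_mod_cast card_pow_le_succ_pow E n
  have h2 := (hlow n).trans h1
  have h3 : (1 + ε) * (((n + 1 : ℕ) : ℝ) ^ E.card / (1 + ε) ^ (n + 1)) < 1 := hn
  rw [mul_div_assoc', div_lt_one (by positivity), pow_succ, mul_comm] at h3
  exact absurd h2 (not_le.2 (lt_of_mul_lt_mul_right h3 (by positivity)))

/-- A commutative group that is generated as a group by a submonoid `P` has Følner sets in
`P⁻¹`. -/
theorem exists_foelner (P : Submonoid G) (hP : ∀ g : G, ∃ p ∈ P, ∃ q ∈ P, g = p * q⁻¹)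
    (F : Finset G) {ε : ℝ} (hε : 0 < ε) :
    ∃ T : Finset G, T.Nonempty ∧ (∀ h ∈ T, h⁻¹ ∈ P) ∧
      ∀ g ∈ F, (1 - ε) * (T.card : ℝ) ≤ ((T.filter fun h => g⁻¹ * h ∈ T).card : ℝ) := by
  choose p hp q hq hpq using hP
  -- All numerators and denominators of the elements of `F` go into `E`; the element `1` keeps the
  -- powers of `E` nonempty.
  let E : Finset G := insert 1 (F.image p ∪ F.image q)
  have hE1 : (1 : G) ∈ E := Finset.mem_insert_self _ _
  have hEP : ∀ x ∈ E, x ∈ P := by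
    intro x hx
    simp only [E, Finset.mem_insert, Finset.mem_union, Finset.mem_image] at hx
    rcases hx with rfl | ⟨g, _, rfl⟩ | ⟨g, _, rfl⟩
    exacts [one_mem P, hp g, hq g]
  have hEnP : ∀ n, ∀ x ∈ E ^ n, x ∈ P := by
    intro n x hx
    obtain ⟨e, -, rfl⟩ := exists_exponents_of_mem_pow E n x hx
    exact prod_mem fun z hz => pow_mem (hEP z hz) _
  obtain ⟨n, hn⟩ := exists_card_pow_succ_le E hε
  refine ⟨(E ^ (n + 1))⁻¹, ?_, ?_, ?_⟩
  · exact (Finset.Nonempty.pow ⟨1, hE1⟩).inv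
  · intro h hh
    exact hEnP _ _ (Finset.mem_inv'.1 hh)
  · intro g hg
    have hle : (E ^ n).card ≤
        (((E ^ (n + 1))⁻¹).filter fun h => g⁻¹ * h ∈ (E ^ (n + 1))⁻¹).card := by
      -- For `g = p q⁻¹` and `c ∈ E ^ n`, the element `h = (c q)⁻¹` satisfies `g⁻¹ h = (c p)⁻¹`.
      -- Both are inverses of elements of `E ^ (n + 1)`, so at least `|E ^ n|` elements of the set
      -- are kept in it by `g⁻¹`.
      refine Finset.card_le_card_of_injOn (fun c => (c * q g)⁻¹) (fun c hc => ?_) ?_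
      · have hpE : p g ∈ E := by
          simp only [E, Finset.mem_insert, Finset.mem_union, Finset.mem_image]
          exact Or.inr (Or.inl ⟨g, hg, rfl⟩)
        have hqE : q g ∈ E := by
          simp only [E, Finset.mem_insert, Finset.mem_union, Finset.mem_image]
          exact Or.inr (Or.inr ⟨g, hg, rfl⟩)
        rw [Finset.mem_coe, Finset.mem_filter, Finset.mem_inv', Finset.mem_inv', inv_inv, pow_succ]
        refine ⟨Finset.mul_mem_mul hc hqE, ?_⟩
        have : (g⁻¹ * (c * q g)⁻¹)⁻¹ = c * p g := by
          rw [mul_inv_rev, inv_inv, inv_inv, mul_assoc]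
          congr 1
          rw [mul_comm]
          exact (eq_mul_inv_iff_mul_eq.1 (hpq g))
        rw [this]
        exact Finset.mul_mem_mul hc hpE
      · intro c _ d _ hcd
        exact mul_right_cancel (inv_injective hcd)
    rw [Finset.card_inv]
    have h1 : (0 : ℝ) ≤ (E ^ n).card := Nat.cast_nonneg _
    have h2 : ((E ^ n).card : ℝ) ≤ _ := Nat.cast_le.2 hle
    refine le_trans ?_ h2
    -- The estimate uses `(1 - ε)(1 + ε) ≤ 1`; for `ε > 1` the left-hand side is not positive.
    by_cases hε1 : ε ≤ 1
    · calc _ ≤ (1 - ε) * ((1 + ε) * (E ^ n).card) := by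
            exact mul_le_mul_of_nonneg_left hn (by linarith)
        _ ≤ _ := by nlinarith [mul_nonneg h1 (sq_nonneg ε)]
    · have : (1 - ε) * ((E ^ (n + 1)).card : ℝ) ≤ 0 :=
        mul_nonpos_of_nonpos_of_nonneg (by linarith) (Nat.cast_nonneg _)
      linarith

end Foelner

/-! ### Covariant pairs with isometries and homomorphisms of corners -/

section CovariantPairs

variable {A G : Type u} [NonUnitalCStarAlgebra A] [CommGroup G]

/-- A representation `β` of `A` together with a representation `S` by isometries of a submonoid
`P` of the group `G` acting on `A`, such that `S p` implements the action of `p ∈ P` and the range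
projection of `S p` is the image of `p e`. -/
structure IsCovariantPair (α : G →* (A →⋆ₙₐ[ℂ] A)) (P : Submonoid G) (e : A) {B : Type*}
    [CStarAlgebra B] (β : A →⋆ₙₐ[ℂ] B) (S : G → B) : Prop where
  exists_fraction : ∀ g : G, ∃ p ∈ P, ∃ q ∈ P, g = p * q⁻¹
  isometry : ∀ p ∈ P, star (S p) * S p = 1
  map_mul : ∀ p ∈ P, ∀ q ∈ P, S (p * q) = S p * S q
  covariant : ∀ p ∈ P, ∀ a, β (α p a) * S p = S p * β a
  range_proj : ∀ p ∈ P, S p * star (S p) = β (α p e)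
  proj_mul : ∀ a, β (e * a) = β a
  proj_comm : ∀ a, a * e = e * a
  proj_idem : e * e = e

/-- The partial isometry `(S q)* S p` attached to the fraction `g = p q⁻¹`. -/
def fracIsometry {B : Type*} [CStarAlgebra B] (P : Submonoid G)
    (hP : ∀ g : G, ∃ p ∈ P, ∃ q ∈ P, g = p * q⁻¹) (S : G → B) (g : G) : B :=
  star (S (hP g).choose_spec.2.choose) * S (hP g).choose

/-! ### Calculus and norm estimate for covariant pairs -/

namespace IsCovariantPair

variable {α : G →* (A →⋆ₙₐ[ℂ] A)} {P : Submonoid G} {e : A} {B : Type*} [CStarAlgebra B]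
  {β : A →⋆ₙₐ[ℂ] B} {S : G → B}

theorem comp (h : IsCovariantPair α P e β S) {B' : Type*} [CStarAlgebra B'] (f : B →⋆ₐ[ℂ] B') :
    IsCovariantPair α P e ((f : B →⋆ₙₐ[ℂ] B').comp β) fun g => f (S g) where
  exists_fraction := h.exists_fraction
  isometry p hp := by rw [← map_star, ← _root_.map_mul, h.isometry p hp, map_one]
  map_mul p hp q hq := by rw [h.map_mul p hp q hq, _root_.map_mul]
  covariant p hp a := by
    have := congrArg f (h.covariant p hp a)
    rwa [_root_.map_mul, _root_.map_mul] at this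
  range_proj p hp := by
    rw [← map_star, ← _root_.map_mul, h.range_proj p hp]
    rfl
  proj_mul a := congrArg f (h.proj_mul a)
  proj_comm := h.proj_comm
  proj_idem := h.proj_idem

/-- Inserting `star (S q') * S q' = 1` expands the first fraction, and inserting `star (S q) * S q =
1` expands the second, both to the denominator `q q'`. The partial isometry therefore depends only
on the group element. -/
theorem star_mul_eq (h : IsCovariantPair α P e β S) {p q p' q' : G} (hp : p ∈ P)
    (hq : q ∈ P) (hp' : p' ∈ P) (hq' : q' ∈ P)
    (heq : p * q⁻¹ = p' * q'⁻¹) : star (S q) * S p = star (S q') * S p' := by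
  have heq' : q' * p = q * p' := by
    rw [mul_inv_eq_iff_eq_mul, mul_assoc, mul_comm q'⁻¹, ← mul_assoc, eq_mul_inv_iff_mul_eq] at heq
    rw [mul_comm, heq, mul_comm]
  calc star (S q) * S p = star (S q) * (star (S q') * S q') * S p := by
        rw [h.isometry q' hq', mul_one]
    _ = star (S (q' * q)) * S (q' * p) := by
        rw [h.map_mul q' hq' q hq, h.map_mul q' hq' p hp, star_mul]
        simp only [mul_assoc]
    _ = star (S (q * q')) * S (q * p') := by rw [heq', mul_comm q' q]
    _ = star (S q') * (star (S q) * S q) * S p' := by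
        rw [h.map_mul q hq q' hq', h.map_mul q hq p' hp', star_mul]
        simp only [mul_assoc]
    _ = _ := by rw [h.isometry q hq, mul_one]

theorem fracIsometry_mul_inv (h : IsCovariantPair α P e β S) {p q : G} (hp : p ∈ P) (hq : q ∈ P) :
    fracIsometry P h.exists_fraction S (p * q⁻¹) = star (S q) * S p := by
  have h1 := (h.exists_fraction (p * q⁻¹)).choose_spec
  exact h.star_mul_eq h1.1 h1.2.choose_spec.1 hp hq h1.2.choose_spec.2.symm

theorem star_mul_map (h : IsCovariantPair α P e β S) {p : G} (hp : p ∈ P) (a : A) :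
    star (S p) * β (α p a) = β a * star (S p) := by
  have := congrArg star (h.covariant p hp (star a))
  simpa only [star_mul, map_star, star_star] using this

/-- A covariant pair on a Hilbert space is dominated by the full crossed product. -/
theorem norm_sum_le {H : Type u} [NormedAddCommGroup H] [InnerProductSpace ℂ H] [CompleteSpace H]
    {β : A →⋆ₙₐ[ℂ] (H →L[ℂ] H)} {S : G → (H →L[ℂ] H)} (h : IsCovariantPair α P e β S)
    (c : G →₀ A) :
    ‖∑ g ∈ c.support, β (c g) * fracIsometry P h.exists_fraction S g‖ ≤
      ‖CrossedProduct.ofFinsupp α c‖ := by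
  classical
  let W := fracIsometry P h.exists_fraction S
  let V : G →* unitary (lp (fun _ : G => H) 2 →L[ℂ] lp (fun _ : G => H) 2) :=
    { toFun := fun g => Unitary.linearIsometryEquiv.symm (permIsometry H (Equiv.mulLeft g))
      map_one' := by
        refine Subtype.ext (ContinuousLinearMap.ext fun ζ => lp.ext (funext fun k => ?_))
        change ζ ((1 : G)⁻¹ * k) = ζ k
        simp
      map_mul' := fun g g' => by
        refine Subtype.ext (ContinuousLinearMap.ext fun ζ => lp.ext (funext fun k => ?_))
        change ζ ((g * g')⁻¹ * k) = ζ (g'⁻¹ * (g⁻¹ * k))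
        rw [mul_inv_rev, mul_assoc] }
  have hV : ∀ g ζ k, (V g : lp (fun _ : G => H) 2 →L[ℂ] lp (fun _ : G => H) 2) ζ k =
      ζ (g⁻¹ * k) := fun _ _ _ => rfl
  -- The regular covariant representation induced from `β`: at the point `k` the algebra acts
  -- through `β ∘ α k⁻¹`, and the group acts by left translation.
  let ρ : CovariantRep α :=
    { H := lp (fun _ : G => H) 2
      π := diagRep fun k => β.comp (α k⁻¹)
      V := V
      covariant := fun g a => by
        rw [← Unitary.coe_star, Unitary.star_eq_inv, ← map_inv]
        refine ContinuousLinearMap.ext fun ζ => lp.ext (funext fun k => ?_)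
        change β (α (g⁻¹ * k)⁻¹ a) (ζ (g⁻¹⁻¹ * (g⁻¹ * k))) = β (α k⁻¹ (α g a)) (ζ k)
        rw [inv_inv, mul_inv_cancel_left, mul_inv_rev, inv_inv, _root_.map_mul]
        rfl }
  have key : ∀ (ξ η : H) (T : Finset G), (∀ k ∈ T, k⁻¹ ∈ P) →
      ‖∑ g ∈ c.support, ((T.filter fun k => g⁻¹ * k ∈ T).card : ℂ) *
        inner ℂ η (β (c g) (W g ξ))‖ ≤
      T.card * (‖CrossedProduct.ofFinsupp α c‖ * ‖ξ‖ * ‖η‖) := by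
    intro ξ η T hT
    -- For `k ∈ T` the inverse `k⁻¹` lies in `P`, so `S k⁻¹` is an isometry and `J` multiplies norms
    -- by `√|T|`.
    let J : H → lp (fun _ : G => H) 2 := fun ξ => ∑ k ∈ T, lp.single 2 k (S k⁻¹ ξ)
    have hJapply : ∀ ξ k, J ξ k = if k ∈ T then S k⁻¹ ξ else 0 := by
      intro ξ k
      simp only [J, lp.coeFn_sum, Finset.sum_apply, lp.coeFn_single]
      split_ifs with hk
      · rw [Finset.sum_eq_single k]
        · simp
        · intro l _ hl
          simp [hl.symm]
        · exact fun h => absurd hk h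
      · refine Finset.sum_eq_zero fun l hl => ?_
        have : k ≠ l := fun h => hk (h ▸ hl)
        simp [this]
    have hSnorm : ∀ k ∈ T, ∀ ξ, ‖S k⁻¹ ξ‖ = ‖ξ‖ := by
      intro k hk ξ
      have h1 : ∀ ξ, star (S k⁻¹) (S k⁻¹ ξ) = ξ := fun ξ =>
        DFunLike.congr_fun (h.isometry _ (hT k hk)) ξ
      have h2 : ‖S k⁻¹ ξ‖ ^ 2 = ‖ξ‖ ^ 2 := by
        have : (inner ℂ (S k⁻¹ ξ) (S k⁻¹ ξ)) = (inner ℂ ξ ξ : ℂ) := by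
          rw [← ContinuousLinearMap.adjoint_inner_right, ← ContinuousLinearMap.star_eq_adjoint, h1]
        rw [inner_self_eq_norm_sq_to_K, inner_self_eq_norm_sq_to_K] at this
        exact_mod_cast this
      exact (sq_eq_sq₀ (norm_nonneg _) (norm_nonneg _)).1 h2
    have hJnorm : ∀ ξ, ‖J ξ‖ ^ 2 = T.card * ‖ξ‖ ^ 2 := by
      intro ξ
      have := lp.norm_sum_single (p := 2) (by norm_num) (fun k => S k⁻¹ ξ) T
      simp only [ENNReal.toReal_ofNat, Real.rpow_ofNat] at this
      rw [this, Finset.sum_congr rfl fun k hk => by rw [hSnorm k hk]]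
      simp
    -- Each `k` with `k` and `g⁻¹ k` both in `T` contributes the same number. Indeed `W g = star (S
    -- k⁻¹) * S (g⁻¹ k)⁻¹`, and covariance moves `star (S k⁻¹)` past the coefficient.
    have hinner : ∀ g, inner ℂ (J η) (CrossedProduct.ev ρ (CrossedProduct.mk α (c g) g) (J ξ)) =
        ((T.filter fun k => g⁻¹ * k ∈ T).card : ℂ) * inner ℂ η (β (c g) (W g ξ)) := by
      intro g
      have h1 : ∀ k, (CrossedProduct.ev ρ (CrossedProduct.mk α (c g) g) (J ξ)) k =
          β (α k⁻¹ (c g)) (J ξ (g⁻¹ * k)) := fun k => rfl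
      have h2 : ∀ ζ : lp (fun _ : G => H) 2,
          inner ℂ (J η) ζ = ∑ k ∈ T, inner ℂ (S k⁻¹ η) (ζ k) := by
        intro ζ
        simp only [J, sum_inner, lp.inner_single_left]
      rw [h2, Finset.card_filter, Nat.cast_sum, Finset.sum_mul]
      refine Finset.sum_congr rfl fun k hk => ?_
      rw [h1, hJapply]
      split_ifs with hgk
      · rw [Nat.cast_one, one_mul]
        have h3 : W g = star (S k⁻¹) * S (g⁻¹ * k)⁻¹ := by
          rw [← h.fracIsometry_mul_inv (hT _ hgk) (hT k hk)]
          congr 1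
          rw [inv_inv, mul_inv_rev, inv_inv, mul_comm, mul_inv_cancel_left]
        have h4 : β (c g) * W g = star (S k⁻¹) * (β (α k⁻¹ (c g)) * S (g⁻¹ * k)⁻¹) := by
          rw [h3, ← mul_assoc, ← h.star_mul_map (hT k hk), mul_assoc]
        have h5 : β (c g) (W g ξ) = star (S k⁻¹) (β (α k⁻¹ (c g)) (S (g⁻¹ * k)⁻¹ ξ)) :=
          DFunLike.congr_fun h4 ξ
        rw [h5, ContinuousLinearMap.star_eq_adjoint, ContinuousLinearMap.adjoint_inner_right]
      · simp
    have hsum : ∑ g ∈ c.support, ((T.filter fun k => g⁻¹ * k ∈ T).card : ℂ) *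
        inner ℂ η (β (c g) (W g ξ)) =
        inner ℂ (J η) (CrossedProduct.ev ρ (CrossedProduct.ofFinsupp α c) (J ξ)) := by
      rw [CrossedProduct.ofFinsupp_eq_sum, map_sum (CrossedProduct.ev ρ), sum_apply, inner_sum]
      exact Finset.sum_congr rfl fun g _ => (hinner g).symm
    rw [hsum]
    have hJ' : ∀ ξ, ‖J ξ‖ = √T.card * ‖ξ‖ := by
      intro ξ
      rw [← Real.sqrt_sq (norm_nonneg (J ξ)), hJnorm, Real.sqrt_mul (Nat.cast_nonneg _),
        Real.sqrt_sq (norm_nonneg _)]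
    calc _ ≤ ‖J η‖ * (‖CrossedProduct.ofFinsupp α c‖ * ‖J ξ‖) :=
          (norm_inner_le_norm _ _).trans (by
            gcongr
            exact ContinuousLinearMap.le_of_opNorm_le _ (CrossedProduct.norm_ev_le ρ _) _)
      _ = (√T.card * √T.card) * (‖CrossedProduct.ofFinsupp α c‖ * ‖ξ‖ * ‖η‖) := by
          rw [hJ', hJ']
          ring
      _ = _ := by rw [Real.mul_self_sqrt (Nat.cast_nonneg _)]
  -- Dividing the previous estimate by `|T|` replaces each overlap count by nearly `1`; the Følner
  -- condition makes the total error at most `δ`.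
  have hbound : ∀ ξ η : H, ‖∑ g ∈ c.support, inner ℂ η (β (c g) (W g ξ))‖ ≤
      ‖CrossedProduct.ofFinsupp α c‖ * ‖ξ‖ * ‖η‖ := by
    intro ξ η
    let x : G → ℂ := fun g => inner ℂ η (β (c g) (W g ξ))
    let M : ℝ := ∑ g ∈ c.support, ‖x g‖
    have hM : 0 ≤ M := Finset.sum_nonneg fun _ _ => norm_nonneg _
    refine le_of_forall_pos_le_add fun δ hδ => ?_
    obtain ⟨T, hTne, hTP, hTF⟩ := exists_foelner P h.exists_fraction c.support
      (ε := δ / (M + 1)) (by positivity)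
    have hcard : (0 : ℝ) < T.card := by exact_mod_cast hTne.card_pos
    have h1 := key ξ η T hTP
    have h2 : (T.card : ℂ) * ∑ g ∈ c.support, x g =
        ∑ g ∈ c.support, ((T.filter fun k => g⁻¹ * k ∈ T).card : ℂ) * x g +
        ∑ g ∈ c.support, ((T.card : ℂ) - ((T.filter fun k => g⁻¹ * k ∈ T).card : ℂ)) * x g := by
      rw [← Finset.sum_add_distrib, Finset.mul_sum]
      exact Finset.sum_congr rfl fun g _ => by ring
    have h3 : ‖∑ g ∈ c.support,
        ((T.card : ℂ) - ((T.filter fun k => g⁻¹ * k ∈ T).card : ℂ)) * x g‖ ≤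
        T.card * (δ / (M + 1) * M) := by
      refine (_root_.norm_sum_le _ _).trans ?_
      rw [← mul_assoc, Finset.mul_sum]
      refine Finset.sum_le_sum fun g hg => ?_
      rw [norm_mul]
      gcongr
      have h4 : ((T.filter fun k => g⁻¹ * k ∈ T).card : ℝ) ≤ T.card := by
        exact_mod_cast Finset.card_filter_le _ _
      have h5 : ‖(T.card : ℂ) - ((T.filter fun k => g⁻¹ * k ∈ T).card : ℂ)‖ =
          (T.card : ℝ) - ((T.filter fun k => g⁻¹ * k ∈ T).card : ℝ) := by
        rw [← Complex.ofReal_natCast, ← Complex.ofReal_natCast, ← Complex.ofReal_sub,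
          Complex.norm_real, Real.norm_of_nonneg (by linarith)]
      rw [h5]
      have := hTF g hg
      linarith
    have h4 : (T.card : ℝ) * ‖∑ g ∈ c.support, x g‖ ≤
        T.card * (‖CrossedProduct.ofFinsupp α c‖ * ‖ξ‖ * ‖η‖ + δ / (M + 1) * M) := by
      calc _ = ‖(T.card : ℂ) * ∑ g ∈ c.support, x g‖ := by
            rw [norm_mul, Complex.norm_natCast]
        _ ≤ _ := by
            rw [h2, mul_add]
            exact (norm_add_le _ _).trans (add_le_add h1 h3)
    have h5 : δ / (M + 1) * M ≤ δ := by
      rw [div_mul_eq_mul_div, div_le_iff₀ (by positivity)]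
      nlinarith
    have h6 := le_of_mul_le_mul_left h4 hcard
    exact h6.trans (by linarith)
  refine ContinuousLinearMap.opNorm_le_bound _ (norm_nonneg _) fun ξ => ?_
  let X : H →L[ℂ] H := ∑ g ∈ c.support, β (c g) * W g
  have hX : ∀ η, inner ℂ η (X ξ) = ∑ g ∈ c.support, inner ℂ η (β (c g) (W g ξ)) := by
    intro η
    simp only [X, sum_apply, inner_sum]
    rfl
  change ‖X ξ‖ ≤ _
  rcases eq_or_ne (X ξ) 0 with h0 | h0
  · rw [h0, norm_zero]
    positivity
  -- Taking `η = X ξ` turns the bound on matrix coefficients into a bound on the vector.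
  · have h1 := hbound ξ (X ξ)
    rw [← hX, inner_self_eq_norm_sq_to_K, norm_pow, RCLike.norm_ofReal, abs_norm, sq] at h1
    exact le_of_mul_le_mul_right h1 (norm_pos_iff.2 h0)

/-- For `g = p q⁻¹`, covariance moves `S p` past the coefficient and its adjoint form moves `star (S
q)`. Writing `β b` as `β (e * b)` produces the coefficient that also arises from multiplying by `e
δ_1` in the crossed product. -/
theorem fracIsometry_mul_map (h : IsCovariantPair α P e β S) (g : G) (b : A) :
    fracIsometry P h.exists_fraction S g * β b =
      β (α g (e * b)) * fracIsometry P h.exists_fraction S g := by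
  obtain ⟨p, hp, q, hq, rfl⟩ := h.exists_fraction g
  have h1 : α p (e * b) = α q (α (p * q⁻¹) (e * b)) := by
    conv_lhs => rw [← inv_mul_cancel_right p q, mul_comm, _root_.map_mul α]
    rfl
  rw [h.fracIsometry_mul_inv hp hq, mul_assoc, ← h.proj_mul b, ← h.covariant p hp, h1,
    ← mul_assoc, h.star_mul_map hq, mul_assoc]

/-- Expand `g` to `ps/(qs)` and `k` to `pr/(ps)`. The product then contains the range projection of
`S (p s)`, which is `β (α (p s) e)`; moved across `star (S (q s))` it becomes `β (α g e)`. So `W` is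
multiplicative up to this projection. -/
theorem fracIsometry_mul (h : IsCovariantPair α P e β S) (g k : G) :
    fracIsometry P h.exists_fraction S g * fracIsometry P h.exists_fraction S k =
      β (α g e) * fracIsometry P h.exists_fraction S (g * k) := by
  obtain ⟨p, hp, q, hq, rfl⟩ := h.exists_fraction g
  obtain ⟨r, hr, s, hs, rfl⟩ := h.exists_fraction k
  have hx := mul_mem hq hs
  have hy := mul_mem hp hs
  have hz := mul_mem hp hr
  have h1 : p * q⁻¹ = p * s * (q * s)⁻¹ := by
    rw [mul_inv_rev, mul_assoc, mul_inv_cancel_left]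
  have h2 : r * s⁻¹ = p * r * (p * s)⁻¹ := by
    rw [mul_comm p r, mul_comm p s, mul_inv_rev, mul_assoc, mul_inv_cancel_left]
  have h3 : p * q⁻¹ * (r * s⁻¹) = p * r * (q * s)⁻¹ := by
    rw [mul_inv_rev, mul_mul_mul_comm, mul_comm q⁻¹]
  have h4 : α (p * s) e = α (q * s) (α (p * q⁻¹) e) := by
    have : p * s = q * s * (p * q⁻¹) := by
      rw [h1, mul_comm (q * s), inv_mul_cancel_right]
    rw [this, _root_.map_mul]
    rfl
  rw [h3, h.fracIsometry_mul_inv hz hx, ← mul_assoc, ← h.star_mul_map hx, ← h4,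
    ← h.range_proj _ hy, h2, h.fracIsometry_mul_inv hz hy, h1, h.fracIsometry_mul_inv hy hx]
  simp only [mul_assoc]

theorem star_fracIsometry (h : IsCovariantPair α P e β S) (g : G) :
    star (fracIsometry P h.exists_fraction S g) = fracIsometry P h.exists_fraction S g⁻¹ := by
  obtain ⟨p, hp, q, hq, rfl⟩ := h.exists_fraction g
  rw [mul_inv_rev, inv_inv, h.fracIsometry_mul_inv hp hq, h.fracIsometry_mul_inv hq hp, star_mul,
    star_star]

/-- The range projection of `S p`, carried across `star (S q)`, becomes `β (α g e)`, and it fixes `S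
p`. -/
theorem map_mul_fracIsometry (h : IsCovariantPair α P e β S) (g : G) :
    β (α g e) * fracIsometry P h.exists_fraction S g = fracIsometry P h.exists_fraction S g := by
  obtain ⟨p, hp, q, hq, rfl⟩ := h.exists_fraction g
  have h1 : α p e = α q (α (p * q⁻¹) e) := by
    conv_lhs => rw [← inv_mul_cancel_right p q, mul_comm, _root_.map_mul α]
    rfl
  rw [h.fracIsometry_mul_inv hp hq, ← mul_assoc, ← h.star_mul_map hq, ← h1, ← h.range_proj p hp,
    mul_assoc, mul_assoc, h.isometry p hp, mul_one]

/-- A covariant pair that is dominated by the full crossed product defines a *-homomorphism of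
the corner at `e`. -/
theorem exists_cornerHom (h : IsCovariantPair α P e β S)
    (hnorm : ∀ c : G →₀ A, ‖∑ g ∈ c.support, β (c g) * fracIsometry P h.exists_fraction S g‖ ≤
      ‖CrossedProduct.ofFinsupp α c‖)
    (he : IsStarProjection (CrossedProduct.mk α e 1)) :
    ∃ L : CrossedProduct α →L[ℂ] B,
      (∀ a g, L (CrossedProduct.mk α a g) = β a * fracIsometry P h.exists_fraction S g) ∧
      (∀ x, L (CrossedProduct.mk α e 1 * x * CrossedProduct.mk α e 1) = L x) ∧
      ∃ Φ : corner (CrossedProduct.mk α e 1) he →⋆ₙₐ[ℂ] B, ∀ x, Φ x = L x := by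
  let W := fracIsometry P h.exists_fraction S
  let ε := CrossedProduct.mk α e 1
  let L₀ : (G →₀ A) →ₗ[ℂ] B := Finsupp.lsum ℂ fun g =>
    (LinearMap.mulRight ℂ (W g)).comp (β : A →ₗ[ℂ] B)
  have hL₀ : ∀ c, L₀ c = ∑ g ∈ c.support, β (c g) * W g := fun c => rfl
  have hb : ∀ c, ‖L₀ c‖ ≤ 1 * ‖CrossedProduct.ofFinsupp α c‖ := fun c => by
    rw [one_mul, hL₀]
    exact hnorm c
  let L := L₀.extendOfNorm (CrossedProduct.ofFinsupp α)
  have hL : ∀ a g, L (CrossedProduct.mk α a g) = β a * W g := by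
    intro a g
    rw [← CrossedProduct.ofFinsupp_single,
      LinearMap.extendOfNorm_eq CrossedProduct.denseRange_ofFinsupp ⟨1, hb⟩]
    exact Finsupp.lsum_single ℂ _ g a
  have hcut : ∀ x, L (ε * x * ε) = L x := by
    refine CrossedProduct.eq_of_forall_mk
      (f := L.comp ((ContinuousLinearMap.mul ℂ _).flip ε ∘L ContinuousLinearMap.mul ℂ _ ε))
      (g := L) (ContinuousLinearMap.continuous _) L.continuous fun a g => ?_
    change L (ε * CrossedProduct.mk α a g * ε) = L (CrossedProduct.mk α a g)
    rw [CrossedProduct.mk_mul, CrossedProduct.mk_mul, hL, hL, one_mul, mul_one, map_one,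
      NonUnitalStarAlgHom.coe_one, id, _root_.map_mul, h.proj_mul, mul_assoc]
    exact congrArg _ (h.map_mul_fracIsometry g)
  -- `L` is multiplicative with `e δ_1` inserted between the factors: this supplies the projection
  -- `β (α g e)` by which `W` fails to be multiplicative. Elements of the corner absorb the
  -- insertion.
  have hmul : ∀ x y, L (x * ε * y) = L x * L y := by
    intro x y
    refine CrossedProduct.eq_of_forall_mk
      (f := L.comp ((ContinuousLinearMap.mul ℂ _).flip (ε * y)))
      (g := ((ContinuousLinearMap.mul ℂ _).flip (L y)).comp L) (ContinuousLinearMap.continuous _)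
      (ContinuousLinearMap.continuous _) (fun a g => ?_) x |> fun h => by simpa [mul_assoc] using h
    change L (CrossedProduct.mk α a g * (ε * y)) = L (CrossedProduct.mk α a g) * L y
    refine CrossedProduct.eq_of_forall_mk
      (f := L.comp (ContinuousLinearMap.mul ℂ _ (CrossedProduct.mk α a g) ∘L
        ContinuousLinearMap.mul ℂ _ ε))
      (g := (ContinuousLinearMap.mul ℂ _ (L (CrossedProduct.mk α a g))).comp L)
      (ContinuousLinearMap.continuous _) (ContinuousLinearMap.continuous _) (fun b k => ?_) y
    change L (CrossedProduct.mk α a g * (ε * CrossedProduct.mk α b k)) =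
      L (CrossedProduct.mk α a g) * L (CrossedProduct.mk α b k)
    rw [CrossedProduct.mk_mul, CrossedProduct.mk_mul, hL, hL, hL, one_mul, map_one,
      NonUnitalStarAlgHom.coe_one, id]
    have h1 : β (α g (e * b)) * β (α g e) = β (α g (e * b)) := by
      rw [← _root_.map_mul, ← _root_.map_mul, mul_assoc, h.proj_comm, ← mul_assoc, h.proj_idem]
    calc _ = β a * (β (α g (e * b)) * W (g * k)) := by rw [_root_.map_mul, mul_assoc]
      _ = β a * (β (α g (e * b)) * (W g * W k)) := by
          rw [show W g * W k = _ from h.fracIsometry_mul g k, ← mul_assoc (β (α g (e * b))), h1]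
      _ = β a * (W g * β b * W k) := by
          rw [show W g * β b = _ from h.fracIsometry_mul_map g b, mul_assoc]
      _ = _ := by simp only [mul_assoc]
  have hstar : ∀ x, L (star x) = star (L x) := by
    intro x
    refine CrossedProduct.eq_of_forall_mk
      (f := (L : CrossedProduct α →+ B).comp (starAddEquiv : CrossedProduct α ≃+ _).toAddMonoidHom)
      (g := (starAddEquiv : B ≃+ _).toAddMonoidHom.comp (L : CrossedProduct α →+ B))
      (L.continuous.comp continuous_star) (continuous_star.comp L.continuous) (fun a g => ?_) x
    change L (star (CrossedProduct.mk α a g)) = star (L (CrossedProduct.mk α a g))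
    rw [CrossedProduct.star_mk, hL, hL, star_mul, ← map_star,
      show star (W g) = W g⁻¹ from h.star_fracIsometry g,
      show W g⁻¹ * β (star a) = _ from h.fracIsometry_mul_map g⁻¹ (star a), ← h.proj_comm,
      _root_.map_mul, _root_.map_mul, mul_assoc]
    exact congrArg _ (h.map_mul_fracIsometry g⁻¹).symm
  refine ⟨L, hL, hcut, ?_⟩
  have hcorner : ∀ x : corner ε he, (x : CrossedProduct α) * ε = x := by
    rintro ⟨_, b, rfl⟩
    change ε * b * ε * ε = ε * b * ε
    rw [mul_assoc _ ε ε, he.isIdempotentElem.eq]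
  exact ⟨{ toFun := fun x => L x
           map_smul' := fun t x => map_smul L t (x : CrossedProduct α)
           map_zero' := map_zero L
           map_add' := fun x y => map_add L (x : CrossedProduct α) y
           map_mul' := fun x y => by
            have := hmul x y
            rwa [hcorner] at this
           map_star' := fun x => hstar x }, fun _ => rfl⟩

end IsCovariantPair

end CovariantPairs

/-! ### Local and finite adelic integers -/

section IntegralAdeles

open IsDedekindDomain.HeightOneSpectrum

set_option linter.unusedSectionVars false

variable {K : Type u} [Field K] [NumberField K]

theorem isOpen_adicCompletionIntegers (v : HeightOneSpectrum (𝓞 K)) :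
    IsOpen (v.adicCompletionIntegers K : Set (v.adicCompletion K)) :=
  Valued.isOpen_valuationSubring _

theorem valued_algebraMap (v : HeightOneSpectrum (𝓞 K)) (k : K) :
    Valued.v (algebraMap K (v.adicCompletion K) k) = v.valuation K k :=
  valuedAdicCompletion_eq_valuation' v k

theorem valued_coe_int (v : HeightOneSpectrum (𝓞 K)) (n : 𝓞 K) :
    Valued.v (algebraMap K (v.adicCompletion K) n) = v.intValuation n := by
  rw [valued_algebraMap]
  exact v.valuation_of_algebraMap n

/-- `K` is dense in its completion, and dividing by `t` turns the required ball into the open ring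
of integers. -/
theorem exists_valued_sub_algebraMap_le (v : HeightOneSpectrum (𝓞 K)) (y : v.adicCompletion K)
    {t : v.adicCompletion K} (ht : t ≠ 0) :
    ∃ k : K, Valued.v (y - algebraMap K (v.adicCompletion K) k) ≤ Valued.v t := by
  have hcont : Continuous fun z : v.adicCompletion K => (y - z) * t⁻¹ :=
    (continuous_const.sub continuous_id).mul continuous_const
  obtain ⟨_, hz, k, rfl⟩ := (denseRange_algebraMap K v).inter_open_nonempty _
    ((isOpen_adicCompletionIntegers v).preimage hcont) ⟨y, by
      rw [Set.mem_preimage, sub_self, zero_mul]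
      exact zero_mem (v.adicCompletionIntegers K)⟩
  refine ⟨k, ?_⟩
  have h1 : Valued.v ((y - algebraMap K (v.adicCompletion K) k) * t⁻¹) ≤ 1 := hz
  rw [map_mul, map_inv₀] at h1
  rwa [mul_inv_le_iff₀ (zero_lt_iff.2 ((Valuation.ne_zero_iff _).2 ht)), one_mul] at h1

/-- Integers of the completion are approximated by global integers. -/
theorem exists_int_valued_sub_le (v : HeightOneSpectrum (𝓞 K)) {y : v.adicCompletion K}
    (hy : Valued.v y ≤ 1) {m : 𝓞 K} (hm : m ≠ 0) :
    ∃ n : 𝓞 K, Valued.v (y - algebraMap K (v.adicCompletion K) n) ≤ v.intValuation m := by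
  have hm0 : v.intValuation m ≠ 0 := v.intValuation_ne_zero m hm
  obtain ⟨k, hk⟩ := exists_valued_sub_algebraMap_le v y
    (t := algebraMap K (v.adicCompletion K) m) (by
      intro h
      apply hm0
      rw [← valued_coe_int, h, map_zero])
  rw [valued_coe_int] at hk
  -- The ultrametric inequality makes the approximant integral at `v`; an element of `K` integral at
  -- `v` is in turn approximated by a global integer.
  have hk1 : v.valuation K k ≤ 1 := by
    rw [← valued_algebraMap, ← sub_sub_cancel y (algebraMap K (v.adicCompletion K) k)]
    exact (Valuation.map_sub _ _ _).trans
      (max_le hy (hk.trans (v.intValuation_le_one m)))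
  obtain ⟨a, ha⟩ := v.exists_valuation_sub_lt_of_integer hk1 (Units.mk0 _ hm0)
  refine ⟨a, ?_⟩
  rw [← sub_sub_sub_cancel_right _ _ (algebraMap K (v.adicCompletion K) k), ← map_sub]
  refine (Valuation.map_sub _ _ _).trans (max_le hk ?_)
  rw [valued_algebraMap]
  exact ha.le

/-- A complete discrete valuation ring with finite residue field is compact. The residue field is
finite because global integers approximate local ones modulo the maximal ideal, so it is a quotient
of the finite ring `o/v`. -/
instance compactSpace_adicCompletionIntegers (v : HeightOneSpectrum (𝓞 K)) :
    CompactSpace (v.adicCompletionIntegers K) := by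
  have hfin : Finite (IsLocalRing.ResidueField (v.adicCompletionIntegers K)) := by
    have : Finite (𝓞 K ⧸ v.asIdeal) := Ideal.finiteQuotientOfFreeOfNeBot v.asIdeal v.ne_bot
    let f : 𝓞 K →+* IsLocalRing.ResidueField (v.adicCompletionIntegers K) :=
      (IsLocalRing.residue _).comp (algebraMap (𝓞 K) (v.adicCompletionIntegers K))
    have hker : ∀ x : v.adicCompletionIntegers K, Valued.v (x : v.adicCompletion K) < 1 →
        IsLocalRing.residue (v.adicCompletionIntegers K) x = 0 := by
      intro x hx
      rw [IsLocalRing.residue_eq_zero_iff, IsLocalRing.mem_maximalIdeal, mem_nonunits_iff,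
        adicCompletionIntegers.isUnit_iff_valued_eq_one]
      exact hx.ne
    have hf : ∀ a ∈ v.asIdeal, f a = 0 := by
      intro a ha
      refine hker _ ?_
      have := (v.intValuation_lt_one_iff_mem a).2 ha
      rwa [← valued_coe_int] at this
    refine Finite.of_surjective (Ideal.Quotient.lift v.asIdeal f hf) ?_
    intro x
    obtain ⟨y, rfl⟩ := IsLocalRing.residue_surjective x
    obtain ⟨m, hm, hm0⟩ := Submodule.exists_mem_ne_zero_of_ne_bot v.ne_bot
    obtain ⟨n, hn⟩ := exists_int_valued_sub_le v y.2 hm0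
    refine ⟨Ideal.Quotient.mk _ n, ?_⟩
    rw [Ideal.Quotient.lift_mk]
    refine (sub_eq_zero.1 ?_).symm
    change IsLocalRing.residue _ y - IsLocalRing.residue _ _ = 0
    rw [← map_sub]
    refine hker _ (lt_of_le_of_lt hn ?_)
    exact (v.intValuation_lt_one_iff_mem m).2 hm
  have hcomp : CompleteSpace (v.adicCompletionIntegers K) :=
    (Valued.isClosed_valuationSubring (v.adicCompletion K)).completeSpace_coe
  exact Valued.integer.compactSpace_iff_completeSpace_and_isDiscreteValuationRing_and_finite_residueField.2
    ⟨hcomp, inferInstanceAs (IsDiscreteValuationRing (v.adicCompletionIntegers K)), hfin⟩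

instance : T2Space (FinAdele K) :=
  inferInstanceAs (T2Space (RestrictedProduct (fun v : HeightOneSpectrum (𝓞 K) =>
    v.adicCompletion K) (fun v => (v.adicCompletionIntegers K : Set (v.adicCompletion K)))
      Filter.cofinite))

theorem isOpen_integralAdeles : IsOpen (integralAdeles K : Set (FinAdele K)) :=
  RestrictedProduct.isOpen_forall_mem (R := fun v : HeightOneSpectrum (𝓞 K) => v.adicCompletion K)
    (A := fun v => (v.adicCompletionIntegers K : Set (v.adicCompletion K)))
    isOpen_adicCompletionIntegers

/-- The structure map presents `ô` as a continuous image of the product of the compact local rings.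
-/
theorem isCompact_integralAdeles : IsCompact (integralAdeles K : Set (FinAdele K)) := by
  have : ∀ v : HeightOneSpectrum (𝓞 K),
      CompactSpace (v.adicCompletionIntegers K : Set (v.adicCompletion K)) :=
    compactSpace_adicCompletionIntegers
  have h := isCompact_range (RestrictedProduct.isEmbedding_structureMap
    (R := fun v : HeightOneSpectrum (𝓞 K) => v.adicCompletion K)
    (A := fun v => (v.adicCompletionIntegers K : Set (v.adicCompletion K)))
    (𝓕 := Filter.cofinite)).continuous
  rw [RestrictedProduct.range_structureMap] at h
  exact h

theorem isClopen_integralAdeles : IsClopen (integralAdeles K : Set (FinAdele K)) :=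
  ⟨isCompact_integralAdeles.isClosed, isOpen_integralAdeles⟩

instance : CompactSpace (integralAdeles K) := isCompact_iff_compactSpace.1 isCompact_integralAdeles

/-- The image of a global integer in the finite adeles. -/
abbrev intAdele (n : 𝓞 K) : FinAdele K := algebraMap (𝓞 K) (FinAdele K) n

theorem finAdele_mul_apply (x y : FinAdele K) (v : HeightOneSpectrum (𝓞 K)) :
    (x * y) v = x v * y v := rfl

theorem intAdele_mem (n : 𝓞 K) : intAdele n ∈ integralAdeles K := fun v =>
  v.coe_mem_adicCompletionIntegers (K := K) n

/-- An element of `K` that is integral at all finite places is an algebraic integer. -/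
theorem exists_int_of_mem_integralAdeles {x : K}
    (hx : algebraMap K (FinAdele K) x ∈ integralAdeles K) : ∃ n : 𝓞 K, (n : K) = x := by
  refine HeightOneSpectrum.mem_integers_of_valuation_le_one K x fun v => ?_
  rw [← valued_algebraMap]
  exact hx v

/-- The unit of the finite adeles given by a nonzero integer. -/
def intUnit (m : (𝓞 K)⁰) : Kˣ :=
  Units.mk0 ((m : 𝓞 K) : K) (by
    simp)

@[simp]
theorem coe_intUnit (m : (𝓞 K)⁰) : (intUnit m : K) = ((m : 𝓞 K) : K) := rfl

theorem intUnit_mul (k m : (𝓞 K)⁰) : intUnit (k * m) = intUnit k * intUnit m :=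
  Units.ext (by simp)

theorem coe_diagFin_intUnit (m : (𝓞 K)⁰) :
    ((diagFin K (intUnit m) : (FinAdele K)ˣ) : FinAdele K) = intAdele (m : 𝓞 K) := rfl

theorem intAdele_mul_injective (m : (𝓞 K)⁰) :
    Function.Injective fun y : FinAdele K => intAdele (m : 𝓞 K) * y := by
  rw [← coe_diagFin_intUnit]
  exact (diagFin K (intUnit m)).mulLeft_bijective.injective

/-- `o` is dense in `ô`: every element of `ô` is congruent modulo `m` to an element of `o`. -/
theorem exists_int_add_mul {y : FinAdele K} (hy : y ∈ integralAdeles K) (m : (𝓞 K)⁰) :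
    ∃ n : 𝓞 K, ∃ w ∈ integralAdeles K, y = intAdele n + intAdele (m : 𝓞 K) * w := by
  classical
  have hm0 : (m : 𝓞 K) ≠ 0 := nonZeroDivisors.ne_zero m.2
  choose x hx using fun v => exists_int_valued_sub_le v (hy v) hm0
  -- Only the finitely many places dividing `m` impose a condition; there the Chinese remainder
  -- theorem merges the local approximants into one integer. Elsewhere `m` is a local unit.
  have hfin : {v : HeightOneSpectrum (𝓞 K) | v.intValuation (m : 𝓞 K) < 1}.Finite := by
    simp_rw [intValuation_lt_one_iff_dvd]
    exact Ideal.finite_factors (by simp)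
  have hpow : ∀ v : HeightOneSpectrum (𝓞 K), ∃ k : ℕ, v.intValuation (m : 𝓞 K) =
      WithZero.exp (-(k : ℤ)) := fun v => ⟨_, v.intValuation_if_neg hm0⟩
  choose e he using hpow
  obtain ⟨n, hn⟩ := IsDedekindDomain.exists_forall_sub_mem_ideal (s := hfin.toFinset)
    (fun v : HeightOneSpectrum (𝓞 K) => v.asIdeal) e (fun v _ => v.prime)
    (fun v _ w _ hvw h => hvw (HeightOneSpectrum.ext h)) (fun v => x v)
  refine ⟨n, (((diagFin K (intUnit m))⁻¹ : (FinAdele K)ˣ) : FinAdele K) * (y - intAdele n), ?_, ?_⟩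
  · intro v
    have hle : Valued.v (y v - algebraMap K (v.adicCompletion K) n) ≤ v.intValuation (m : 𝓞 K) := by
      by_cases hv : v.intValuation (m : 𝓞 K) < 1
      · have h1 := hn v (by simpa using hv)
        rw [← intValuation_le_pow_iff_mem, ← he v, ← valued_coe_int] at h1
        have h2 : y v - algebraMap K (v.adicCompletion K) n =
            (y v - algebraMap K (v.adicCompletion K) (x v)) -
              algebraMap K (v.adicCompletion K) (n - x v : 𝓞 K) := by
          rw [show ((n - x v : 𝓞 K) : K) = (n : K) - x v from map_sub (algebraMap (𝓞 K) K) n (x v),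
            map_sub, sub_sub_sub_cancel_right]
        rw [h2]
        exact (Valuation.map_sub _ _ _).trans (max_le (hx v) h1)
      · have h1 : v.intValuation (m : 𝓞 K) = 1 := le_antisymm (v.intValuation_le_one _) (not_lt.1 hv)
        rw [h1]
        exact (Valuation.map_sub _ _ _).trans (max_le (hy v) (by
          rw [valued_coe_int]; exact v.intValuation_le_one n))
    have hmv : v.intValuation (m : 𝓞 K) ≠ 0 := v.intValuation_ne_zero _ hm0
    have h3 : ((((diagFin K (intUnit m))⁻¹ : (FinAdele K)ˣ) : FinAdele K) *
        (y - intAdele n)) v = (algebraMap K (v.adicCompletion K) (m : 𝓞 K))⁻¹ *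
          (y v - algebraMap K (v.adicCompletion K) n) := by
      have : (((diagFin K (intUnit m))⁻¹ : (FinAdele K)ˣ) : FinAdele K) v =
          (algebraMap K (v.adicCompletion K) (m : 𝓞 K))⁻¹ := by
        rw [← map_inv]
        exact map_inv₀ (algebraMap K (v.adicCompletion K)) _
      rw [finAdele_mul_apply, this]
      rfl
    rw [h3, mem_adicCompletionIntegers, map_mul, map_inv₀, valued_coe_int, mul_comm,
      mul_inv_le_iff₀ (zero_lt_iff.2 hmv), one_mul]
    exact hle
  · rw [← coe_diagFin_intUnit, Units.mul_inv_cancel_left]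
    ring

/-- `m ô ∩ o = m o`. -/
theorem dvd_of_intAdele_eq {n : 𝓞 K} {m : (𝓞 K)⁰} {w : FinAdele K} (hw : w ∈ integralAdeles K)
    (h : intAdele n = intAdele (m : 𝓞 K) * w) : (m : 𝓞 K) ∣ n := by
  have h1 : algebraMap K (FinAdele K) ((n : K) / ((m : 𝓞 K) : K)) = w := by
    apply intAdele_mul_injective m
    change algebraMap K (FinAdele K) ((m : 𝓞 K) : K) * _ = _
    rw [← map_mul, mul_div_cancel₀]
    · exact h
    · exact (intUnit m).ne_zero
  rw [← h1] at hw
  obtain ⟨k, hk⟩ := exists_int_of_mem_integralAdeles hw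
  refine ⟨k, RingOfIntegers.ext ?_⟩
  change _ = algebraMap (𝓞 K) K (m * k)
  rw [map_mul, show algebraMap (𝓞 K) K k = _ from hk, mul_div_cancel₀]
  exact (intUnit m).ne_zero

/-- The set `m ô`. -/
def multiples (m : (𝓞 K)⁰) : Set (FinAdele K) :=
  (fun y => intAdele (m : 𝓞 K) * y) '' integralAdeles K

theorem isOpen_multiples (m : (𝓞 K)⁰) : IsOpen (multiples m) :=
  isOpenMap_smul (diagFin K (intUnit m)) _ isOpen_integralAdeles

theorem isCompact_multiples (m : (𝓞 K)⁰) : IsCompact (multiples m) :=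
  isCompact_integralAdeles.image (continuous_const.mul continuous_id)

/-- If `y v ≠ 0`, a high power of a nonzero element of the prime at `v` has valuation below that of
`y v`, and `y` is not an integral multiple of it. -/
theorem eq_zero_of_forall_mem_multiples {y : FinAdele K} (h : ∀ m, y ∈ multiples m) : y = 0 := by
  refine FiniteAdeleRing.ext K fun v => ?_
  change y v = 0
  by_contra hy
  obtain ⟨m, hm, hm0⟩ := Submodule.exists_mem_ne_zero_of_ne_bot v.ne_bot
  have hne : Valued.v (y v) ≠ 0 := (Valuation.ne_zero_iff Valued.v).2 hy
  obtain ⟨k, hk⟩ := exists_pow_lt₀ ((v.intValuation_lt_one_iff_mem m).2 hm) (Units.mk0 _ hne)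
  obtain ⟨w, hw, hwy⟩ := h ⟨m ^ k, mem_nonZeroDivisors_of_ne_zero (pow_ne_zero k hm0)⟩
  have h0 : y v = algebraMap K (v.adicCompletion K) (m ^ k : 𝓞 K) * w v := by
    rw [← hwy, finAdele_mul_apply]
    rfl
  have h1 : Valued.v (y v) = v.intValuation (m ^ k) * Valued.v (w v) := by
    rw [h0, map_mul, valued_coe_int]
  have h2 : Valued.v (w v) ≤ 1 := hw v
  have h3 : v.intValuation m ^ k < v.intValuation (m ^ k) * Valued.v (w v) := h1 ▸ hk
  rw [← map_pow] at h3
  exact absurd h3 (not_lt.2 (mul_le_of_le_one_right' h2))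

theorem multiples_mul_subset (k m : (𝓞 K)⁰) : multiples (k * m) ⊆ multiples k := by
  rintro _ ⟨y, hy, rfl⟩
  refine ⟨intAdele (m : 𝓞 K) * y, mul_mem (intAdele_mem _) hy, ?_⟩
  simp [mul_assoc]

/-- The sets `m ô` are compact, directed downwards and meet only in zero, so by compactness one of
them lies in `U`. -/
theorem exists_multiples_subset {U : Set (FinAdele K)} (hU : IsOpen U) (h0 : (0 : FinAdele K) ∈ U) :
    ∃ m : (𝓞 K)⁰, multiples m ⊆ U := by
  by_contra! hne
  have h := IsCompact.nonempty_iInter_of_directed_nonempty_isCompact_isClosed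
    (fun m : (𝓞 K)⁰ => multiples m \ U)
    (fun k m => ⟨k * m, Set.sdiff_subset_sdiff_left (multiples_mul_subset k m), by
      rw [mul_comm k m]
      exact Set.sdiff_subset_sdiff_left (multiples_mul_subset m k)⟩)
    (fun m => Set.sdiff_nonempty.2 (hne m)) (fun m => (isCompact_multiples m).diff hU)
    (fun m => (isCompact_multiples m).isClosed.sdiff hU)
  obtain ⟨y, hy⟩ := h
  rw [Set.mem_iInter] at hy
  have hy0 := eq_zero_of_forall_mem_multiples fun m => (hy m).1
  exact (hy 1).2 (hy0 ▸ h0)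

end IntegralAdeles

/-! ### The ideal group -/

section IdealGroup

open IsDedekindDomain.HeightOneSpectrum

variable {K : Type u} [Field K] [NumberField K]

theorem finIdele_apply_ne_zero (z : (FinAdele K)ˣ) (v : HeightOneSpectrum (𝓞 K)) :
    (z : FinAdele K) v ≠ 0 := by
  intro h
  have h1 : (z : FinAdele K) v * ((z⁻¹ : (FinAdele K)ˣ) : FinAdele K) v = 1 := by
    rw [← finAdele_mul_apply, Units.mul_inv]
    rfl
  rw [h, zero_mul] at h1
  exact zero_ne_one h1

/-- The valuation of a finite idele at a finite place. -/
def ideleVal (v : HeightOneSpectrum (𝓞 K)) (z : (FinAdele K)ˣ) : WithZero (Multiplicative ℤ) :=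
  Valued.v ((z : FinAdele K) v)

theorem ideleVal_ne_zero (v : HeightOneSpectrum (𝓞 K)) (z : (FinAdele K)ˣ) : ideleVal v z ≠ 0 :=
  (Valuation.ne_zero_iff _).2 (finIdele_apply_ne_zero z v)

theorem ideleVal_mul (v : HeightOneSpectrum (𝓞 K)) (z w : (FinAdele K)ˣ) :
    ideleVal v (z * w) = ideleVal v z * ideleVal v w := by
  rw [ideleVal, Units.val_mul, finAdele_mul_apply, map_mul]
  rfl

theorem ideleVal_one (v : HeightOneSpectrum (𝓞 K)) : ideleVal v (1 : (FinAdele K)ˣ) = 1 :=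
  map_one Valued.v

theorem ideleVal_inv (v : HeightOneSpectrum (𝓞 K)) (z : (FinAdele K)ˣ) :
    ideleVal v z⁻¹ = (ideleVal v z)⁻¹ := by
  refine eq_inv_of_mul_eq_one_left ?_
  rw [← ideleVal_mul, inv_mul_cancel, ideleVal_one]

theorem ideleVal_diagFin (v : HeightOneSpectrum (𝓞 K)) (x : Kˣ) :
    ideleVal v (diagFin K x) = v.valuation K (x : K) :=
  valued_algebraMap v x

theorem finite_ideleVal_ne_one (z : (FinAdele K)ˣ) : {v | ideleVal v z ≠ 1}.Finite :=
  (FiniteAdeleRing.isUnit_iff.1 z.isUnit).2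

theorem mem_integralIdeles_iff (z : (FinAdele K)ˣ) :
    z ∈ integralIdeles K ↔ ∀ v, ideleVal v z = 1 := by
  constructor
  · rintro ⟨h1, h2⟩ v
    have h3 : ideleVal v z ≤ 1 := h1 v
    have h4 : ideleVal v z⁻¹ ≤ 1 := h2 v
    rw [ideleVal_inv, inv_le_one₀ (zero_lt_iff.2 (ideleVal_ne_zero v z))] at h4
    exact le_antisymm h3 h4
  · intro h
    refine ⟨fun v => (h v).le, fun v => ?_⟩
    have : ideleVal v z⁻¹ ≤ 1 := by rw [ideleVal_inv, h v, inv_one]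
    exact this

theorem mem_intUnits_of_diagFin_mem {x : Kˣ} (hx : diagFin K x ∈ integralIdeles K) :
    x ∈ intUnits K := by
  obtain ⟨n, hn⟩ := exists_int_of_mem_integralAdeles (x := (x : K)) hx.1
  have h2 : algebraMap K (FinAdele K) ((x⁻¹ : Kˣ) : K) ∈ integralAdeles K := by
    have h : (((diagFin K x)⁻¹ : (FinAdele K)ˣ) : FinAdele K) ∈ integralAdeles K := hx.2
    rw [← map_inv] at h
    exact h
  obtain ⟨m, hm⟩ := exists_int_of_mem_integralAdeles h2
  have h3 : n * m = 1 := RingOfIntegers.ext (by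
    change algebraMap (𝓞 K) K (n * m) = algebraMap (𝓞 K) K 1
    rw [map_mul, map_one, show algebraMap (𝓞 K) K n = _ from hn,
      show algebraMap (𝓞 K) K m = _ from hm, Units.mul_inv])
  refine ⟨⟨n, m, h3, by rw [mul_comm, h3]⟩, Units.ext ?_⟩
  exact hn

theorem diagFin_neg_one_mem : diagFin K (-1) ∈ integralIdeles K :=
  diagFin_mem_integralIdeles _ ⟨-1, Units.ext (by simp)⟩

/-- If the class number is one, every class in `𝔸_f^*/ô^*` has a representative in `G`, and the
representatives can be chosen multiplicatively. -/
theorem exists_section (hK : NumberField.classNumber K = 1) (G : Subgroup Kˣ)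
    (hG : ∀ x : Kˣ, x ∈ G ∨ -x ∈ G) :
    ∃ σ : IdealGroup K →* Kˣ, ∀ z, σ z ∈ G ∧ (diagFin K (σ z) : IdealGroup K) = z := by
  classical
  have hpid : IsPrincipalIdealRing (𝓞 K) := (NumberField.classNumber_eq_one_iff).1 hK
  -- A generator of the prime ideal, replaced by its negative if necessary to lie in `G`; the sign
  -- does not affect valuations.
  have hgen : ∀ v : HeightOneSpectrum (𝓞 K), ∃ x : Kˣ, x ∈ G ∧
      v.valuation K (x : K) = WithZero.exp (-1 : ℤ) ∧
      ∀ w : HeightOneSpectrum (𝓞 K), w ≠ v → w.valuation K (x : K) = 1 := by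
    intro v
    obtain ⟨r, hr⟩ := hpid.principal v.asIdeal
    have hr' : v.asIdeal = Ideal.span {r} := hr
    have hr0 : r ≠ 0 := by
      rintro rfl
      exact v.ne_bot (by simpa using hr')
    let x : Kˣ := Units.mk0 (r : K) (by simpa using hr0)
    have h1 : v.valuation K (x : K) = WithZero.exp (-1 : ℤ) := by
      rw [← v.intValuation_singleton hr0 hr']
      exact v.valuation_of_algebraMap r
    have h2 : ∀ w : HeightOneSpectrum (𝓞 K), w ≠ v → w.valuation K (x : K) = 1 := by
      intro w hw
      refine (w.valuation_of_algebraMap r).trans ?_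
      rw [intValuation_eq_one_iff]
      intro hmem
      have hle : v.asIdeal ≤ w.asIdeal := by
        rw [hr', Ideal.span_singleton_le_iff_mem]
        exact hmem
      exact hw (HeightOneSpectrum.ext (v.isMaximal.eq_of_le w.isPrime.ne_top hle).symm)
    rcases hG x with hx | hx
    · exact ⟨x, hx, h1, h2⟩
    · refine ⟨-x, hx, ?_, fun w hw => ?_⟩
      · rw [Units.val_neg, Valuation.map_neg, h1]
      · rw [Units.val_neg, Valuation.map_neg, h2 w hw]
  choose ϖ hϖG hϖv hϖw using hgen
  -- The valuation is `exp` of minus the order, so the exponent is the order of `z` at `v`. The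
  -- product over all `v` depends only on the fractional ideal of `z`.
  let f : (FinAdele K)ˣ → HeightOneSpectrum (𝓞 K) → Kˣ := fun z v =>
    ϖ v ^ (-(ideleVal v z).log)
  have hfin : ∀ z, Function.HasFiniteMulSupport (f z) := by
    intro z
    refine (finite_ideleVal_ne_one z).subset fun v hv => ?_
    intro h
    apply hv
    simp only [f, h, WithZero.log_one, neg_zero, zpow_zero]
  let τ : (FinAdele K)ˣ →* Kˣ :=
    { toFun := fun z => ∏ᶠ v, f z v
      map_one' := by
        refine finprod_eq_one_of_forall_eq_one fun v => ?_
        simp only [f, ideleVal_one, WithZero.log_one, neg_zero, zpow_zero]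
      map_mul' := fun z w => by
        rw [← finprod_mul_distrib (hfin z) (hfin w)]
        refine finprod_congr fun v => ?_
        simp only [f]
        rw [ideleVal_mul, WithZero.log_mul (ideleVal_ne_zero v z) (ideleVal_ne_zero v w), neg_add,
          zpow_add] }
  have hτG : ∀ z, τ z ∈ G := fun z =>
    finprod_induction (· ∈ G) (one_mem G) (fun _ _ => mul_mem) fun v => zpow_mem (hϖG v) _
  have hτv : ∀ z v, v.valuation K (τ z : K) = ideleVal v z := by
    intro z v
    let g : Kˣ →* WithZero (Multiplicative ℤ) :=
      (v.valuation K : K →* WithZero (Multiplicative ℤ)).comp (Units.coeHom K)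
    have hg : ∀ (x : Kˣ) (n : ℤ), g (x ^ n) = g x ^ n := fun x n => by
      change v.valuation K ((x ^ n : Kˣ) : K) = _
      rw [Units.val_zpow_eq_zpow_val, map_zpow₀]
      rfl
    change g (∏ᶠ w, f z w) = _
    rw [g.map_finprod (hfin z), finprod_eq_single _ v]
    · simp only [f, hg]
      rw [show g (ϖ v) = _ from hϖv v, ← WithZero.exp_zsmul, smul_eq_mul, neg_mul_neg, mul_one,
        WithZero.exp_log (ideleVal_ne_zero v z)]
    · intro w hw
      simp only [f, hg]
      rw [show g (ϖ w) = _ from hϖw w v hw.symm, one_zpow]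
  have hker : ∀ z ∈ integralIdeles K, τ z = 1 := by
    intro z hz
    refine finprod_eq_one_of_forall_eq_one fun v => ?_
    simp only [f, (mem_integralIdeles_iff z).1 hz v, WithZero.log_one, neg_zero, zpow_zero]
  refine ⟨QuotientGroup.lift (integralIdeles K) τ hker, fun z => ?_⟩
  induction z using QuotientGroup.induction_on with
  | H z =>
    refine ⟨hτG z, ?_⟩
    change ((diagFin K (τ z) : (FinAdele K)ˣ) : IdealGroup K) = z
    rw [QuotientGroup.eq, mem_integralIdeles_iff]
    intro v
    rw [ideleVal_mul, ideleVal_inv, ideleVal_diagFin, hτv,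
      inv_mul_cancel₀ (ideleVal_ne_zero v z)]

/-- The quotient of `G` by `G ∩ o^*` is the ideal group. -/
theorem exists_scalarGroup_equiv (hK : NumberField.classNumber K = 1) (G : Subgroup Kˣ)
    (hG : ∀ x : Kˣ, x ∈ G ∨ -x ∈ G) :
    ∃ γ : IdealGroup K ≃* ScalarGroup G,
      ∀ l : G, γ (diagFin K l : IdealGroup K) = (l : ScalarGroup G) := by
  obtain ⟨σ, hσ⟩ := exists_section hK G hG
  let f : ScalarGroup G →* IdealGroup K :=
    QuotientGroup.lift ((intUnits K).subgroupOf G)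
      ((QuotientGroup.mk' (integralIdeles K)).comp ((diagFin K).comp G.subtype)) (by
        intro x hx
        exact (QuotientGroup.eq_one_iff _).2 (diagFin_mem_integralIdeles _ hx))
  have hf : ∀ l : G, f (l : ScalarGroup G) = (diagFin K l : IdealGroup K) := fun _ => rfl
  have hinj : Function.Injective f := by
    rw [injective_iff_map_eq_one]
    intro x hx
    induction x using QuotientGroup.induction_on with
    | H l =>
      rw [hf, QuotientGroup.eq_one_iff] at hx
      exact (QuotientGroup.eq_one_iff l).2 (mem_intUnits_of_diagFin_mem hx)
  have hsurj : Function.Surjective f := fun z => ⟨((⟨σ z, (hσ z).1⟩ : G) : ScalarGroup G), (hσ z).2⟩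
  let e := MulEquiv.ofBijective f ⟨hinj, hsurj⟩
  refine ⟨e.symm, fun l => ?_⟩
  rw [MulEquiv.symm_apply_eq]
  rfl

end IdealGroup

/-! ### The space `X` -/

section SpaceX

variable {K : Type u} [Field K] [NumberField K]

/-- The set of infinite ideles that are positive at all real places. -/
def positiveIdeles (K : Type u) [Field K] : Set (InfiniteAdeleRing K)ˣ :=
  {x | ∀ (v : InfinitePlace K) (hv : v.IsReal),
    0 < InfinitePlace.Completion.extensionEmbeddingOfIsReal hv ((x : InfiniteAdeleRing K) v)}

theorem isOpen_positiveIdeles : IsOpen (positiveIdeles K) := by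
  have : positiveIdeles K = ⋂ v : InfinitePlace K, ⋂ hv : v.IsReal,
      {x : (InfiniteAdeleRing K)ˣ | 0 < InfinitePlace.Completion.extensionEmbeddingOfIsReal hv
        ((x : InfiniteAdeleRing K) v)} := by
    ext x
    simp [positiveIdeles]
  rw [this]
  refine isOpen_iInter_of_finite fun v => isOpen_iInter_of_finite fun hv => ?_
  refine isOpen_lt continuous_const ?_
  exact (InfinitePlace.Completion.isometry_extensionEmbeddingOfIsReal hv).continuous.comp
    ((continuous_apply v).comp Units.continuous_val)

/-- The positive infinite ideles are the continuous image of a product of half-lines and punctured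
planes, a connected set that also contains `1`. -/
theorem positiveIdeles_subset_connectedComponent {x : (InfiniteAdeleRing K)ˣ}
    (hx : x ∈ positiveIdeles K) :
    x ∈ Subgroup.connectedComponentOfOne (InfiniteAdeleRing K)ˣ := by
  have hpre : ∀ v : InfinitePlace K, PreconnectedSpace (positivePart v) := fun v =>
    isPreconnected_iff_preconnectedSpace.1 (isPreconnected_positivePart v)
  let f : (∀ v : InfinitePlace K, positivePart v) → (InfiniteAdeleRing K)ˣ := fun s =>
    { val := fun v => (s v : v.Completion)
      inv := fun v => (s v : v.Completion)⁻¹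
      val_inv := funext fun v => mul_inv_cancel₀ (s v).2.1
      inv_val := funext fun v => inv_mul_cancel₀ (s v).2.1 }
  have hf : Continuous f := by
    refine Units.continuous_iff.2 ⟨?_, ?_⟩
    · exact continuous_pi fun v => continuous_subtype_val.comp (continuous_apply v)
    · exact continuous_pi fun v =>
        (continuous_subtype_val.comp (continuous_apply v)).inv₀ fun s => (s v).2.1
  have hne : ∀ v, (x : InfiniteAdeleRing K) v ≠ 0 := by
    intro v h
    have h1 : (x : InfiniteAdeleRing K) v * ((x⁻¹ : (InfiniteAdeleRing K)ˣ) :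
        InfiniteAdeleRing K) v = 1 := congrFun x.mul_inv v
    rw [h, zero_mul] at h1
    exact zero_ne_one h1
  refine (isPreconnected_range hf).subset_connectedComponent ?_ ?_
  · refine ⟨fun v => ⟨1, one_ne_zero, fun hv => by simp⟩, ?_⟩
    exact Units.ext rfl
  · exact ⟨fun v => ⟨(x : InfiniteAdeleRing K) v, hne v, hx v⟩, Units.ext rfl⟩

/-- The infinite component of an idele. -/
def ideleInf (K : Type u) [Field K] [NumberField K] : (Adele K)ˣ →* (InfiniteAdeleRing K)ˣ :=
  Units.map
    { toFun := fun a : Adele K => (a.1 : InfiniteAdeleRing K)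
      map_one' := rfl
      map_mul' := fun _ _ => rfl }

/-- The finite component of an idele. -/
def ideleFin (K : Type u) [Field K] [NumberField K] : (Adele K)ˣ →* (FinAdele K)ˣ :=
  Units.map
    { toFun := fun a : Adele K => (a.2 : FinAdele K)
      map_one' := rfl
      map_mul' := fun _ _ => rfl }

theorem continuous_ideleInf : Continuous (ideleInf K) :=
  Continuous.units_map _ continuous_fst

theorem continuous_ideleFin : Continuous (ideleFin K) :=
  Continuous.units_map _ continuous_snd

theorem infIdele_mul_finIdele (a : (Adele K)ˣ) :
    infIdele K (ideleInf K a) * finIdele K (ideleFin K a) = a := by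
  apply Units.ext
  exact Prod.ext (mul_one (a : Adele K).1) (one_mul (a : Adele K).2)

theorem infIdele_mem_ideleU {x : (InfiniteAdeleRing K)ˣ} (hx : x ∈ positiveIdeles K) :
    infIdele K x ∈ ideleU K :=
  Subgroup.le_topologicalClosure _ (Subgroup.mem_sup_right
    ⟨x, positiveIdeles_subset_connectedComponent hx, rfl⟩)

theorem diagIdele_mem_ideleU (x : Kˣ) : diagIdele K x ∈ ideleU K :=
  Subgroup.le_topologicalClosure _ (Subgroup.mem_sup_left ⟨x, rfl⟩)

theorem ideleClass_eq_one {a : (Adele K)ˣ} (ha : a ∈ ideleU K) : ideleClass K a = 1 :=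
  (QuotientGroup.eq_one_iff a).2 ha

/-- The map `ô^* → 𝔸^*/U`. -/
def unitClass (K : Type u) [Field K] [NumberField K] (r : integralIdeles K) : IdeleClassQuot K :=
  ideleClass K (finIdele K r)

theorem isOpen_integralIdeles : IsOpen (integralIdeles K : Set (FinAdele K)ˣ) :=
  (isOpen_integralAdeles.preimage Units.continuous_val).inter
    (isOpen_integralAdeles.preimage Units.continuous_coe_inv)

/-- Infinite ideles positive at the real places die in `𝔸^*/U`. An open set of unit ideles thus has
the same image as its product with all of them, which is open in the ideles, and quotient maps of
groups are open. -/
theorem isOpenMap_unitClass : IsOpenMap (unitClass K) := by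
  intro W hW
  have hW' : IsOpen (Subtype.val '' W : Set (FinAdele K)ˣ) :=
    isOpen_integralIdeles.isOpenMap_subtype_val W hW
  let P : Set (Adele K)ˣ := ideleInf K ⁻¹' positiveIdeles K ∩ ideleFin K ⁻¹' (Subtype.val '' W)
  have hP : IsOpen P := (isOpen_positiveIdeles.preimage continuous_ideleInf).inter
    (hW'.preimage continuous_ideleFin)
  have hPW : unitClass K '' W = (QuotientGroup.mk : (Adele K)ˣ → (Adele K)ˣ ⧸ ideleU K) '' P := by
    ext q
    constructor
    · rintro ⟨r, hr, rfl⟩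
      refine ⟨finIdele K r, ⟨fun v hv => ?_, r, hr, rfl⟩, rfl⟩
      change 0 < InfinitePlace.Completion.extensionEmbeddingOfIsReal hv (1 : v.Completion)
      rw [map_one]
      exact one_pos
    · rintro ⟨a, ⟨ha, r, hr, hra⟩, rfl⟩
      refine ⟨r, hr, ?_⟩
      change ideleClass K (finIdele K r) = ideleClass K a
      rw [← infIdele_mul_finIdele a, map_mul, ideleClass_eq_one (infIdele_mem_ideleU ha), one_mul,
        hra]
  rw [hPW]
  exact QuotientGroup.isOpenMap_coe P hP

/-- Divide an idele by a scalar that makes its finite part a unit idele and its infinite part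
positive: both the scalar and the positive infinite part lie in `U`. -/
theorem surjective_unitClass (hK : NumberField.classNumber K = 1)
    (hr : NumberField.InfinitePlace.nrRealPlaces K ≤ 1) :
    Function.Surjective (unitClass K) := by
  classical
  intro q
  obtain ⟨a, rfl⟩ : ∃ a, ideleClass K a = q := QuotientGroup.mk_surjective q
  obtain ⟨σ, hσ⟩ := exists_section hK (⊤ : Subgroup Kˣ) fun x => Or.inl trivial
  have h1 : ∃ l : Kˣ, (ideleFin K a) * (diagFin K l)⁻¹ ∈ integralIdeles K := by
    refine ⟨σ (ideleFin K a : IdealGroup K), ?_⟩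
    have := (hσ (ideleFin K a : IdealGroup K)).2
    rw [QuotientGroup.eq] at this
    rwa [mul_comm]
  obtain ⟨l, hl⟩ := h1
  have h2 : ∃ l : Kˣ, (ideleFin K a) * (diagFin K l)⁻¹ ∈ integralIdeles K ∧
      ideleInf K a * (diagInf K l)⁻¹ ∈ positiveIdeles K := by
    by_cases hpos : ideleInf K a * (diagInf K l)⁻¹ ∈ positiveIdeles K
    · exact ⟨l, hl, hpos⟩
    -- Changing the sign of the scalar keeps the finite part a unit idele. With only one real place,
    -- it repairs all the signs at once.
    · refine ⟨-1 * l, ?_, ?_⟩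
      · rw [map_mul, mul_inv_rev, ← mul_assoc]
        exact mul_mem hl (inv_mem diagFin_neg_one_mem)
      · simp only [positiveIdeles, Set.mem_ofPred_eq, not_forall, not_lt] at hpos
        obtain ⟨v, hv, hle⟩ := hpos
        intro w hw
        have hwv : w = v := congrArg Subtype.val
          (Fintype.card_le_one_iff.1 hr (⟨w, hw⟩ : {w : InfinitePlace K // w.IsReal}) ⟨v, hv⟩)
        subst hwv
        let x := ideleInf K a * (diagInf K l)⁻¹
        have h3 : ideleInf K a * (diagInf K (-1 * l))⁻¹ = -1 * x := by
          have : diagInf K (-1) = -1 := Units.ext (by simp [diagInf])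
          rw [map_mul, this, mul_inv_rev, ← mul_assoc, mul_comm]
          simp [x]
        have h4 : ((x : InfiniteAdeleRing K) w) ≠ 0 := by
          intro h
          have h1 : (x : InfiniteAdeleRing K) w * ((x⁻¹ : (InfiniteAdeleRing K)ˣ) :
              InfiniteAdeleRing K) w = 1 := congrFun x.mul_inv w
          rw [h, zero_mul] at h1
          exact zero_ne_one h1
        rw [h3]
        have h5 : ((-1 * x : (InfiniteAdeleRing K)ˣ) : InfiniteAdeleRing K) w =
            -((x : InfiniteAdeleRing K) w) := by
          rw [Units.val_mul, Units.val_neg, Units.val_one, neg_one_mul]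
          rfl
        rw [h5, map_neg, neg_pos]
        refine lt_of_le_of_ne hle ?_
        exact (map_ne_zero _).2 h4
  obtain ⟨l, hl, hpos⟩ := h2
  refine ⟨⟨_, hl⟩, ?_⟩
  have h3 : a = diagIdele K l * infIdele K (ideleInf K a * (diagInf K l)⁻¹) *
      finIdele K (ideleFin K a * (diagFin K l)⁻¹) := by
    have h4 : diagIdele K l = infIdele K (diagInf K l) * finIdele K (diagFin K l) :=
      (infIdele_mul_finIdele (diagIdele K l)).symm
    conv_lhs => rw [← infIdele_mul_finIdele a]
    rw [h4, map_mul, map_mul, map_inv, map_inv]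
    generalize infIdele K (diagInf K l) = p
    generalize finIdele K (diagFin K l) = q
    generalize infIdele K (ideleInf K a) = s
    generalize finIdele K (ideleFin K a) = t
    calc s * t = p * p⁻¹ * (q * q⁻¹) * (s * t) := by rw [mul_inv_cancel, mul_inv_cancel]; simp
      _ = p * q * (s * p⁻¹) * (t * q⁻¹) := by
        simp only [mul_comm, mul_left_comm, mul_assoc]
  conv_rhs => rw [h3]
  rw [map_mul, map_mul, ideleClass_eq_one (diagIdele_mem_ideleU l),
    ideleClass_eq_one (infIdele_mem_ideleU hpos), one_mul, one_mul]
  rfl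

/-- The map `𝔸_f → X`, `y ↦ [(1, y)]`. -/
def toX (y : FinAdele K) : SpaceX K := Quotient.mk (spaceXSetoid K) (1, y)

theorem continuous_toX : Continuous (toX (K := K)) :=
  continuous_quotient_mk'.comp (by fun_prop)

theorem toX_eq_iff (y y' : FinAdele K) : toX y = toX y' ↔ adeleSetoid K y y' := by
  constructor
  · intro h
    obtain ⟨r, hr, h⟩ := Quotient.exact h
    have h1 : ideleClass K (finIdele K r) * 1 = 1 := congrArg Prod.fst h
    have h2 : ((r⁻¹ : (FinAdele K)ˣ) : FinAdele K) * y = y' := congrArg Prod.snd h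
    rw [mul_one] at h1
    refine ⟨r, hr, (QuotientGroup.eq_one_iff _).1 h1, ?_⟩
    rw [← h2, Units.mul_inv_cancel_left]
  · intro h
    exact congrArg (phiStar K) (Quotient.sound h)

theorem mk_eq_toX (r : integralIdeles K) (y : FinAdele K) :
    Quotient.mk (spaceXSetoid K) (unitClass K r, y) =
      toX (((r : (FinAdele K)ˣ) : FinAdele K) * y) := by
  refine Quotient.sound ⟨(r : (FinAdele K)ˣ)⁻¹, inv_mem r.2, Prod.ext ?_ ?_⟩
  · change ideleClass K (finIdele K (r : (FinAdele K)ˣ)⁻¹) * ideleClass K (finIdele K r) = 1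
    rw [← map_mul, ← map_mul, inv_mul_cancel, map_one, map_one]
  · rw [inv_inv]

end SpaceX

/-! ### The homeomorphism `𝔸_f/∼ ≅ X` -/

section Homeomorphism

variable {K : Type u} [Field K] [NumberField K]

theorem surjective_toX (hK : NumberField.classNumber K = 1)
    (hr : NumberField.InfinitePlace.nrRealPlaces K ≤ 1) : Function.Surjective (toX (K := K)) := by
  intro p
  induction p using Quotient.inductionOn with
  | h p =>
    obtain ⟨q, y⟩ := p
    obtain ⟨r, rfl⟩ := surjective_unitClass hK hr q
    exact ⟨_, (mk_eq_toX r y).symm⟩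

/-- The preimage of `toX '' O` in `𝔸^*/U × 𝔸_f` is the image of the open set of pairs `(r, y)` with
`r y ∈ O` under `unitClass × id`, an open map. Surjectivity of `unitClass` lets every first
coordinate be written as the class of some `r`. -/
theorem isOpenMap_toX (hK : NumberField.classNumber K = 1)
    (hr : NumberField.InfinitePlace.nrRealPlaces K ≤ 1) : IsOpenMap (toX (K := K)) := by
  intro O hO
  let W : Set (integralIdeles K × FinAdele K) :=
    {p | ((p.1 : (FinAdele K)ˣ) : FinAdele K) * p.2 ∈ O}
  have hW : IsOpen W := by
    refine hO.preimage ?_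
    exact (Units.continuous_val.comp (continuous_subtype_val.comp continuous_fst)).mul
      continuous_snd
  have key : Quotient.mk (spaceXSetoid K) ⁻¹' (toX '' O) =
      Prod.map (unitClass K) (id : FinAdele K → FinAdele K) '' W := by
    ext p
    constructor
    · obtain ⟨q, y⟩ := p
      obtain ⟨r, rfl⟩ := surjective_unitClass hK hr q
      rintro ⟨y', hy', h⟩
      rw [mk_eq_toX, toX_eq_iff] at h
      obtain ⟨z, hz, hzU, h⟩ := h
      refine ⟨(⟨z, hz⟩ * r, y), ?_, Prod.ext ?_ rfl⟩
      · change ((z * (r : (FinAdele K)ˣ) : (FinAdele K)ˣ) : FinAdele K) * y ∈ O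
        rw [Units.val_mul, mul_assoc, ← h]
        exact hy'
      · change ideleClass K (finIdele K (z * r)) = ideleClass K (finIdele K r)
        rw [map_mul, map_mul, ideleClass_eq_one hzU, one_mul]
    · rintro ⟨⟨r, y⟩, hry, rfl⟩
      exact ⟨_, hry, (mk_eq_toX r y).symm⟩
  refine isQuotientMap_quotient_mk'.isOpen_preimage.1 ?_
  change IsOpen (Quotient.mk (spaceXSetoid K) ⁻¹' (toX '' O))
  rw [key]
  exact (isOpenMap_unitClass.prodMap IsOpenMap.id) W hW

theorem exists_homeomorph (hK : NumberField.classNumber K = 1)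
    (hr : NumberField.InfinitePlace.nrRealPlaces K ≤ 1) :
    ∃ φ : AdeleQuot K ≃ₜ SpaceX K, ∀ p, φ p = phiStar K p := by
  have hcont : Continuous (phiStar K) := continuous_toX.quotient_lift _
  have hbij : Function.Bijective (phiStar K) := by
    constructor
    · intro p q
      induction p using Quotient.inductionOn with
      | h y =>
        induction q using Quotient.inductionOn with
        | h y' => exact fun h => Quotient.sound ((toX_eq_iff y y').1 h)
    · intro p
      obtain ⟨y, rfl⟩ := surjective_toX hK hr p
      exact ⟨Quotient.mk _ y, rfl⟩
  have hopen : IsOpenMap (phiStar K) := by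
    intro O hO
    have h : phiStar K '' O = toX '' (Quotient.mk (adeleSetoid K) ⁻¹' O) := by
      ext p
      constructor
      · rintro ⟨q, hq, rfl⟩
        induction q using Quotient.inductionOn with
        | h y => exact ⟨y, hq, rfl⟩
      · rintro ⟨y, hy, rfl⟩
        exact ⟨_, hy, rfl⟩
    rw [h]
    exact isOpenMap_toX hK hr _ (hO.preimage continuous_quotient_mk')
  exact ⟨(Equiv.ofBijective _ hbij).toHomeomorphOfContinuousOpen hcont hopen, fun _ => rfl⟩

theorem mul_mem_integralAdeles_iff {z : (FinAdele K)ˣ} (hz : z ∈ integralIdeles K)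
    (y : FinAdele K) : (z : FinAdele K) * y ∈ integralAdeles K ↔ y ∈ integralAdeles K := by
  refine ⟨fun h => ?_, fun h => mul_mem hz.1 h⟩
  have h' : ((z⁻¹ : (FinAdele K)ˣ) : FinAdele K) * ((z : FinAdele K) * y) ∈ integralAdeles K :=
    mul_mem hz.2 h
  rwa [Units.inv_mul_cancel_left] at h'

/-- Unit ideles preserve `ô`, so membership of the second coordinate does not depend on the
representative. -/
theorem mk_mem_subsetY (q : IdeleClassQuot K) (y : FinAdele K) :
    Quotient.mk (spaceXSetoid K) (q, y) ∈ subsetY K ↔ y ∈ integralAdeles K := by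
  constructor
  · rintro ⟨q', y', hy', h⟩
    obtain ⟨r, hr, h⟩ := Quotient.exact h
    have h2 : ((r⁻¹ : (FinAdele K)ˣ) : FinAdele K) * y = y' := congrArg Prod.snd h
    rw [← h2] at hy'
    exact (mul_mem_integralAdeles_iff (inv_mem hr) y).1 hy'
  · exact fun h => ⟨q, y, h, rfl⟩

theorem toX_mem_subsetY (y : FinAdele K) : toX y ∈ subsetY K ↔ y ∈ integralAdeles K :=
  mk_mem_subsetY 1 y

theorem isClopen_subsetY : IsClopen (subsetY K) := by
  refine isQuotientMap_quotient_mk'.isClopen_preimage.1 ?_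
  have h : Quotient.mk (spaceXSetoid K) ⁻¹' subsetY K = Prod.snd ⁻¹' (integralAdeles K) := by
    ext p
    exact mk_mem_subsetY p.1 p.2
  change IsClopen (Quotient.mk (spaceXSetoid K) ⁻¹' subsetY K)
  rw [h]
  exact isClopen_integralAdeles.preimage continuous_snd

theorem isCompact_subsetY (hK : NumberField.classNumber K = 1)
    (hr : NumberField.InfinitePlace.nrRealPlaces K ≤ 1) : IsCompact (subsetY K) := by
  have h : subsetY K = toX '' (integralAdeles K) := by
    ext p
    obtain ⟨y, rfl⟩ := surjective_toX hK hr p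
    constructor
    · exact fun hy => ⟨y, (toX_mem_subsetY y).1 hy, rfl⟩
    · rintro ⟨y', hy', h⟩
      rw [← h]
      exact (toX_mem_subsetY y').2 hy'
  rw [h]
  exact isCompact_integralAdeles.image continuous_toX

theorem mk_mem_integralQuot (y : FinAdele K) :
    Quotient.mk (adeleSetoid K) y ∈ integralQuot K ↔ y ∈ integralAdeles K := by
  constructor
  · rintro ⟨y', hy', h⟩
    obtain ⟨z, hz, -, rfl⟩ := Quotient.exact h
    exact (mul_mem_integralAdeles_iff hz y').2 hy'
  · exact fun h => ⟨y, h, rfl⟩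

theorem isClopen_integralQuot : IsClopen (integralQuot K) := by
  refine isQuotientMap_quotient_mk'.isClopen_preimage.1 ?_
  have h : Quotient.mk (adeleSetoid K) ⁻¹' integralQuot K = integralAdeles K := by
    ext y
    exact mk_mem_integralQuot y
  change IsClopen (Quotient.mk (adeleSetoid K) ⁻¹' integralQuot K)
  rw [h]
  exact isClopen_integralAdeles

theorem isCompact_integralQuot : IsCompact (integralQuot K) := by
  have h : integralQuot K = Quotient.mk (adeleSetoid K) '' (integralAdeles K) := by
    ext p
    constructor
    · rintro ⟨y, hy, rfl⟩
      exact ⟨y, hy, rfl⟩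
    · rintro ⟨y, hy, rfl⟩
      exact ⟨y, hy, rfl⟩
  rw [h]
  exact isCompact_integralAdeles.image continuous_quotient_mk'

theorem phiStar_mem_subsetY (p : AdeleQuot K) : phiStar K p ∈ subsetY K ↔ p ∈ integralQuot K := by
  induction p using Quotient.inductionOn with
  | h y => exact (toX_mem_subsetY y).trans (mk_mem_integralQuot y).symm

/-- An idele in `U` does not move the first coordinate. This makes `φ^*` equivariant for totally
positive scalars. -/
theorem idealActX_diagFin_toX (z : (FinAdele K)ˣ) (hz : finIdele K z ∈ ideleU K) (y : FinAdele K) :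
    idealActX K (z : IdealGroup K) (toX y) = toX ((z : FinAdele K) * y) := by
  refine congrArg (Quotient.mk (spaceXSetoid K)) (Prod.ext ?_ rfl)
  change (ideleClass K (finIdele K z))⁻¹ * 1 = 1
  rw [ideleClass_eq_one hz, inv_one, one_mul]

theorem indicatorC₀_apply {X : Type u} [TopologicalSpace X] {S : Set X}
    (h : IsClopen S ∧ IsCompact S) (x : X) : indicatorC₀ S x = S.indicator 1 x := by
  rw [indicatorC₀, dif_pos h]
  rfl

/-- The isomorphism `C₀(X) ≅ C₀(X')` induced by a homeomorphism `X' ≅ X`. -/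
def compHomeomorph {X X' : Type u} [TopologicalSpace X] [TopologicalSpace X'] (φ : X' ≃ₜ X) :
    C₀(X, ℂ) ≃⋆ₐ[ℂ] C₀(X', ℂ) where
  toFun f := f.comp φ.toCocompactMap
  invFun f := f.comp φ.symm.toCocompactMap
  left_inv f := by
    ext x
    exact congrArg f (φ.apply_symm_apply x)
  right_inv f := by
    ext x
    exact congrArg f (φ.symm_apply_apply x)
  map_mul' _ _ := rfl
  map_add' _ _ := rfl
  map_star' _ := rfl
  map_smul' _ _ := rfl

theorem exists_corner_equiv {B B' : Type*} [NonUnitalCStarAlgebra B] [NonUnitalCStarAlgebra B']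
    (Ψ : B ≃⋆ₐ[ℂ] B') {e : B} {e' : B'} (he : IsStarProjection e) (he' : IsStarProjection e')
    (h : Ψ e = e') : ∃ Ψ' : corner e he ≃⋆ₐ[ℂ] corner e' he', ∀ a, (Ψ' a : B') = Ψ a := by
  have h' : Ψ.symm e' = e := by rw [← h, StarAlgEquiv.symm_apply_apply]
  have h1 : ∀ a ∈ corner e he, Ψ a ∈ corner e' he' := by
    rintro _ ⟨b, rfl⟩
    exact ⟨Ψ b, by rw [map_mul, map_mul, h]⟩
  have h2 : ∀ a ∈ corner e' he', Ψ.symm a ∈ corner e he := by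
    rintro _ ⟨b, rfl⟩
    exact ⟨Ψ.symm b, by rw [map_mul, map_mul, h']⟩
  exact ⟨{
    toFun := fun a => ⟨Ψ a, h1 a a.2⟩
    invFun := fun a => ⟨Ψ.symm a, h2 a a.2⟩
    left_inv := fun a => Subtype.ext (Ψ.symm_apply_apply _)
    right_inv := fun a => Subtype.ext (Ψ.apply_symm_apply _)
    map_mul' := fun a b => Subtype.ext (map_mul Ψ _ _)
    map_add' := fun a b => Subtype.ext (map_add Ψ _ _)
    map_star' := fun a => Subtype.ext (map_star Ψ _)
    map_smul' := fun c a => Subtype.ext (map_smul Ψ c _) }, fun _ => rfl⟩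

/-- Total positivity of `G` puts its finite ideles into `U`, which gives equivariance; containing
`x` or `-x` for every `x` makes `G` map onto the ideal group. -/
theorem phiStarInducesIsos (hK : NumberField.classNumber K = 1)
    (hr : NumberField.InfinitePlace.nrRealPlaces K ≤ 1) (G : Subgroup Kˣ)
    (hG : IsTotallyPositive G) (hG' : ∀ x : Kˣ, x ∈ G ∨ -x ∈ G) : PhiStarInducesIsos G hG := by
  obtain ⟨φ, hφ⟩ := exists_homeomorph hK hr
  obtain ⟨γ, hγ⟩ := exists_scalarGroup_equiv hK G hG'
  obtain ⟨σ, hσ⟩ := exists_section hK G hG'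
  have hequi : ∀ (l : G) (p : AdeleQuot K),
      φ (scalarAct G hG (l : ScalarGroup G) p) =
        idealActX K (diagFin K l : IdealGroup K) (φ p) := by
    intro l p
    rw [hφ, hφ]
    induction p using Quotient.inductionOn with
    | h y => exact (idealActX_diagFin_toX _ (finIdele_diagFin_mem _ (hG l l.2)) y).symm
  have hcov : ∀ (z : IdealGroup K) (f : C₀(SpaceX K, ℂ)),
      compHomeomorph φ (translation (idealActX K) z f) =
        translation (scalarAct G hG) (γ z) (compHomeomorph φ f) := by
    intro z f
    obtain ⟨l, hl⟩ : ∃ l : G, (diagFin K l : IdealGroup K) = z⁻¹ :=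
      ⟨⟨σ z⁻¹, (hσ z⁻¹).1⟩, (hσ z⁻¹).2⟩
    ext p
    change f (idealActX K z⁻¹ (φ p)) = f (φ (scalarAct G hG (γ z)⁻¹ p))
    rw [← map_inv γ, ← hl, hγ, hequi]
  obtain ⟨Ψ, hΨ⟩ := CrossedProduct.exists_equiv (compHomeomorph φ) γ hcov
  have hΨe : Ψ (indicatorElt (idealActX K) (subsetY K)) =
      indicatorElt (scalarAct G hG) (integralQuot K) := by
    rw [indicatorElt, hΨ, map_one, indicatorElt]
    congr 1
    ext p
    change indicatorC₀ (subsetY K) (φ p) = _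
    rw [indicatorC₀_apply ⟨isClopen_subsetY, isCompact_subsetY hK hr⟩,
      indicatorC₀_apply ⟨isClopen_integralQuot, isCompact_integralQuot⟩, hφ]
    by_cases hp : p ∈ integralQuot K
    · rw [Set.indicator_of_mem hp, Set.indicator_of_mem ((phiStar_mem_subsetY p).2 hp)]
      rfl
    · rw [Set.indicator_of_notMem hp,
        Set.indicator_of_notMem (mt (phiStar_mem_subsetY p).1 hp)]
  obtain ⟨Ψ', hΨ'⟩ := exists_corner_equiv Ψ (isStarProjection_indicatorElt _ _)
    (isStarProjection_indicatorElt _ _) hΨe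
  refine ⟨φ, hφ, Ψ, fun f l => ?_, Ψ', hΨ'⟩
  rw [hΨ, hγ]
  rfl

end Homeomorphism

/-! ### The ring C*-algebra -/

theorem mul_sum_mul_eq_sum {B ι : Type*} [CStarAlgebra B] [Fintype ι] (a b : B) (f : ι → B) :
    a * (∑ i, f i) * b = ∑ i, a * f i * b := by
  rw [Finset.mul_sum, Finset.sum_mul]

namespace RingCStarAlgebra

variable {R : Type u} [CommRing R]

/-- The representation of `𝔄[R]` defined by a representation of the generators and relations. -/
def eval (ρ : RingRep R) : RingCStarAlgebra R →⋆ₐ[ℂ] (ρ.H →L[ℂ] ρ.H) where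
  toFun x := (x.1 : RingRep.Ambient R) ρ
  map_one' := rfl
  map_mul' _ _ := rfl
  map_zero' := rfl
  map_add' _ _ := rfl
  commutes' _ := rfl
  map_star' _ := rfl

theorem eval_s (ρ : RingRep R) (m : R⁰) : eval ρ (s m) = ρ.s m := rfl

theorem eval_u (ρ : RingRep R) (n : R) : eval ρ (u n) = ρ.u n := rfl

theorem ext_eval {x y : RingCStarAlgebra R} (h : ∀ ρ, eval ρ x = eval ρ y) : x = y :=
  Subtype.ext (lp.ext (funext h))

theorem norm_le_of_forall_eval {x : RingCStarAlgebra R} {C : ℝ} (hC : 0 ≤ C)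
    (h : ∀ ρ, ‖eval ρ x‖ ≤ C) : ‖x‖ ≤ C :=
  lp.norm_le_of_forall_le hC h

theorem star_s_mul_s (m : R⁰) : star (s m) * s m = 1 :=
  ext_eval fun ρ => by
    rw [map_mul, map_star, eval_s, ρ.isometry_s, map_one]

theorem s_mul_s (k m : R⁰) : s k * s m = s (k * m) :=
  ext_eval fun ρ => by rw [map_mul, eval_s, eval_s, eval_s, ρ.s_mul]

theorem u_mul_u (l n : R) : u l * u n = u (l + n) :=
  ext_eval fun ρ => by rw [map_mul, eval_u, eval_u, eval_u, ρ.u_mul]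

theorem star_u_mul_u (n : R) : star (u n) * u n = 1 :=
  ext_eval fun ρ => by
    rw [map_mul, map_star, eval_u, map_one]
    exact (Unitary.mem_iff.1 (ρ.unitary_u n)).1

theorem s_mul_u (m : R⁰) (n : R) : s m * u n = u (m * n) * s m :=
  ext_eval fun ρ => by rw [map_mul, map_mul, eval_u, eval_s, eval_u, ρ.s_mul_u]

theorem u_zero : u (0 : R) = 1 := by
  have h := u_mul_u (0 : R) 0
  rw [add_zero] at h
  calc u (0 : R) = star (u 0) * u 0 * u 0 := by rw [star_u_mul_u, one_mul]
    _ = 1 := by rw [mul_assoc, h, star_u_mul_u]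

theorem u_mul_u_neg (n : R) : u n * u (-n) = 1 := by
  rw [u_mul_u, add_neg_cancel, u_zero]

theorem star_u (n : R) : star (u n) = u (-n) :=
  calc star (u n) = star (u n) * (u n * u (-n)) := by rw [u_mul_u_neg, mul_one]
    _ = u (-n) := by rw [← mul_assoc, star_u_mul_u, one_mul]

/-- The projection `u^n s_m s_m^* u^{-n}`. -/
def proj (m : R⁰) (n : R) : RingCStarAlgebra R := u n * (s m * star (s m)) * u (-n)

theorem proj_zero (m : R⁰) : proj m 0 = s m * star (s m) := by
  rw [proj, neg_zero, u_zero, one_mul, mul_one]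

theorem proj_eq_mul_star (m : R⁰) (n : R) : proj m n = (u n * s m) * star (u n * s m) := by
  rw [proj, star_mul, star_u]
  simp only [mul_assoc]

theorem star_us_mul_us (m : R⁰) (n : R) : star (u n * s m) * (u n * s m) = 1 := by
  rw [star_mul, mul_assoc, ← mul_assoc (star (u n)), star_u_mul_u, one_mul, star_s_mul_s]

theorem star_proj (m : R⁰) (n : R) : star (proj m n) = proj m n := by
  rw [proj_eq_mul_star, star_mul, star_star]

theorem proj_mul_self (m : R⁰) (n : R) : proj m n * proj m n = proj m n := by
  rw [proj_eq_mul_star, mul_assoc, ← mul_assoc (star _), star_us_mul_us, one_mul]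

theorem us_eq (m : R⁰) (n k : R) : u (n + m * k) * s m = u n * s m * u k := by
  rw [mul_assoc, s_mul_u, ← mul_assoc, u_mul_u]

/-- Shifting `n` by `m k` multiplies the isometry `u n * s m` on the right by the unitary `u k`,
which leaves the range projection unchanged. -/
theorem proj_add_mul (m : R⁰) (n k : R) : proj m (n + m * k) = proj m n := by
  rw [proj_eq_mul_star, us_eq, star_mul, mul_assoc, ← mul_assoc (u k), star_u, u_mul_u_neg,
    one_mul, proj_eq_mul_star]

theorem proj_congr {m : R⁰} {n n' : R} (h : (m : R) ∣ n - n') : proj m n = proj m n' := by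
  obtain ⟨k, hk⟩ := h
  rw [← proj_add_mul m n' k, ← hk, add_sub_cancel]

theorem dvd_sub_out (m : R⁰) (n : R) :
    (m : R) ∣ n - Quotient.out (Ideal.Quotient.mk (Ideal.span {(m : R)}) n) := by
  rw [← Ideal.mem_span_singleton, ← Ideal.Quotient.eq]
  exact (Quotient.out_eq _).symm

theorem proj_out (m : R⁰) (n : R) :
    proj m (Quotient.out (Ideal.Quotient.mk (Ideal.span {(m : R)}) n)) = proj m n :=
  (proj_congr (dvd_sub_out m n)).symm

theorem eval_sum_proj (ρ : RingRep R) (m : R⁰) [Fintype (R ⧸ Ideal.span {(m : R)})] :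
    eval ρ (∑ c : R ⧸ Ideal.span {(m : R)}, proj m (Quotient.out c)) = 1 := by
  rw [← ρ.sum_eq_one m, finsum_eq_sum_of_fintype, map_sum]
  rfl

theorem sum_proj (m : R⁰) [Fintype (R ⧸ Ideal.span {(m : R)})] :
    ∑ c : R ⧸ Ideal.span {(m : R)}, proj m (Quotient.out c) = 1 :=
  ext_eval fun ρ => by rw [eval_sum_proj, map_one]

/-- Conjugating the sum relation for `k` by the isometry `u n * s m` splits the class `n` modulo `m`
into its classes modulo `m k`. -/
theorem proj_eq_sum (m k : R⁰) (n : R) [Fintype (R ⧸ Ideal.span {(k : R)})] :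
    proj m n = ∑ c : R ⧸ Ideal.span {(k : R)}, proj (m * k) (n + m * Quotient.out c) := by
  have h1 : ∀ j, proj (m * k) (n + m * j) = u n * s m * proj k j * star (u n * s m) := by
    intro j
    have h2 : u (n + m * j) * s (m * k) = u n * s m * (u j * s k) := by
      rw [← s_mul_s, ← mul_assoc, us_eq]
      simp only [mul_assoc]
    rw [proj_eq_mul_star, proj_eq_mul_star, h2, star_mul (u n * s m)]
    simp only [mul_assoc]
  rw [Finset.sum_congr rfl fun c _ => h1 _]
  refine Eq.trans ?_ (mul_sum_mul_eq_sum _ _ _)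
  rw [sum_proj, mul_one, proj_eq_mul_star]

theorem star_s_mul_proj_mul_s (c m : R⁰) (n : R) :
    star (s c) * proj (c * m) (c * n) * s c = proj m n := by
  have h : u (c * n) * s (c * m) = s c * (u n * s m) := by
    rw [← s_mul_s, ← mul_assoc, ← mul_assoc, s_mul_u]
  rw [proj_eq_mul_star, h, star_mul (s c)]
  calc _ = star (s c) * s c * (u n * s m * star (u n * s m)) * (star (s c) * s c) := by
        simp only [mul_assoc]
    _ = proj m n := by rw [star_s_mul_s, one_mul, mul_one, proj_eq_mul_star]

end RingCStarAlgebra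

/-- Projections in a C*-algebra that sum to one are orthogonal. -/
theorem mul_eq_zero_of_sum_eq_one {B ι : Type*} [CStarAlgebra B] [Fintype ι] (p : ι → B)
    (hs : ∀ i, star (p i) = p i) (hi : ∀ i, p i * p i = p i) (h : ∑ i, p i = 1) {i j : ι}
    (hij : i ≠ j) : p i * p j = 0 := by
  classical
  let _ := CStarAlgebra.spectralOrder B
  let _ := CStarAlgebra.spectralOrderedRing B
  -- Compressing `∑ p k = 1` by `p j` gives `p j` on both sides, so the positive terms with `k ≠ j`
  -- sum to zero and each of them vanishes.
  have h1 : ∑ k ∈ Finset.univ.erase j, star (p k * p j) * (p k * p j) = 0 := by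
    have h2 : ∑ k, star (p k * p j) * (p k * p j) = p j := by
      have h3 : ∀ k, star (p k * p j) * (p k * p j) = p j * p k * p j := fun k => by
        rw [star_mul, hs, hs, mul_assoc, ← mul_assoc (p k), hi, mul_assoc]
      simp only [h3, ← Finset.sum_mul, ← Finset.mul_sum, h, mul_one, hi]
    rw [← Finset.add_sum_erase _ _ (Finset.mem_univ j)] at h2
    simp only [hi, hs] at h2 ⊢
    exact add_eq_left.1 h2
  rw [Finset.sum_eq_zero_iff_of_nonneg fun k _ => star_mul_self_nonneg _] at h1
  exact CStarRing.star_mul_self_eq_zero_iff _ |>.1 (h1 i (by simp [hij]))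

/-! ### Orthogonality and commutation of the coset projections -/

namespace RingCStarAlgebra

variable {R : Type u} [CommRing R] [hfin : ∀ m : R⁰, Finite (R ⧸ Ideal.span {(m : R)})]

theorem proj_mul_proj_of_not_dvd {m : R⁰} {n n' : R} (h : ¬ (m : R) ∣ n - n') :
    proj m n * proj m n' = 0 := by
  have := Fintype.ofFinite (R ⧸ Ideal.span {(m : R)})
  rw [← proj_out m n, ← proj_out m n']
  refine mul_eq_zero_of_sum_eq_one
    (fun c : R ⧸ Ideal.span {(m : R)} => proj m (Quotient.out c)) (fun _ => star_proj _ _)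
    (fun _ => proj_mul_self _ _) (sum_proj m) ?_
  rwa [Ne, Ideal.Quotient.eq, Ideal.mem_span_singleton]

theorem commute_proj_same (m : R⁰) (n n' : R) : Commute (proj m n) (proj m n') := by
  by_cases h : (m : R) ∣ n - n'
  · rw [proj_congr h]
  · have h' : ¬ (m : R) ∣ n' - n := by rwa [← dvd_neg, neg_sub]
    exact (proj_mul_proj_of_not_dvd h).trans (proj_mul_proj_of_not_dvd h').symm

/-- Both projections are sums of projections for the common modulus `m m'`, and those are pairwise
equal or orthogonal. -/
theorem commute_proj (m m' : R⁰) (n n' : R) : Commute (proj m n) (proj m' n') := by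
  have := Fintype.ofFinite (R ⧸ Ideal.span {(m : R)})
  have := Fintype.ofFinite (R ⧸ Ideal.span {(m' : R)})
  rw [proj_eq_sum m m' n, proj_eq_sum m' m n', mul_comm m' m]
  exact Commute.sum_left _ _ _ fun c _ => Commute.sum_right _ _ _ fun c' _ =>
    commute_proj_same _ _ _

/-- The range projections of `s c` and `u k * s c` belong to different classes modulo `c`, so they
are orthogonal. -/
theorem star_s_mul_u_mul_s {c : R⁰} {k : R} (h : ¬ (c : R) ∣ k) : star (s c) * u k * s c = 0 := by
  have h1 : proj c 0 * proj c k = 0 :=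
    proj_mul_proj_of_not_dvd (by rwa [zero_sub, dvd_neg])
  rw [proj_zero, proj_eq_mul_star] at h1
  calc star (s c) * u k * s c
      = star (s c) * s c * (star (s c) * u k * s c) * (star (u k * s c) * (u k * s c)) := by
        rw [star_s_mul_s, star_us_mul_us, one_mul, mul_one]
    _ = star (s c) * (s c * star (s c) * (u k * s c * star (u k * s c))) * (u k * s c) := by
        simp only [mul_assoc]
    _ = 0 := by rw [h1, mul_zero, zero_mul]

theorem star_s_mul_proj_mul_s_of_not_dvd {c m : R⁰} {k : R} (h : ¬ (c : R) ∣ k) :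
    star (s c) * proj (c * m) k * s c = 0 := by
  rw [proj_eq_mul_star, ← s_mul_s]
  calc _ = star (s c) * u k * s c * (s m * star (u k * (s c * s m)) * s c) := by
        simp only [mul_assoc]
    _ = 0 := by rw [star_s_mul_u_mul_s h, zero_mul]

end RingCStarAlgebra

/-! ### Continuous functions on `ô` in the ring C*-algebra -/

/-- A family of commuting self-adjoint elements of a C*-algebra, on which the characters of the
algebras that contain them are given by functions `f i` on `X`, defines a representation of
`C(X)`. -/
theorem exists_starAlgHom_of_points {B ι X : Type*} [CStarAlgebra B] [TopologicalSpace X]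
    (p : ι → B) (hs : ∀ i, star (p i) = p i) (hc : ∀ i j, Commute (p i) (p j)) (f : ι → X → ℂ)
    (hpt : ∀ (D : StarSubalgebra ℂ B) (hD : ∀ i, p i ∈ D) (χ : D →ₐ[ℂ] ℂ),
      ∃ x, ∀ i, χ ⟨p i, hD i⟩ = f i x)
    (htop : ∀ x, ∀ U ∈ nhds x, ∃ i, f i x ≠ 0 ∧ ∀ x', f i x' ≠ 0 → x' ∈ U) :
    ∃ α : C(X, ℂ) →⋆ₐ[ℂ] B, ∀ i (g : C(X, ℂ)), (∀ x, g x = f i x) → α g = p i := by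
  let S := StarAlgebra.adjoin ℂ (Set.range p)
  let D : StarSubalgebra ℂ B := S.topologicalClosure
  have hS : IsMulCommutative S := by
    refine StarAlgebra.isMulCommutative_adjoin ℂ ?_ ?_
    · rintro _ ⟨i, rfl⟩ _ ⟨j, rfl⟩
      exact hc i j
    · rintro _ ⟨i, rfl⟩ _ ⟨j, rfl⟩
      rw [hs]
      exact hc i j
  have hcomm : ∀ x y : D, x * y = y * x :=
    (S.commRingTopologicalClosure hS.is_comm.comm).mul_comm
  have hclosed : IsClosed (D : Set B) := isClosed_closure
  let _ : CommCStarAlgebra D :=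
    { StarSubalgebra.cstarAlgebra D (h_closed := hclosed) with mul_comm := hcomm }
  have hD : ∀ i, p i ∈ D := fun i => S.le_topologicalClosure (StarAlgebra.subset_adjoin ℂ _ ⟨i, rfl⟩)
  -- This maps the character space of the commutative algebra `D` to `X`. Its continuity comes from
  -- `htop`: the sets where some `f i` is nonzero contain arbitrarily small neighbourhoods of each
  -- point.
  choose y hy using fun χ : WeakDual.characterSpace ℂ D =>
    hpt D hD (WeakDual.CharacterSpace.toAlgHom χ)
  have hcont : Continuous y := by
    refine continuous_iff_continuousAt.2 fun χ U hU => ?_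
    obtain ⟨i, hi, hiU⟩ := htop _ U hU
    rw [← hy] at hi
    have hopen : IsOpen {χ : WeakDual.characterSpace ℂ D | χ ⟨p i, hD i⟩ ≠ 0} :=
      isOpen_ne.preimage ((map_continuous (gelfandStarTransform D ⟨p i, hD i⟩)))
    rw [Filter.mem_map]
    refine Filter.mem_of_superset (hopen.mem_nhds hi) fun χ' hχ' => ?_
    refine hiU _ ?_
    rw [← hy]
    exact hχ'
  -- Functions on `X` are pulled back to the character space and read as elements of `D` by the
  -- inverse Gelfand transform.
  let α : C(X, ℂ) →⋆ₐ[ℂ] B := (D.subtype.comp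
    ((gelfandStarTransform D).symm : C(WeakDual.characterSpace ℂ D, ℂ) →⋆ₐ[ℂ] D)).comp
      (ContinuousMap.compStarAlgHom' ℂ ℂ ⟨y, hcont⟩)
  refine ⟨α, fun i g hg => ?_⟩
  have h : (gelfandStarTransform D).symm (g.comp ⟨y, hcont⟩) = ⟨p i, hD i⟩ := by
    rw [StarAlgEquiv.symm_apply_eq]
    ext χ
    exact (hg (y χ)).trans (hy χ i).symm
  exact congrArg Subtype.val h

section Coset

variable {K : Type u} [Field K] [NumberField K]

instance finite_quotient_span (m : (𝓞 K)⁰) : Finite (𝓞 K ⧸ Ideal.span {(m : 𝓞 K)}) :=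
  Ideal.finiteQuotientOfFreeOfNeBot _ (by
    rw [Ne, Ideal.span_singleton_eq_bot]
    exact nonZeroDivisors.ne_zero m.2)

theorem mem_integralCoset {m : (𝓞 K)⁰} {n : 𝓞 K} {y : integralAdeles K} :
    y ∈ integralCoset m n ↔ (y : FinAdele K) - intAdele n ∈ multiples m := by
  constructor
  · rintro ⟨w, hw, h⟩
    exact ⟨w, hw, by rw [h, add_sub_cancel_left]⟩
  · rintro ⟨w, hw, h⟩
    exact ⟨w, hw, by rw [← sub_eq_iff_eq_add', ← h]⟩

theorem isClopen_integralCoset (m : (𝓞 K)⁰) (n : 𝓞 K) : IsClopen (integralCoset m n) := by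
  have h : integralCoset m n =
      (fun y : integralAdeles K => (y : FinAdele K) - intAdele n) ⁻¹' multiples m := by
    ext y
    exact mem_integralCoset
  rw [h]
  exact IsClopen.preimage ⟨(isCompact_multiples m).isClosed, isOpen_multiples m⟩
    (continuous_subtype_val.sub continuous_const)

theorem exists_mem_integralCoset (m : (𝓞 K)⁰) (y : integralAdeles K) :
    ∃ n, y ∈ integralCoset m n := by
  obtain ⟨n, w, hw, h⟩ := exists_int_add_mul y.2 m
  exact ⟨n, w, hw, h⟩

theorem integralCoset_subset {m k : (𝓞 K)⁰} {n n' : 𝓞 K} (h : (m : 𝓞 K) ∣ n' - n) :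
    integralCoset (m * k) n' ⊆ integralCoset m n := by
  rintro y ⟨w, hw, hy⟩
  obtain ⟨t, ht⟩ := h
  refine ⟨intAdele t + intAdele (k : 𝓞 K) * w,
    add_mem (intAdele_mem t) (mul_mem (intAdele_mem _) hw), ?_⟩
  rw [hy, sub_eq_iff_eq_add'.1 ht]
  simp only [intAdele, Submonoid.coe_mul, map_add, map_mul]
  ring

theorem dvd_of_mem_integralCoset {m : (𝓞 K)⁰} {n n' : 𝓞 K} {y : integralAdeles K}
    (h : y ∈ integralCoset m n) (h' : y ∈ integralCoset m n') : (m : 𝓞 K) ∣ n - n' := by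
  obtain ⟨w, hw, h⟩ := h
  obtain ⟨w', hw', h'⟩ := h'
  refine dvd_of_intAdele_eq (sub_mem hw' hw) ?_
  rw [h] at h'
  simp only [intAdele, map_sub]
  linear_combination h'

theorem integralCoset_nonempty (m : (𝓞 K)⁰) (n : 𝓞 K) : (integralCoset m n).Nonempty :=
  ⟨⟨intAdele n, intAdele_mem n⟩, 0, zero_mem _, by simp⟩

/-- A compatible system of residue classes is defined by an element of `ô`. -/
theorem exists_mem_iInter_integralCoset (n : (𝓞 K)⁰ → 𝓞 K)
    (h : ∀ m k : (𝓞 K)⁰, (m : 𝓞 K) ∣ n (m * k) - n m) : ∃ y, ∀ m, y ∈ integralCoset m (n m) := by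
  have h1 := IsCompact.nonempty_iInter_of_directed_nonempty_isCompact_isClosed
    (fun m : (𝓞 K)⁰ => integralCoset m (n m))
    (fun k m => ⟨k * m, integralCoset_subset (h k m), by
      change integralCoset (k * m) (n (k * m)) ⊆ integralCoset m (n m)
      rw [mul_comm k m]
      exact integralCoset_subset (h m k)⟩)
    (fun m => integralCoset_nonempty m _) (fun m => (isClopen_integralCoset m _).1.isCompact)
    (fun m => (isClopen_integralCoset m _).1)
  obtain ⟨y, hy⟩ := h1
  exact ⟨y, Set.mem_iInter.1 hy⟩

/-- Cosets form a neighbourhood basis even when all moduli are multiples of a fixed `c`; this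
freedom is needed for functions of the form `g(c ·)`. -/
theorem exists_integralCoset_subset {y : integralAdeles K} {U : Set (integralAdeles K)}
    (hU : U ∈ nhds y) (c : (𝓞 K)⁰) :
    ∃ m n, y ∈ integralCoset (c * m) n ∧ integralCoset (c * m) n ⊆ U := by
  obtain ⟨V, hVU, hV, hyV⟩ := mem_nhds_iff.1 hU
  obtain ⟨W, hW, rfl⟩ := isOpen_induced_iff.1 hV
  have hcont : Continuous fun t : FinAdele K => (y : FinAdele K) + t :=
    continuous_const.add continuous_id
  obtain ⟨m, hm⟩ := exists_multiples_subset (hW.preimage hcont) (by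
    change (y : FinAdele K) + 0 ∈ W
    rw [add_zero]
    exact hyV)
  obtain ⟨n, hn⟩ := exists_mem_integralCoset (c * m) y
  refine ⟨m, n, hn, fun y' hy' => hVU ?_⟩
  obtain ⟨w, hw, h⟩ := hn
  obtain ⟨w', hw', h'⟩ := hy'
  have h2 : (y' : FinAdele K) - y ∈ multiples m := by
    rw [h, h']
    refine multiples_mul_subset m c ⟨w' - w, sub_mem hw' hw, ?_⟩
    rw [mul_comm m c]
    change _ * _ = _
    ring
  have h3 := hm h2
  change (y : FinAdele K) + (y' - y) ∈ W at h3
  rw [add_sub_cancel] at h3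
  exact h3

/-- A `{0, 1}`-valued function on the residue classes that behaves like the values at a point of
the indicator functions comes from a point. -/
theorem exists_point_of_indicator (q : (𝓞 K)⁰ → 𝓞 K → ℂ)
    (hidem : ∀ m n, q m n * q m n = q m n)
    (hcongr : ∀ {m : (𝓞 K)⁰} {n n' : 𝓞 K}, (m : 𝓞 K) ∣ n - n' → q m n = q m n')
    (horth : ∀ {m : (𝓞 K)⁰} {n n' : 𝓞 K}, ¬ (m : 𝓞 K) ∣ n - n' → q m n * q m n' = 0)
    (hone : ∀ m, ∃ n, q m n ≠ 0)
    (href : ∀ m k n, q m n ≠ 0 → ∃ j, q (m * k) (n + m * j) ≠ 0) :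
    ∃ y, ∀ m n, q m n = (integralCoset m n).indicator 1 y := by
  choose n hn using hone
  -- Exactly one class modulo each `m` is selected. The refinement hypothesis makes the selected
  -- classes compatible, so compactness provides a common point.
  have huniq : ∀ {m a b}, q m a ≠ 0 → q m b ≠ 0 → (m : 𝓞 K) ∣ a - b := by
    intro m a b ha hb
    by_contra h
    exact mul_ne_zero ha hb (horth h)
  obtain ⟨y, hy⟩ := exists_mem_iInter_integralCoset n (by
    intro m k
    obtain ⟨j, hj⟩ := href m k _ (hn m)
    have h1 := huniq (hn (m * k)) hj
    have h2 : (m : 𝓞 K) ∣ n (m * k) - (n m + m * j) :=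
      (Dvd.intro (k : 𝓞 K) rfl).trans h1
    have h3 : n (m * k) - n m = (n (m * k) - (n m + m * j)) + m * j := by ring
    rw [h3]
    exact dvd_add h2 (dvd_mul_right _ _))
  refine ⟨y, fun m a => ?_⟩
  by_cases h : q m a = 0
  · rw [h, Set.indicator_of_notMem]
    intro ha
    apply hn m
    rw [hcongr (dvd_of_mem_integralCoset (hy m) ha), h]
  · have h1 : q m a = 1 := mul_left_cancel₀ h (by rw [hidem, mul_one])
    rw [Set.indicator_of_mem, h1]
    · rfl
    · have h2 := integralCoset_subset (k := 1) (huniq (hn m) h)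
      rw [mul_one] at h2
      exact h2 (hy m)

open RingCStarAlgebra in
/-- The representation of `C(ô)` in `𝔄[o]` that maps the indicator function of `n + m ô` to
`u^n s_m s_m^* u^{-n}`. -/
theorem exists_functionRep : ∃ α : C(integralAdeles K, ℂ) →⋆ₐ[ℂ] RingCStarAlgebra (𝓞 K),
    ∀ (m : (𝓞 K)⁰) (n : 𝓞 K) (g : C(integralAdeles K, ℂ)),
      (∀ y, g y = (integralCoset m n).indicator 1 y) → α g = proj m n := by
  refine Exists.imp (fun α hα m n g hg => hα (m, n) g hg) (exists_starAlgHom_of_points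
    (fun i : (𝓞 K)⁰ × 𝓞 K => proj i.1 i.2) (fun i => star_proj _ _)
    (fun i j => commute_proj _ _ _ _) (fun i y => (integralCoset i.1 i.2).indicator 1 y) ?_ ?_)
  · intro D hD χ
    -- A character that does not vanish on a sum does not vanish on some summand: applied to the two
    -- sum relations, this gives existence and refinement of the selected classes.
    have hsum : ∀ (ι : Type u) [Fintype ι] (a : ι → D) (b : D),
        (b : RingCStarAlgebra (𝓞 K)) = ∑ i, (a i : RingCStarAlgebra (𝓞 K)) →
        χ b ≠ 0 → ∃ i, χ (a i) ≠ 0 := by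
      intro ι _ a b hab hb
      have hab' : b = ∑ i, a i := Subtype.ext (hab.trans (map_sum D.subtype a _).symm)
      rw [hab', map_sum] at hb
      obtain ⟨i, -, hi⟩ := Finset.exists_ne_zero_of_sum_ne_zero hb
      exact ⟨i, hi⟩
    refine Exists.imp (fun y hy i => hy i.1 i.2)
      (exists_point_of_indicator (fun m n => χ ⟨proj m n, hD (m, n)⟩) ?_ ?_ ?_ ?_ ?_)
    · intro m n
      rw [← map_mul]
      exact congrArg χ (Subtype.ext (proj_mul_self m n))
    · intro m n n' h
      exact congrArg χ (Subtype.ext (proj_congr h))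
    · intro m n n' h
      rw [← map_mul, ← map_zero χ]
      exact congrArg χ (Subtype.ext (proj_mul_proj_of_not_dvd h))
    · intro m
      have := Fintype.ofFinite (𝓞 K ⧸ Ideal.span {(m : 𝓞 K)})
      obtain ⟨c, hc⟩ := hsum (𝓞 K ⧸ Ideal.span {(m : 𝓞 K)})
        (fun c => ⟨proj m (Quotient.out c), hD (m, _)⟩) 1 (sum_proj m).symm (by simp)
      exact ⟨_, hc⟩
    · intro m k n h
      have := Fintype.ofFinite (𝓞 K ⧸ Ideal.span {(k : 𝓞 K)})
      obtain ⟨c, hc⟩ := hsum (𝓞 K ⧸ Ideal.span {(k : 𝓞 K)})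
        (fun c => ⟨proj (m * k) (n + m * Quotient.out c), hD (m * k, _)⟩) _ (proj_eq_sum m k n) h
      exact ⟨_, hc⟩
  · intro y U hU
    obtain ⟨m, n, h, hsub⟩ := exists_integralCoset_subset hU 1
    refine ⟨(1 * m, n), ?_, fun y' hy' => hsub (Set.mem_of_indicator_ne_zero hy')⟩
    rw [Set.indicator_of_mem h]
    exact one_ne_zero

/-- The indicator function of the coset `n + m ô`. -/
def cosetIndicator (m : (𝓞 K)⁰) (n : 𝓞 K) : C(integralAdeles K, ℂ) where
  toFun := (integralCoset m n).indicator 1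
  continuous_toFun := (continuous_const (y := (1 : ℂ))).indicator (by
    simp [(isClopen_integralCoset m n).frontier_eq])

/-- By Stone–Weierstrass, the indicators of cosets with moduli divisible by `c` generate a dense
*-subalgebra. -/
theorem starAlgHom_ext_cosetIndicator {B : Type*} [CStarAlgebra B]
    {f g : C(integralAdeles K, ℂ) →⋆ₐ[ℂ] B} (c : (𝓞 K)⁰)
    (h : ∀ m n, f (cosetIndicator (c * m) n) = g (cosetIndicator (c * m) n)) : f = g := by
  let S : StarSubalgebra ℂ C(integralAdeles K, ℂ) :=
    StarAlgebra.adjoin ℂ {t | ∃ m n, t = cosetIndicator (c * m) n}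
  have hsep : S.SeparatesPoints := by
    intro y y' hne
    have hU : {y'}ᶜ ∈ nhds y := isOpen_compl_singleton.mem_nhds hne
    obtain ⟨m, n, hy, hsub⟩ := exists_integralCoset_subset hU c
    refine ⟨_, ⟨cosetIndicator (c * m) n, StarAlgebra.subset_adjoin ℂ _ ⟨m, n, rfl⟩, rfl⟩, ?_⟩
    change (integralCoset (c * m) n).indicator 1 y ≠ (integralCoset (c * m) n).indicator 1 y'
    rw [Set.indicator_of_mem hy,
      Set.indicator_of_notMem fun hy' => hsub hy' rfl]
    exact one_ne_zero
  have htop := ContinuousMap.starSubalgebra_topologicalClosure_eq_top_of_separatesPoints S hsep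
  have hS : Set.EqOn f g S := by
    intro t ht
    induction ht using StarAlgebra.adjoin_induction with
    | mem t ht =>
      obtain ⟨m, n, rfl⟩ := ht
      exact h m n
    | algebraMap r => rw [AlgHomClass.commutes, AlgHomClass.commutes]
    | add a b _ _ ha hb => rw [map_add, map_add, ha, hb]
    | mul a b _ _ ha hb => rw [map_mul, map_mul, ha, hb]
    | star a _ ha => rw [map_star, map_star, ha]
  have hdense : Dense (S : Set C(integralAdeles K, ℂ)) := by
    intro t
    have : t ∈ S.topologicalClosure := htop ▸ StarSubalgebra.mem_top
    exact this
  have hcont : ∀ f : C(integralAdeles K, ℂ) →⋆ₐ[ℂ] B, Continuous f := fun f =>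
    AddMonoidHomClass.continuous_of_bound f 1 fun t =>
      (NonUnitalStarAlgHom.norm_apply_le f t).trans_eq (one_mul _).symm
  exact DFunLike.coe_injective (Continuous.ext_on hdense (hcont f) (hcont g) hS)

/-- Multiplication by a nonzero integer on `ô`. -/
def mulInt (c : (𝓞 K)⁰) : C(integralAdeles K, integralAdeles K) where
  toFun y := ⟨intAdele (c : 𝓞 K) * y, mul_mem (intAdele_mem _) y.2⟩
  continuous_toFun := Continuous.subtype_mk (continuous_const.mul continuous_subtype_val) _

theorem mulInt_mem_integralCoset (c m : (𝓞 K)⁰) (n : 𝓞 K) (y : integralAdeles K) :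
    mulInt c y ∈ integralCoset (c * m) (c * n) ↔ y ∈ integralCoset m n := by
  have key : ∀ w : FinAdele K, intAdele ((c : 𝓞 K) * n) + intAdele ((c * m : (𝓞 K)⁰) : 𝓞 K) * w =
      intAdele (c : 𝓞 K) * (intAdele n + intAdele (m : 𝓞 K) * w) := by
    intro w
    simp only [intAdele, Submonoid.coe_mul, map_mul]
    ring
  constructor
  · rintro ⟨w, hw, h⟩
    exact ⟨w, hw, intAdele_mul_injective c (h.trans (key w))⟩
  · rintro ⟨w, hw, h⟩
    exact ⟨w, hw, (congrArg (intAdele (c : 𝓞 K) * ·) h).trans (key w).symm⟩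

theorem dvd_of_mulInt_mem_integralCoset {c m : (𝓞 K)⁰} {n : 𝓞 K} {y : integralAdeles K}
    (h : mulInt c y ∈ integralCoset (c * m) n) : (c : 𝓞 K) ∣ n := by
  have h1 : mulInt c y ∈ integralCoset c n := integralCoset_subset (by simp) h
  have h2 : mulInt c y ∈ integralCoset c 0 := ⟨y, y.2, by
    rw [map_zero, zero_add]
    rfl⟩
  simpa using dvd_of_mem_integralCoset h1 h2

open RingCStarAlgebra in
/-- The relation `α(g) s_c = s_c α(g(c ·))` in `𝔄[o]`. -/
theorem functionRep_mul_s (α : C(integralAdeles K, ℂ) →⋆ₐ[ℂ] RingCStarAlgebra (𝓞 K))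
    (hα : ∀ m n, α (cosetIndicator m n) = proj m n) (c : (𝓞 K)⁰) (g : C(integralAdeles K, ℂ)) :
    α g * s c = s c * α (g.comp (mulInt c)) := by
  -- The range projection of `s c` is the image of an indicator function, hence commutes with the
  -- image of `α`; this makes compression by `s c` multiplicative.
  have hcomm : ∀ g, α g * (s c * star (s c)) = s c * star (s c) * α g := fun g => by
    rw [← proj_zero, ← hα, ← map_mul, ← map_mul, mul_comm]
  let f : C(integralAdeles K, ℂ) →⋆ₐ[ℂ] RingCStarAlgebra (𝓞 K) :=
    { toFun := fun g => star (s c) * α g * s c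
      map_one' := by rw [map_one, mul_one, star_s_mul_s]
      map_mul' := fun a b => by
        calc star (s c) * α (a * b) * s c
            = star (s c) * α a * α b * (s c * star (s c)) * s c := by
              rw [map_mul, mul_assoc _ (s c * star (s c)), mul_assoc (s c), star_s_mul_s, mul_one]
              simp only [mul_assoc]
          _ = star (s c) * α a * (α b * (s c * star (s c))) * s c := by simp only [mul_assoc]
          _ = _ := by rw [hcomm]; simp only [mul_assoc]
      map_zero' := by rw [map_zero, mul_zero, zero_mul]
      map_add' := fun a b => by rw [map_add, mul_add, add_mul]
      commutes' := fun r => by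
        rw [AlgHomClass.commutes, ← Algebra.commutes, mul_assoc, star_s_mul_s, mul_one]
      map_star' := fun a => by
        rw [map_star, star_mul, star_mul, star_star, mul_assoc] }
  have hf : f = α.comp (ContinuousMap.compStarAlgHom' ℂ ℂ (mulInt c)) := by
    refine starAlgHom_ext_cosetIndicator c fun m n => ?_
    change star (s c) * α _ * s c = α ((cosetIndicator (c * m) n).comp (mulInt c))
    rw [hα]
    -- A coset modulo `c m` either comes from a coset modulo `m` by multiplication with `c`, or
    -- misses `c ô`, and then both sides vanish.
    by_cases hn : (c : 𝓞 K) ∣ n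
    · obtain ⟨k, rfl⟩ := hn
      rw [star_s_mul_proj_mul_s, ← hα]
      congr 1
      ext y
      change (integralCoset m k).indicator 1 y =
        (integralCoset (c * m) (c * k)).indicator 1 (mulInt c y)
      by_cases hy : y ∈ integralCoset m k
      · rw [Set.indicator_of_mem hy,
          Set.indicator_of_mem ((mulInt_mem_integralCoset c m k y).2 hy)]
        rfl
      · rw [Set.indicator_of_notMem hy,
          Set.indicator_of_notMem (mt (mulInt_mem_integralCoset c m k y).1 hy)]
    · rw [star_s_mul_proj_mul_s_of_not_dvd hn, ← map_zero α]
      congr 1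
      ext y
      exact (Set.indicator_of_notMem (fun hy => hn (dvd_of_mulInt_mem_integralCoset hy)) _).symm
  have h1 : star (s c) * α g * s c = α (g.comp (mulInt c)) := DFunLike.congr_fun hf g
  rw [← h1, ← mul_assoc, ← mul_assoc, ← hcomm, mul_assoc, mul_assoc, star_s_mul_s, mul_one]

end Coset

/-! ### Injectivity on corners -/

section CornerInjective

variable {A G : Type u} [NonUnitalCStarAlgebra A] [CommGroup G] {α : G →* (A →⋆ₙₐ[ℂ] A)}

theorem exists_ofFinsupp_corner (e : A) (c : G →₀ A) : ∃ c' : G →₀ A,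
    CrossedProduct.mk α e 1 * CrossedProduct.ofFinsupp α c * CrossedProduct.mk α e 1 =
      CrossedProduct.ofFinsupp α c' ∧ c' 1 = e * c 1 * e := by
  classical
  induction c using Finsupp.induction_linear with
  | zero => exact ⟨0, by simp, by simp⟩
  | add c d hc hd =>
    obtain ⟨c', hc, hc1⟩ := hc
    obtain ⟨d', hd, hd1⟩ := hd
    refine ⟨c' + d', ?_, ?_⟩
    · rw [map_add, map_add, mul_add, add_mul, hc, hd]
    · rw [Finsupp.add_apply, Finsupp.add_apply, hc1, hd1, mul_add, add_mul]
  | single g a =>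
    refine ⟨Finsupp.single g (e * a * α g e), ?_, ?_⟩
    · rw [CrossedProduct.ofFinsupp_single, CrossedProduct.ofFinsupp_single, CrossedProduct.mk_mul,
        CrossedProduct.mk_mul, one_mul, mul_one, map_one]
      rfl
    · rw [Finsupp.single_apply, Finsupp.single_apply]
      split_ifs with h
      · rw [h, map_one]
        rfl
      · simp

/-- A homomorphism on a corner is injective if it controls the coefficient at the identity. -/
theorem injective_of_norm_coeff_le {B : Type*} [CStarAlgebra B] {e : A}
    (he : IsStarProjection (CrossedProduct.mk α e 1)) (L : CrossedProduct α →L[ℂ] B)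
    (Φ : corner (CrossedProduct.mk α e 1) he →⋆ₙₐ[ℂ] B) (hΦ : ∀ x, Φ x = L x)
    (hc : ∀ c : G →₀ A, ‖e * c 1‖ ≤ ‖L (CrossedProduct.ofFinsupp α c)‖) :
    Function.Injective Φ := by
  rw [injective_iff_map_eq_zero]
  intro x hx
  have hL : L (star (x : CrossedProduct α) * x) = 0 := by
    rw [← show Φ (star x * x) = L (star (x : CrossedProduct α) * x) from hΦ (star x * x), map_mul,
      hx, mul_zero]
  set b : CrossedProduct α := star (x : CrossedProduct α) * x with hb
  set E := CrossedProduct.mk α e 1 with hE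
  have hEE : E * E = E := he.isIdempotentElem
  have hbE : E * b * E = b := by
    obtain ⟨d, hd⟩ := (star x * x).2
    have hd' : b = E * d * E := hd
    rw [hd']
    calc E * (E * d * E) * E = (E * E) * d * (E * E) := by simp only [mul_assoc]
      _ = _ := by rw [hEE]
  refine Subtype.ext (CrossedProduct.eq_zero_of_coeff_one_small (x : CrossedProduct α) ?_)
  intro ε hε
  -- The final estimates lose the factors `‖E‖ * ‖E‖` and `‖L‖ * ‖e‖`. The second bounds the
  -- coefficient at the identity: since `L b = 0`, the value of `L` on the approximation is small.
  let M : ℝ := 1 + ‖L‖ * ‖e‖ + ‖E‖ * ‖E‖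
  have hM : 0 < M := by positivity
  obtain ⟨c, hcb⟩ := Metric.denseRange_iff.1 CrossedProduct.denseRange_ofFinsupp b (ε / M)
    (div_pos hε hM)
  rw [dist_eq_norm] at hcb
  obtain ⟨c', hc', hc1⟩ := exists_ofFinsupp_corner (α := α) e c
  refine ⟨c', ?_, ?_⟩
  · calc ‖b - CrossedProduct.ofFinsupp α c'‖
        = ‖E * (b - CrossedProduct.ofFinsupp α c) * E‖ := by
          rw [mul_sub, sub_mul, hbE, hc']
      _ ≤ ‖E‖ * ‖b - CrossedProduct.ofFinsupp α c‖ * ‖E‖ :=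
          (norm_mul_le _ _).trans (mul_le_mul_of_nonneg_right (norm_mul_le _ _) (norm_nonneg _))
      _ = (‖E‖ * ‖E‖) * ‖b - CrossedProduct.ofFinsupp α c‖ := by ring
      _ ≤ M * (ε / M) := by
          refine mul_le_mul ?_ hcb.le (norm_nonneg _) hM.le
          have : 0 ≤ ‖L‖ * ‖e‖ := by positivity
          linarith
      _ = ε := mul_div_cancel₀ _ hM.ne'
  · calc ‖c' 1‖ = ‖e * c 1 * e‖ := by rw [hc1]
      _ ≤ ‖e * c 1‖ * ‖e‖ := norm_mul_le _ _
      _ ≤ ‖L (CrossedProduct.ofFinsupp α c)‖ * ‖e‖ :=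
          mul_le_mul_of_nonneg_right (hc c) (norm_nonneg _)
      _ = ‖L (b - CrossedProduct.ofFinsupp α c)‖ * ‖e‖ := by
          rw [map_sub, hL, zero_sub, norm_neg]
      _ ≤ ‖L‖ * ‖b - CrossedProduct.ofFinsupp α c‖ * ‖e‖ :=
          mul_le_mul_of_nonneg_right (L.le_opNorm _) (norm_nonneg _)
      _ = (‖L‖ * ‖e‖) * ‖b - CrossedProduct.ofFinsupp α c‖ := by ring
      _ ≤ M * (ε / M) := by
          refine mul_le_mul ?_ hcb.le (norm_nonneg _) hM.le
          have : 0 ≤ ‖E‖ * ‖E‖ := by positivity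
          linarith
      _ = ε := mul_div_cancel₀ _ hM.ne'

end CornerInjective

/-! ### The covariant pair -/

section Pair

variable {K : Type u} [Field K] [NumberField K]

theorem intUnit_injective {F : Type u} [Field F] : Function.Injective (intUnit (K := F)) := by
  intro a b h
  have h1 := congrArg Units.val h
  exact Subtype.ext (RingOfIntegers.ext h1)

open RingCStarAlgebra in
theorem RingCStarAlgebra.star_s_mul_s_eq {R : Type u} [CommRing R] {a b a' b' : R⁰}
    (h : a * b' = a' * b) : star (s b) * s a = star (s b') * s a' :=
  calc star (s b) * s a = star (s b) * (star (s b') * s b') * s a := by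
        rw [star_s_mul_s, mul_one]
    _ = star (s (b' * b)) * s (b' * a) := by
        rw [← s_mul_s b' b, ← s_mul_s b' a, star_mul]
        simp only [mul_assoc]
    _ = star (s (b * b')) * s (b * a') := by rw [mul_comm b' a, h, mul_comm a' b, mul_comm b' b]
    _ = star (s b') * (star (s b) * s b) * s a' := by
        rw [← s_mul_s b b', ← s_mul_s b a', star_mul]
        simp only [mul_assoc]
    _ = _ := by rw [star_s_mul_s, mul_one]

/-- The classes whose representatives under the section `σ` are algebraic integers. -/
def integralClasses (σ : IdealGroup K →* Kˣ) : Submonoid (IdealGroup K) where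
  carrier := {z | ∃ m : (𝓞 K)⁰, intUnit m = σ z}
  one_mem' := ⟨1, Units.ext (by simp)⟩
  mul_mem' := by
    rintro z w ⟨m, hm⟩ ⟨k, hk⟩
    exact ⟨m * k, by rw [intUnit_mul, hm, hk, map_mul]⟩

/-- The isometry `s_{σ z}`, if `σ z` is an algebraic integer. -/
def classIsometry (σ : IdealGroup K →* Kˣ) (z : IdealGroup K) : RingCStarAlgebra (𝓞 K) := by
  classical
  exact if h : ∃ m : (𝓞 K)⁰, intUnit m = σ z then RingCStarAlgebra.s h.choose else 0

theorem classIsometry_eq {σ : IdealGroup K →* Kˣ} {z : IdealGroup K} {m : (𝓞 K)⁰}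
    (h : intUnit m = σ z) : classIsometry σ z = RingCStarAlgebra.s m := by
  have h' : ∃ m : (𝓞 K)⁰, intUnit m = σ z := ⟨m, h⟩
  rw [classIsometry, dif_pos h']
  exact congrArg _ (intUnit_injective (h'.choose_spec.trans h.symm))

/-- The restriction of functions on `X` to `ô`. -/
def restrictHom : C₀(SpaceX K, ℂ) →⋆ₙₐ[ℂ] C(integralAdeles K, ℂ) where
  toFun := restrictToIntegral
  map_smul' _ _ := rfl
  map_zero' := rfl
  map_add' _ _ := rfl
  map_mul' _ _ := rfl
  map_star' _ := rfl

theorem restrictHom_apply (f : C₀(SpaceX K, ℂ)) (y : integralAdeles K) :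
    restrictHom f y = f (toX (y : FinAdele K)) := rfl

/-- The representation of `C₀(X)` that a representation of `C(ô)` defines by restriction. -/
def restrictRep {B : Type*} [CStarAlgebra B] (α : C(integralAdeles K, ℂ) →⋆ₐ[ℂ] B) :
    C₀(SpaceX K, ℂ) →⋆ₙₐ[ℂ] B where
  toFun f := α (restrictHom f)
  map_smul' c f := by rw [map_smul, map_smul]; rfl
  map_zero' := by rw [map_zero, map_zero]
  map_add' f g := by rw [map_add, map_add]
  map_mul' f g := by rw [map_mul, map_mul]
  map_star' f := by rw [map_star, map_star]

/-- The representative of the class of a nonzero integer differs from it by a unit idele, so it is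
integral at every finite place and is itself an integer. Writing `σ z = a / b` then presents `z` as
a quotient of two integral classes. -/
theorem exists_fraction_of_section {σ : IdealGroup K →* Kˣ}
    (hσ : ∀ z, (diagFin K (σ z) : IdealGroup K) = z) (z : IdealGroup K) :
    ∃ p ∈ integralClasses σ, ∃ q ∈ integralClasses σ, z = p * q⁻¹ := by
  have key : ∀ a : (𝓞 K)⁰, (diagFin K (intUnit a) : IdealGroup K) ∈ integralClasses σ := by
    intro a
    have h := hσ (diagFin K (intUnit a) : IdealGroup K)
    rw [eq_comm, QuotientGroup.eq] at h
    set x := σ (diagFin K (intUnit a) : IdealGroup K) with hx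
    have h1 : algebraMap K (FinAdele K) (x : K) ∈ integralAdeles K := by
      have h2 : ((diagFin K (intUnit a) * ((diagFin K (intUnit a))⁻¹ * diagFin K x) :
          (FinAdele K)ˣ) : FinAdele K) ∈ integralAdeles K := by
        rw [Units.val_mul, coe_diagFin_intUnit]
        exact mul_mem (intAdele_mem _) h.1
      rw [mul_inv_cancel_left] at h2
      exact h2
    obtain ⟨n, hn⟩ := exists_int_of_mem_integralAdeles h1
    have hn0 : n ≠ 0 := by
      rintro rfl
      exact x.ne_zero (hn.symm.trans (map_zero (algebraMap (𝓞 K) K)))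
    exact ⟨⟨n, mem_nonZeroDivisors_of_ne_zero hn0⟩, Units.ext hn⟩
  obtain ⟨a, b, hb, hab⟩ := IsFractionRing.div_surjective (A := 𝓞 K) (σ z : K)
  have hb0 : algebraMap (𝓞 K) K b ≠ 0 := by
    simpa using nonZeroDivisors.ne_zero hb
  have ha : a ∈ (𝓞 K)⁰ := by
    refine mem_nonZeroDivisors_of_ne_zero ?_
    rintro rfl
    apply (σ z).ne_zero
    rw [← hab, map_zero, zero_div]
  have hab' : σ z * intUnit ⟨b, hb⟩ = intUnit ⟨a, ha⟩ := by
    apply Units.ext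
    change (σ z : K) * algebraMap (𝓞 K) K b = algebraMap (𝓞 K) K a
    rw [← hab, div_mul_cancel₀ _ hb0]
  refine ⟨_, key ⟨a, ha⟩, _, key ⟨b, hb⟩, ?_⟩
  rw [← hab', map_mul, QuotientGroup.mk_mul, hσ, mul_inv_cancel_right]

/-- Since `σ z` lies in `U`, the class `z` moves `[(1, y)]` to `[(1, σ z · y)]`. Covariance is thus
the relation between `α` and `s m`, and the range projection `s m * star (s m)` is the image of the
indicator of `m ô`, the restriction to `ô` of the translate of `1_Y`. -/
theorem isCovariantPair_functionRep (hY : IsClopen (subsetY K) ∧ IsCompact (subsetY K))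
    {σ : IdealGroup K →* Kˣ} (hσ : ∀ z, (diagFin K (σ z) : IdealGroup K) = z)
    (hσU : ∀ z, finIdele K (diagFin K (σ z)) ∈ ideleU K)
    {α : C(integralAdeles K, ℂ) →⋆ₐ[ℂ] RingCStarAlgebra (𝓞 K)}
    (hα : ∀ m n, α (cosetIndicator m n) = RingCStarAlgebra.proj m n) :
    IsCovariantPair (translation (idealActX K)) (integralClasses σ) (indicatorC₀ (subsetY K))
      (restrictRep α) (classIsometry σ) := by
  have hact : ∀ z y, idealActX K z (toX y) = toX ((diagFin K (σ z) : FinAdele K) * y) := by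
    intro z y
    have h := idealActX_diagFin_toX (diagFin K (σ z)) (hσU z) y
    rwa [hσ] at h
  refine ⟨exists_fraction_of_section hσ, ?_, ?_, ?_, ?_, ?_, fun a => mul_comm _ _,
    indicatorC₀_mul_self _⟩
  · rintro p ⟨m, hm⟩
    rw [classIsometry_eq hm, RingCStarAlgebra.star_s_mul_s]
  · rintro p ⟨m, hm⟩ q ⟨k, hk⟩
    rw [classIsometry_eq hm, classIsometry_eq hk, RingCStarAlgebra.s_mul_s]
    exact classIsometry_eq (by rw [intUnit_mul, hm, hk, map_mul])
  · rintro p ⟨m, hm⟩ a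
    rw [classIsometry_eq hm]
    change α (restrictHom (translation (idealActX K) p a)) * _ = _ * α (restrictHom a)
    rw [functionRep_mul_s α hα]
    congr 2
    ext y
    change a (idealActX K p⁻¹ (toX (intAdele (m : 𝓞 K) * (y : FinAdele K)))) = a (toX y)
    rw [← coe_diagFin_intUnit, hm, ← hact]
    congr 1
    rw [map_inv]
    exact (idealActX K p).symm_apply_apply _
  · rintro p ⟨m, hm⟩
    rw [classIsometry_eq hm, ← RingCStarAlgebra.proj_zero, ← hα]
    change α _ = α (restrictHom (translation (idealActX K) p (indicatorC₀ (subsetY K))))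
    congr 1
    ext y
    change (integralCoset m 0).indicator 1 y =
      indicatorC₀ (subsetY K) (idealActX K p⁻¹ (toX (y : FinAdele K)))
    rw [hact, map_inv, map_inv, ← hm, indicatorC₀_apply hY]
    have hiff : toX ((((diagFin K (intUnit m))⁻¹ : (FinAdele K)ˣ) : FinAdele K) *
        (y : FinAdele K)) ∈ subsetY K ↔ y ∈ integralCoset m 0 := by
      rw [toX_mem_subsetY]
      constructor
      · intro h
        refine ⟨_, h, ?_⟩
        rw [map_zero, zero_add]
        exact (Units.mul_inv_cancel_left (diagFin K (intUnit m)) (y : FinAdele K)).symm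
      · rintro ⟨w, hw, h⟩
        rw [map_zero, zero_add] at h
        rw [h]
        convert hw
        exact Units.inv_mul_cancel_left (diagFin K (intUnit m)) w
    by_cases hy : y ∈ integralCoset m 0
    · rw [Set.indicator_of_mem hy, Set.indicator_of_mem (hiff.2 hy)]
      rfl
    · rw [Set.indicator_of_notMem hy, Set.indicator_of_notMem (mt hiff.1 hy)]
  · intro a
    change α (restrictHom (indicatorC₀ (subsetY K) * a)) = α (restrictHom a)
    congr 1
    ext y
    change indicatorC₀ (subsetY K) (toX (y : FinAdele K)) * a (toX y) = a (toX y)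
    rw [indicatorC₀_apply hY, Set.indicator_of_mem ((toX_mem_subsetY _).2 y.2)]
    exact one_mul _

/-- A covariant pair in `𝔄[R]` satisfies the norm estimate of the full crossed product. -/
theorem IsCovariantPair.norm_sum_le_ring {A G R : Type u} [NonUnitalCStarAlgebra A] [CommGroup G]
    [CommRing R] {α : G →* (A →⋆ₙₐ[ℂ] A)} {P : Submonoid G} {e : A}
    {β : A →⋆ₙₐ[ℂ] RingCStarAlgebra R} {S : G → RingCStarAlgebra R}
    (h : IsCovariantPair α P e β S) (c : G →₀ A) :
    ‖∑ g ∈ c.support, β (c g) * fracIsometry P h.exists_fraction S g‖ ≤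
      ‖CrossedProduct.ofFinsupp α c‖ := by
  refine RingCStarAlgebra.norm_le_of_forall_eval (norm_nonneg _) fun ρ => ?_
  refine le_trans (le_of_eq ?_) ((h.comp (RingCStarAlgebra.eval ρ)).norm_sum_le c)
  rw [map_sum]
  congr 1

end Pair

/-! ### The regular representation on `ℓ²(ô)` -/

section PushOp

variable {Ω Ω' : Type*}

theorem pullOp_single_of_eq [DecidableEq Ω] [DecidableEq Ω'] (j : Ω → Ω')
    (hj : Function.Injective j) (ω : Ω) :
    pullOp ℂ j hj (lp.single 2 (j ω) (1 : ℂ)) = lp.single 2 ω (1 : ℂ) := by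
  refine lp.ext (funext fun η => ?_)
  rw [pullOp_apply, lp.single_apply, lp.single_apply, Pi.single_apply, Pi.single_apply]
  simp only [hj.eq_iff]

theorem pullOp_single_of_notMem [DecidableEq Ω'] (j : Ω → Ω')
    (hj : Function.Injective j) {ω' : Ω'} (h : ω' ∉ Set.range j) :
    pullOp ℂ j hj (lp.single 2 ω' (1 : ℂ)) = 0 := by
  refine lp.ext (funext fun η => ?_)
  rw [pullOp_apply, lp.single_apply, Pi.single_apply, if_neg fun h' => h ⟨η, h'⟩]
  rfl

theorem inner_single_one [DecidableEq Ω] (ω : Ω) (ζ : lp (fun _ : Ω => ℂ) 2) :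
    inner ℂ (lp.single 2 ω (1 : ℂ)) ζ = ζ ω := by
  rw [lp.inner_single_left]
  simp

theorem star_pullOp_apply (j : Ω → Ω') (hj : Function.Injective j) (ζ : lp (fun _ : Ω => ℂ) 2)
    (ω : Ω) : ContinuousLinearMap.adjoint (pullOp ℂ j hj) ζ (j ω) = ζ ω := by
  classical
  rw [← inner_single_one (j ω), ContinuousLinearMap.adjoint_inner_right, pullOp_single_of_eq,
    inner_single_one]

theorem star_pullOp_apply_of_notMem (j : Ω → Ω') (hj : Function.Injective j)
    (ζ : lp (fun _ : Ω => ℂ) 2) {ω' : Ω'} (h : ω' ∉ Set.range j) :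
    ContinuousLinearMap.adjoint (pullOp ℂ j hj) ζ ω' = 0 := by
  classical
  rw [← inner_single_one ω', ContinuousLinearMap.adjoint_inner_right,
    pullOp_single_of_notMem j hj h, inner_zero_left]

end PushOp

section RegularRep

variable {K : Type u} [Field K] [NumberField K]

/-- The Hilbert space `ℓ²(ô)`. -/
abbrev RegularSpace (K : Type u) [Field K] [NumberField K] : Type u :=
  lp (fun _ : integralAdeles K => ℂ) 2

/-- A global integer as an element of `ô`. -/
def intPoint (n : 𝓞 K) : integralAdeles K := ⟨intAdele n, intAdele_mem n⟩

theorem intPoint_add (n k : 𝓞 K) : intPoint (n + k) = intPoint n + intPoint k :=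
  Subtype.ext (map_add _ _ _)

theorem intPoint_neg (n : 𝓞 K) : intPoint (-n) = -intPoint n :=
  Subtype.ext (map_neg _ _)

theorem mulInt_injective (m : (𝓞 K)⁰) : Function.Injective (mulInt m) := fun _ _ h =>
  Subtype.ext (intAdele_mul_injective m (congrArg Subtype.val h))

theorem mulInt_mulInt (k m : (𝓞 K)⁰) (y : integralAdeles K) :
    mulInt k (mulInt m y) = mulInt (k * m) y := by
  refine Subtype.ext ?_
  change intAdele (k : 𝓞 K) * (intAdele (m : 𝓞 K) * (y : FinAdele K)) =
    intAdele ((k : 𝓞 K) * (m : 𝓞 K)) * y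
  rw [intAdele, intAdele, intAdele, map_mul, mul_assoc]

theorem mulInt_add_intPoint (m : (𝓞 K)⁰) (y : integralAdeles K) (n : 𝓞 K) :
    mulInt m (y + intPoint n) = mulInt m y + intPoint ((m : 𝓞 K) * n) := by
  refine Subtype.ext ?_
  change intAdele (m : 𝓞 K) * ((y : FinAdele K) + intAdele n) =
    intAdele (m : 𝓞 K) * y + intAdele ((m : 𝓞 K) * n)
  rw [intAdele, intAdele, intAdele, map_mul, mul_add]

theorem mem_integralCoset_iff_range {m : (𝓞 K)⁰} {n : 𝓞 K} {y : integralAdeles K} :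
    y ∈ integralCoset m n ↔ y - intPoint n ∈ Set.range (mulInt m) := by
  rw [mem_integralCoset]
  constructor
  · rintro ⟨w, hw, h⟩
    exact ⟨⟨w, hw⟩, Subtype.ext h⟩
  · rintro ⟨w, h⟩
    exact ⟨w, w.2, congrArg Subtype.val h⟩

/-- The isometry `ξ_y ↦ ξ_{m y}` on `ℓ²(ô)`. -/
def regS (m : (𝓞 K)⁰) : RegularSpace K →L[ℂ] RegularSpace K :=
  ContinuousLinearMap.adjoint (pullOp ℂ (mulInt m) (mulInt_injective m))

/-- The unitary operator `ξ_y ↦ ξ_{y + n}` on `ℓ²(ô)`. -/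
def regU (n : 𝓞 K) : unitary (RegularSpace K →L[ℂ] RegularSpace K) :=
  Unitary.linearIsometryEquiv.symm (permIsometry ℂ (Equiv.addRight (intPoint n)))

theorem regU_apply (n : 𝓞 K) (ζ : RegularSpace K) (y : integralAdeles K) :
    (regU n : RegularSpace K →L[ℂ] RegularSpace K) ζ y = ζ (y - intPoint n) := by
  rw [sub_eq_add_neg]
  rfl

theorem regS_apply (m : (𝓞 K)⁰) (ζ : RegularSpace K) (y : integralAdeles K) :
    regS m ζ (mulInt m y) = ζ y :=
  star_pullOp_apply _ _ ζ y

theorem regS_apply_of_notMem {m : (𝓞 K)⁰} (ζ : RegularSpace K) {y : integralAdeles K}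
    (hy : y ∉ Set.range (mulInt m)) : regS m ζ y = 0 :=
  star_pullOp_apply_of_notMem _ _ ζ hy

theorem star_regS (m : (𝓞 K)⁰) :
    star (regS m) = pullOp ℂ (mulInt m) (mulInt_injective m) := by
  rw [ContinuousLinearMap.star_eq_adjoint, regS, ContinuousLinearMap.adjoint_adjoint]

theorem star_regS_apply (m : (𝓞 K)⁰) (ζ : RegularSpace K) (y : integralAdeles K) :
    star (regS m) ζ y = ζ (mulInt m y) := by
  rw [star_regS, pullOp_apply]

theorem regular_ext {S T : RegularSpace K →L[ℂ] RegularSpace K} (h : ∀ ζ y, S ζ y = T ζ y) :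
    S = T :=
  ContinuousLinearMap.ext fun ζ => lp.ext (funext (h ζ))

theorem regular_mul_apply (S T : RegularSpace K →L[ℂ] RegularSpace K) (ζ : RegularSpace K) :
    (S * T) ζ = S (T ζ) := rfl

/-- On `ℓ²(ô)` the coset projections are multiplications by coset indicators. This yields the sum
relation, as the cosets partition `ô`, and identifies `α` with multiplication operators. -/
theorem regular_proj_apply (m : (𝓞 K)⁰) (n : 𝓞 K) (ζ : RegularSpace K) (y : integralAdeles K) :
    ((regU n : RegularSpace K →L[ℂ] RegularSpace K) * (regS m * star (regS m)) *
      (regU (-n) : RegularSpace K →L[ℂ] RegularSpace K)) ζ y =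
      (integralCoset m n).indicator 1 y * ζ y := by
  rw [regular_mul_apply, regular_mul_apply, regular_mul_apply, regU_apply]
  by_cases h : y ∈ integralCoset m n
  · obtain ⟨w, hw⟩ := mem_integralCoset_iff_range.1 h
    rw [← hw, regS_apply, star_regS_apply, regU_apply, hw, Set.indicator_of_mem h, intPoint_neg,
      sub_neg_eq_add, sub_add_cancel, Pi.one_apply, one_mul]
  · rw [regS_apply_of_notMem _ (mt mem_integralCoset_iff_range.2 h), Set.indicator_of_notMem h,
      zero_mul]

/-- The representation of `𝔄[o]` on `ℓ²(ô)`. -/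
def regularRep (K : Type u) [Field K] [NumberField K] : RingRep (𝓞 K) where
  H := RegularSpace K
  nontrivial := by
    classical
    refine ⟨lp.single 2 0 (1 : ℂ), 0, fun h => ?_⟩
    have h1 := congrArg (fun ζ : RegularSpace K => ζ 0) h
    simp at h1
  s := regS
  u n := regU n
  isometry_s m := regular_ext fun ζ y => by
    rw [regular_mul_apply, star_regS_apply, regS_apply]
    rfl
  unitary_u n := (regU n).2
  s_mul k m := by
    -- The adjoints are plain compositions with multiplication maps, given by a formula at every
    -- point.
    rw [← star_inj, star_mul]
    refine regular_ext fun ζ y => ?_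
    rw [regular_mul_apply, star_regS_apply, star_regS_apply, star_regS_apply, mulInt_mulInt]
  u_mul l n := regular_ext fun ζ y => by
    rw [regular_mul_apply, regU_apply, regU_apply, regU_apply, intPoint_add, sub_sub]
  s_mul_u m n := regular_ext fun ζ y => by
    rw [regular_mul_apply, regular_mul_apply, regU_apply]
    by_cases h : y ∈ Set.range (mulInt m)
    · obtain ⟨w, rfl⟩ := h
      have h1 : mulInt m w - intPoint ((m : 𝓞 K) * n) = mulInt m (w - intPoint n) := by
        rw [sub_eq_iff_eq_add, ← mulInt_add_intPoint, sub_add_cancel]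
      rw [regS_apply, regU_apply, h1, regS_apply]
    · rw [regS_apply_of_notMem _ h, regS_apply_of_notMem]
      rintro ⟨w, hw⟩
      refine h ⟨w + intPoint n, ?_⟩
      rw [mulInt_add_intPoint, hw, sub_add_cancel]
  sum_eq_one m := by
    have := Fintype.ofFinite (𝓞 K ⧸ Ideal.span {(m : 𝓞 K)})
    rw [finsum_eq_sum_of_fintype]
    refine regular_ext fun ζ y => ?_
    rw [sum_apply, lp.coeFn_sum, Finset.sum_apply]
    simp only [regular_proj_apply]
    obtain ⟨n, hn⟩ := exists_mem_integralCoset m y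
    have hn' : y ∈ integralCoset m
        (Quotient.out (Ideal.Quotient.mk (Ideal.span {(m : 𝓞 K)}) n)) := by
      have h := integralCoset_subset (k := 1) (RingCStarAlgebra.dvd_sub_out m n)
      rw [mul_one] at h
      exact h hn
    rw [Finset.sum_eq_single (Ideal.Quotient.mk (Ideal.span {(m : 𝓞 K)}) n)]
    · rw [Set.indicator_of_mem hn', Pi.one_apply, one_mul]
      rfl
    · intro c _ hc
      rw [Set.indicator_of_notMem, zero_mul]
      intro hy
      apply hc
      have h := dvd_of_mem_integralCoset hy hn
      rw [← Ideal.mem_span_singleton, ← Ideal.Quotient.eq] at h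
      rw [← h]
      exact (Quotient.out_eq c).symm
    · exact fun h => absurd (Finset.mem_univ _) h

/-- The representation of `C(ô)` on `ℓ²(ô)` by multiplication operators. -/
def multiplicationRep (K : Type u) [Field K] [NumberField K] :
    C(integralAdeles K, ℂ) →⋆ₐ[ℂ] (RegularSpace K →L[ℂ] RegularSpace K) :=
  let β : integralAdeles K → C(integralAdeles K, ℂ) →⋆ₙₐ[ℂ] (ℂ →L[ℂ] ℂ) := fun y =>
    { toFun := fun g => g y • (1 : ℂ →L[ℂ] ℂ)
      map_smul' := fun c g => by
        rw [ContinuousMap.smul_apply, smul_assoc]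
        rfl
      map_zero' := ContinuousLinearMap.ext fun t => zero_mul t
      map_add' := fun f g => ContinuousLinearMap.ext fun t => add_mul (f y) (g y) t
      map_mul' := fun f g => by
        rw [ContinuousMap.mul_apply, smul_mul_smul_comm, mul_one]
      map_star' := fun g => by
        rw [ContinuousMap.star_apply, star_smul, star_one] }
  { toFun := diagRep β
    map_one' := regular_ext fun ζ y => by
      rw [diagRep_apply]
      exact one_mul (ζ y)
    map_mul' := map_mul (diagRep β)
    map_zero' := map_zero (diagRep β)
    map_add' := map_add (diagRep β)
    commutes' := fun c => regular_ext fun ζ y => by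
      rw [diagRep_apply]
      rfl
    map_star' := map_star (diagRep β) }

theorem multiplicationRep_apply (g : C(integralAdeles K, ℂ)) (ζ : RegularSpace K)
    (y : integralAdeles K) : multiplicationRep K g ζ y = g y * ζ y := rfl

end RegularRep

/-! ### The embedding into the ring C*-algebra -/

section Embedding

variable {K : Type u} [Field K] [NumberField K]

/-- A nonzero integer is invertible in `𝔸_f`, so `(k - m) y = 0` with `y ≠ 0` forces `k = m`. This
is the freeness behind the vanishing of off-identity diagonal coefficients. -/
theorem eq_of_mulInt_eq {k m : (𝓞 K)⁰} {y : integralAdeles K} (hy : y ≠ 0)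
    (h : mulInt k y = mulInt m y) : k = m := by
  by_contra hne
  have hsub : (k : 𝓞 K) - (m : 𝓞 K) ∈ (𝓞 K)⁰ :=
    mem_nonZeroDivisors_of_ne_zero (sub_ne_zero.2 fun h => hne (Subtype.ext h))
  apply hy
  refine Subtype.ext (intAdele_mul_injective ⟨_, hsub⟩ ?_)
  have h1 : intAdele (k : 𝓞 K) * (y : FinAdele K) = intAdele (m : 𝓞 K) * y :=
    congrArg Subtype.val h
  change intAdele ((k : 𝓞 K) - (m : 𝓞 K)) * (y : FinAdele K) = intAdele ((k : 𝓞 K) - (m : 𝓞 K)) * 0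
  rw [mul_zero, intAdele, map_sub, sub_mul, h1, sub_self]

/-- The representation of `𝔄[o]` by operators on `ℓ²(ô)`. -/
def regularEval (K : Type u) [Field K] [NumberField K] :
    RingCStarAlgebra (𝓞 K) →⋆ₐ[ℂ] (RegularSpace K →L[ℂ] RegularSpace K) :=
  RingCStarAlgebra.eval (regularRep K)

theorem regularEval_s (m : (𝓞 K)⁰) : regularEval K (RingCStarAlgebra.s m) = regS m := rfl

theorem regularEval_functionRep
    {α : C(integralAdeles K, ℂ) →⋆ₐ[ℂ] RingCStarAlgebra (𝓞 K)}
    (hα : ∀ m n, α (cosetIndicator m n) = RingCStarAlgebra.proj m n)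
    (g : C(integralAdeles K, ℂ)) : regularEval K (α g) = multiplicationRep K g := by
  have h : (regularEval K).comp α = multiplicationRep K := by
    refine starAlgHom_ext_cosetIndicator 1 fun m n => ?_
    change regularEval K (α _) = _
    rw [hα]
    exact regular_ext fun ζ y => regular_proj_apply _ _ ζ y
  exact DFunLike.congr_fun h g

/-- If all finite adeles were equal, every nonzero integer would divide `1` in `ô`, hence in `o`,
and `o` would be a field. -/
instance : Nontrivial (FinAdele K) := by
  by_contra h
  have := not_nontrivial_iff_subsingleton.1 h
  refine RingOfIntegers.not_isField K ⟨⟨0, 1, zero_ne_one⟩, mul_comm, fun {a} ha => ?_⟩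
  obtain ⟨b, hb⟩ := dvd_of_intAdele_eq (n := 1) (m := ⟨a, mem_nonZeroDivisors_of_ne_zero ha⟩)
    (w := 0) (zero_mem _) (Subsingleton.elim _ _)
  exact ⟨b, hb.symm⟩

open Classical in
/-- The diagonal coefficient at `y` of an element of `𝔄[o]` in the representation on `ℓ²(ô)`. -/
def diagCoeff (y : integralAdeles K) (x : RingCStarAlgebra (𝓞 K)) : ℂ :=
  regularEval K x (lp.single 2 y (1 : ℂ)) y

theorem diagCoeff_add (y : integralAdeles K) (x x' : RingCStarAlgebra (𝓞 K)) :
    diagCoeff y (x + x') = diagCoeff y x + diagCoeff y x' := by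
  rw [diagCoeff, map_add]
  rfl

theorem diagCoeff_zero (y : integralAdeles K) : diagCoeff y 0 = 0 := by
  rw [diagCoeff, map_zero]
  rfl

theorem norm_diagCoeff_le (y : integralAdeles K) (x : RingCStarAlgebra (𝓞 K)) :
    ‖diagCoeff y x‖ ≤ ‖x‖ := by
  classical
  let T := regularEval K x
  have hT : ‖T‖ ≤ ‖x‖ := NonUnitalStarAlgHom.norm_apply_le (regularEval K) x
  calc ‖diagCoeff y x‖ = ‖T (lp.single 2 y (1 : ℂ)) y‖ := by rw [diagCoeff]
    _ ≤ ‖T (lp.single 2 y (1 : ℂ))‖ :=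
        lp.norm_apply_le_norm (by norm_num) (T (lp.single 2 y (1 : ℂ))) y
    _ ≤ ‖T‖ * ‖(lp.single 2 y (1 : ℂ) : RegularSpace K)‖ := T.le_opNorm _
    _ = ‖T‖ := by rw [lp.norm_single (by norm_num), norm_one, mul_one]
    _ ≤ ‖x‖ := hT

/-- With `g = p q⁻¹`, `σ p = m` and `σ q = k`, the partial isometry is `star (s k) * s m`. It fixes
the basis vector at `y ≠ 0` only if `m y = k y`, that is `m = k` and `g = 1`; otherwise its diagonal
coefficient is zero. -/
theorem diagCoeff_pair {σ : IdealGroup K →* Kˣ}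
    (hσ : ∀ z, (diagFin K (σ z) : IdealGroup K) = z)
    {α : C(integralAdeles K, ℂ) →⋆ₐ[ℂ] RingCStarAlgebra (𝓞 K)}
    (hα : ∀ m n, α (cosetIndicator m n) = RingCStarAlgebra.proj m n) {e : C₀(SpaceX K, ℂ)}
    (h : IsCovariantPair (translation (idealActX K)) (integralClasses σ) e (restrictRep α)
      (classIsometry σ)) {y : integralAdeles K} (hy : y ≠ 0) (a : C₀(SpaceX K, ℂ))
    (g : IdealGroup K) :
    diagCoeff y (restrictRep α a * fracIsometry _ h.exists_fraction (classIsometry σ) g) =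
      (Finsupp.single g a : IdealGroup K →₀ C₀(SpaceX K, ℂ)) 1 (toX (y : FinAdele K)) := by
  classical
  obtain ⟨p, ⟨m, hm⟩, q, ⟨k, hk⟩, rfl⟩ := h.exists_fraction g
  rw [h.fracIsometry_mul_inv ⟨m, hm⟩ ⟨k, hk⟩, classIsometry_eq hm, classIsometry_eq hk]
  have h1 : diagCoeff y (restrictRep α a *
      (star (RingCStarAlgebra.s k) * RingCStarAlgebra.s m)) =
        a (toX (y : FinAdele K)) * regS m (lp.single 2 y (1 : ℂ)) (mulInt k y) := by
    rw [diagCoeff, map_mul, map_mul, map_star, regularEval_s, regularEval_s,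
      show restrictRep α a = α (restrictHom a) from rfl, regularEval_functionRep hα,
      regular_mul_apply, regular_mul_apply, multiplicationRep_apply, star_regS_apply,
      restrictHom_apply]
  rw [h1, Finsupp.single_apply]
  by_cases hpq : p = q
  · subst hpq
    obtain rfl := intUnit_injective (hm.trans hk.symm)
    rw [if_pos (mul_inv_cancel p), regS_apply, lp.single_apply_self, mul_one]
  · rw [if_neg fun hpq' => hpq (mul_inv_eq_one.1 hpq')]
    have h2 : regS m (lp.single 2 y (1 : ℂ)) (mulInt k y) = 0 := by
      by_cases hr : mulInt k y ∈ Set.range (mulInt m)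
      · obtain ⟨w, hw⟩ := hr
        rw [← hw, regS_apply]
        refine lp.single_apply_ne 2 y 1 ?_
        rintro rfl
        obtain rfl := eq_of_mulInt_eq hy hw
        apply hpq
        rw [← hσ p, ← hσ q, ← hm, ← hk]
      · exact regS_apply_of_notMem _ hr
    rw [h2, mul_zero]
    rfl

/-- The point `0`, where freeness fails, is a limit of nonzero integers: every neighbourhood of it
contains some `m ô`, so the bound extends by continuity. -/
theorem norm_apply_toX_le {f : C₀(SpaceX K, ℂ)} {C : ℝ}
    (h : ∀ y : integralAdeles K, y ≠ 0 → ‖f (toX (y : FinAdele K))‖ ≤ C) {y : FinAdele K}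
    (hy : y ∈ integralAdeles K) : ‖f (toX y)‖ ≤ C := by
  by_cases h0 : y = 0
  · subst h0
    by_contra! hlt
    have hopen : IsOpen {y : FinAdele K | C < ‖f (toX y)‖} :=
      isOpen_lt continuous_const (f.continuous.comp continuous_toX).norm
    obtain ⟨m, hm⟩ := exists_multiples_subset hopen hlt
    have h1 : intAdele (m : 𝓞 K) ∈ multiples m := ⟨1, one_mem _, mul_one _⟩
    refine absurd (h ⟨_, intAdele_mem (m : 𝓞 K)⟩ ?_) (not_le.2 (hm h1))
    intro h2
    have h3 : intAdele (m : 𝓞 K) * 1 = intAdele (m : 𝓞 K) * 0 := by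
      rw [mul_one, mul_zero]
      exact congrArg Subtype.val h2
    exact one_ne_zero (intAdele_mul_injective m h3)
  · exact h ⟨y, hy⟩ fun h1 => h0 (congrArg Subtype.val h1)

/-- The covariant pair yields the homomorphism on the corner. The diagonal coefficients on `ℓ²(ô)`
bound the coefficient at the identity on `Y`, which is what injectivity needs. -/
theorem embedsInRingCStarAlgebra (hK : NumberField.classNumber K = 1)
    (hr : NumberField.InfinitePlace.nrRealPlaces K ≤ 1) (G : Subgroup Kˣ)
    (hG : IsTotallyPositive G) (hG' : ∀ x : Kˣ, x ∈ G ∨ -x ∈ G) :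
    EmbedsInRingCStarAlgebra G := by
  obtain ⟨σ, hσ⟩ := exists_section hK G hG'
  obtain ⟨α, hα⟩ := exists_functionRep (K := K)
  have hY : IsClopen (subsetY K) ∧ IsCompact (subsetY K) :=
    ⟨isClopen_subsetY, isCompact_subsetY hK hr⟩
  have hα' : ∀ m n, α (cosetIndicator m n) = RingCStarAlgebra.proj m n := fun m n =>
    hα m n _ fun _ => rfl
  have hσ' : ∀ z, (diagFin K (σ z) : IdealGroup K) = z := fun z => (hσ z).2
  have hpair := isCovariantPair_functionRep hY hσ'
    (fun z => finIdele_diagFin_mem _ (hG _ (hσ z).1)) hα'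
  obtain ⟨L, hL, hLe, Φ, hΦ⟩ := hpair.exists_cornerHom hpair.norm_sum_le_ring
    (isStarProjection_indicatorElt (idealActX K) (subsetY K))
  refine ⟨σ, hσ, α, hα, Φ, ?_, ?_⟩
  · refine injective_of_norm_coeff_le _ L Φ hΦ fun c => ?_
    have hcoeff : ∀ y : integralAdeles K, y ≠ 0 →
        diagCoeff y (L (CrossedProduct.ofFinsupp _ c)) = c 1 (toX (y : FinAdele K)) := by
      intro y hy
      induction c using Finsupp.induction_linear with
      | zero =>
        rw [map_zero, map_zero, diagCoeff_zero]
        rfl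
      | add c d hc hd =>
        rw [map_add, map_add, diagCoeff_add, hc, hd]
        rfl
      | single g a => rw [CrossedProduct.ofFinsupp_single, hL, diagCoeff_pair hσ' hα' hpair hy]
    have hle : ∀ y : integralAdeles K, y ≠ 0 →
        ‖c 1 (toX (y : FinAdele K))‖ ≤ ‖L (CrossedProduct.ofFinsupp _ c)‖ := fun y hy => by
      rw [← hcoeff y hy]
      exact norm_diagCoeff_le _ _
    rw [← ZeroAtInftyContinuousMap.norm_toBCF_eq_norm,
      BoundedContinuousFunction.norm_le (norm_nonneg _)]
    intro x
    obtain ⟨y, rfl⟩ := surjective_toX hK hr x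
    change ‖indicatorC₀ (subsetY K) (toX y) * c 1 (toX y)‖ ≤ _
    rw [indicatorC₀_apply hY]
    by_cases hy : y ∈ integralAdeles K
    · rw [Set.indicator_of_mem ((toX_mem_subsetY y).2 hy), Pi.one_apply, one_mul]
      exact norm_apply_toX_le hle hy
    · rw [Set.indicator_of_notMem (mt (toX_mem_subsetY y).1 hy), zero_mul, norm_zero]
      exact norm_nonneg _
  · intro f z a b hab
    have h1 : Φ (bostConnesElt f z) = L (CrossedProduct.mk _ f z) :=
      (hΦ (bostConnesElt f z)).trans (hLe _)
    refine h1.trans ?_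
    rw [hL]
    change α (restrictToIntegral f) * _ = _
    congr 1
    -- The chosen fraction `m / k` and the given fraction `a / b` both equal `σ z`, so they define
    -- the same element of `𝔄[o]`.
    obtain ⟨p, ⟨m, hm⟩, q, ⟨k, hk⟩, rfl⟩ := hpair.exists_fraction z
    rw [hpair.fracIsometry_mul_inv ⟨m, hm⟩ ⟨k, hk⟩, classIsometry_eq hm, classIsometry_eq hk]
    refine RingCStarAlgebra.star_s_mul_s_eq (intUnit_injective ?_)
    have hab' : σ p * (σ q)⁻¹ = intUnit a * (intUnit b)⁻¹ := by
      rw [← map_inv, ← map_mul]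
      refine Units.ext (hab.trans ?_)
      rw [div_eq_mul_inv, Units.val_mul, Units.val_inv_eq_inv_val]
      rfl
    rw [intUnit_mul, intUnit_mul, hm, hk]
    exact mul_inv_eq_mul_inv_iff_mul_eq_mul.1 hab'

end Embedding

end BostConnes

end

/-! ### The main theorem -/

theorem mainTheorem6 (K : Type*) [Field K] [NumberField K]
    (hK : NumberField.classNumber K = 1)
    (hr : NumberField.InfinitePlace.nrRealPlaces K ≤ 1) :
    (IsClopen (BostConnes.subsetY K) ∧ IsCompact (BostConnes.subsetY K)) ∧
    (IsClopen (BostConnes.integralQuot K) ∧ IsCompact (BostConnes.integralQuot K)) ∧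
    (∀ h0 : NumberField.InfinitePlace.nrRealPlaces K = 0,
      BostConnes.PhiStarInducesIsos (⊤ : Subgroup Kˣ) (BostConnes.isTotallyPositive_top h0) ∧
      BostConnes.EmbedsInRingCStarAlgebra (⊤ : Subgroup Kˣ)) ∧
    (∀ σ : K →+* ℝ,
      BostConnes.PhiStarInducesIsos (BostConnes.positiveScalars σ)
        (BostConnes.isTotallyPositive_positiveScalars hr σ) ∧
      BostConnes.EmbedsInRingCStarAlgebra (BostConnes.positiveScalars σ)) := by
  refine ⟨⟨BostConnes.isClopen_subsetY, BostConnes.isCompact_subsetY hK hr⟩,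
    ⟨BostConnes.isClopen_integralQuot, BostConnes.isCompact_integralQuot⟩,
    fun h0 => ?_, fun σ => ?_⟩
  · have hG' : ∀ x : Kˣ, x ∈ (⊤ : Subgroup Kˣ) ∨ -x ∈ (⊤ : Subgroup Kˣ) := fun _ => Or.inl trivial
    exact ⟨BostConnes.phiStarInducesIsos hK hr _ _ hG', BostConnes.embedsInRingCStarAlgebra hK hr _
      (BostConnes.isTotallyPositive_top h0) hG'⟩
  · have hG' : ∀ x : Kˣ, x ∈ BostConnes.positiveScalars σ ∨ -x ∈ BostConnes.positiveScalars σ := by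
      intro x
      rcases lt_or_gt_of_ne ((map_ne_zero σ).2 x.ne_zero) with h | h
      · refine Or.inr ?_
        change 0 < σ ((-x : Kˣ) : K)
        rw [Units.val_neg, map_neg]
        exact neg_pos.2 h
      · exact Or.inl h
    exact ⟨BostConnes.phiStarInducesIsos hK hr _ _ hG', BostConnes.embedsInRingCStarAlgebra hK hr _
      (BostConnes.isTotallyPositive_positiveScalars hr σ) hG'⟩
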